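/- **Proposition (Lax pair for $\Psi$).** Let $N>1$, let $a_1<\dots<a_N$ be real, and let $k_0,\dots,k_N\in[0,1]$ with $k_0=k_N=0$ and $k_{j-1}\neq k_j$ for $1\le j\le N$. For $\tau,x\in\mathbb R$ put $\theta_x(\mu)=\frac{\mu^4}{4}-\frac{\tau\mu^2}{2}-x\mu$. Fix $c>0$. Let $\Sigma_+$ be the union of the two rays from $c$ in the directions $e^{\pm i\pi/4}$, oriented downwards, $\Sigma_-=-\Sigma_+$ the union of the two rays from $-c$ in the directions $e^{\pm 3i\pi/4}$, oriented upwards, $\Sigma=\Sigma_+\cup\Sigma_-$, and orient $i\mathbb R$ upwards. For real $s,\tau$ let $$J(\mu)=\begin{pmatrix}1&g^T(\mu)\\ f(\mu)&I_N\end{pmatrix},\quad f_j(\mu)=-\sqrt{k_j-k_{j-1}}\,e^{-\theta_{a_j+s}(\mu)}\chi_{i\mathbb R}(\mu),\quad g_j(\mu)=-\sqrt{k_j-k_{j-1}}\,e^{\theta_{a_j+s}(\mu)}\chi_{\Sigma}(\mu)$$ (principal complex square root). A matrix function $\Gamma$ solves the Riemann–Hilbert problem (RHP) at $(s,\tau)$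 if * $\Gamma:\mathbb C\setminus(\Sigma\cup i\mathbb R)\to GL_{N+1}(\mathbb C)$ is analytic; * $\Gamma$ is continuous up to the contour from each side, and its boundary values from the left ($+$) and from the right ($-$) satisfy $\Gamma_+=\Gamma_-J$ on $\Sigma\cup i\mathbb R$; * there are matrices $\Gamma_1,\Gamma_2,\dots$ such that, for every $n\ge 0$, $\Gamma(\mu)=I_{N+1}+\sum_{j=1}^n\Gamma_j\mu^{-j}+\mathcal O(\mu^{-n-1})$ as $\mu\to\infty$ off the contour. Write $\Gamma_1=\begin{pmatrix}-\delta&p^T\\ q&\Delta\end{pmatrix}$ in blocks of sizes $1$ and $N$. Let $U\subseteq\mathbb R^2$ be open and, for each $(s,\tau)\in U$, let $\Gamma=\Gamma(\cdot\,;s,\tau)$ solve the RHP at $(s,\tau)$. Put $\Psi=\Gamma T$ with $$T(\mu)=e^{\frac1{N+1}\sum_{j=1}^N\theta_{a_j+s}(\mu)}\,\mathrm{diag}\bigl(1,e^{-\theta_{a_1+s}(\mu)},\dots,e^{-\theta_{a_N+s}(\mu)}\bigr).$$ Then, for all $(s,\tau)\in U$ and all $\mu\in\mathbb C\setminus(\Sigma\cup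 i\mathbb R)$, $\Psi$ is differentiable in $s$, in $\mu$ and in $\tau$, and $$\partial_s\Psi=A\Psi,\qquad \partial_\mu\Psi=B\Psi,\qquad \partial_\tau\Psi=C\Psi,$$ where $$A(\mu)=\mu A_1+A_0,\qquad A_1=\frac1{N+1}\begin{pmatrix}-N&0\\0&I_N\end{pmatrix},\qquad A_0=\begin{pmatrix}0&p^T\\-q&0\end{pmatrix},$$ $$B(\mu)=\mu^3\tilde B_3+\mu^2B_2+\mu(\tilde B_1+B_1)+\tilde B_0+B_0,\qquad C(\mu)=\frac{\mu^2}{2}A_1+\mu C_1+C_0,$$ $$\tilde B_3=-A_1,\quad \tilde B_1=\tau A_1,\quad \tilde B_0=sA_1+\frac1{N+1}\mathrm{diag}\Bigl(-\sum_{j}a_j,\;Na_1-\sum_{j\ne1}a_j,\;\dots,\;Na_N-\sum_{j\neq N}a_j\Bigr),$$ and the remaining coefficients depend on the $\Gamma_j$ as follows: with $X_1=[\Gamma_1,A_1]$, $X_2=[\Gamma_2,A_1]-X_1\Gamma_1$ and $X_3=[\Gamma_3,A_1]-X_1\Gamma_2-X_2\Gamma_1$, $$B_2=-X_1,\quad B_1=-X_2,\quad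 B_0=\tau X_1-X_3,\qquad C_1=\tfrac12X_1,\quad C_0=\tfrac12X_2 .$$ -/

import Mathlib

open Filter Topology Matrix

namespace Pearcey

/-- Square complex matrices of size `N + 1`, partitioned in blocks of sizes `1 × 1`, `1 × N`,
`N × 1` and `N × N`. -/
abbrev Mat (N : ℕ) : Type := Matrix (Unit ⊕ Fin N) (Unit ⊕ Fin N) ℂ

/-! ### The contour

The contour is the union of the imaginary axis, oriented upwards, and `Σ = Σ₊ ∪ Σ₋`, where (for a
fixed `c > 0`) `Σ₊` consists of the two rays from `c` in the directions `exp (± i π / 4)`, oriented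
downwards (from `exp (i π / 4) ∞` to `exp (- i π / 4) ∞`), and `Σ₋ = - Σ₊` consists of the two rays
from `- c` in the directions `exp (± 3 i π / 4)`, oriented upwards. -/

def imAxis : Set ℂ := {z | z.re = 0}

def sigmaPlus (c : ℝ) : Set ℂ := {z | z.re = c + |z.im|}

def sigmaMinus (c : ℝ) : Set ℂ := {z | z.re = -(c + |z.im|)}

def sigma (c : ℝ) : Set ℂ := sigmaPlus c ∪ sigmaMinus c

def contour (c : ℝ) : Set ℂ := sigma c ∪ imAxis

/-- The component of the complement of the contour to the right of `Σ₊`. -/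
def outerRight (c : ℝ) : Set ℂ := {z | c + |z.im| < z.re}

/-- The component of the complement of the contour between the imaginary axis and `Σ₊`. -/
def innerRight (c : ℝ) : Set ℂ := {z | 0 < z.re ∧ z.re < c + |z.im|}

/-- The component of the complement of the contour between `Σ₋` and the imaginary axis. -/
def innerLeft (c : ℝ) : Set ℂ := {z | -(c + |z.im|) < z.re ∧ z.re < 0}

/-- The component of the complement of the contour to the left of `Σ₋`. -/
def outerLeft (c : ℝ) : Set ℂ := {z | z.re < -(c + |z.im|)}

section

variable {N : ℕ}

/-- The phase `θ_x(μ) = μ⁴ / 4 - τ μ² / 2 - x μ`. -/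
noncomputable def theta (τ x : ℝ) (μ : ℂ) : ℂ := μ ^ 4 / 4 - τ * μ ^ 2 / 2 - x * μ

/-- `√(k_j - k_{j-1})`, the principal complex root (the difference may be negative). -/
noncomputable def rootDiff (k : Fin (N + 1) → ℝ) (j : Fin N) : ℂ :=
  ((k j.succ - k j.castSucc : ℝ) : ℂ) ^ (1 / 2 : ℂ)

/-- The column `f`, supported on the imaginary axis. -/
noncomputable def fVec (a : Fin N → ℝ) (k : Fin (N + 1) → ℝ) (s τ : ℝ) (μ : ℂ) (j : Fin N) : ℂ :=
  imAxis.indicator (fun ν => -rootDiff k j * Complex.exp (-theta τ (a j + s) ν)) μ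

/-- The column `g`, supported on `Σ`. -/
noncomputable def gVec (c : ℝ) (a : Fin N → ℝ) (k : Fin (N + 1) → ℝ) (s τ : ℝ) (μ : ℂ)
    (j : Fin N) : ℂ :=
  (sigma c).indicator (fun ν => -rootDiff k j * Complex.exp (theta τ (a j + s) ν)) μ

/-- The jump matrix `J = [[1, gᵀ], [f, I]]`. -/
noncomputable def jump (c : ℝ) (a : Fin N → ℝ) (k : Fin (N + 1) → ℝ) (s τ : ℝ) (μ : ℂ) : Mat N :=
  fromBlocks 1 (replicateRow Unit (gVec c a k s τ μ)) (replicateCol Unit (fVec a k s τ μ)) 1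

/-- `Γ` has continuous boundary values on `S` from `Ωp` (the left side of `S`) and from `Ωm` (the
right side of `S`), and they satisfy `Γ₊ = Γ₋ J` on `S`. -/
def HasJumpOn (Γ : ℂ → Mat N) (J : ℂ → Mat N) (S Ωp Ωm : Set ℂ) : Prop :=
  ∀ μ ∈ S, ∃ Γp Γm : Mat N,
    Tendsto Γ (𝓝[Ωp] μ) (𝓝 Γp) ∧ Tendsto Γ (𝓝[Ωm] μ) (𝓝 Γm) ∧ Γp = Γm * J μ

/-- `Γ` solves the Riemann-Hilbert problem with parameters `a`, `k`, `s`, `τ`, and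
`I + ∑_{j ≥ 1} G j / μ ^ j` is its asymptotic expansion at infinity. -/
structure IsRHPSolution (c : ℝ) (a : Fin N → ℝ) (k : Fin (N + 1) → ℝ) (s τ : ℝ)
    (Γ : ℂ → Mat N) (G : ℕ → Mat N) : Prop where
  analytic : ∀ i j, AnalyticOnNhd ℂ (fun μ => Γ μ i j) (contour c)ᶜ
  invertible : ∀ μ ∈ (contour c)ᶜ, IsUnit (Γ μ)
  jump_imAxis : HasJumpOn Γ (jump c a k s τ) imAxis (innerLeft c) (innerRight c)
  jump_sigmaPlus : HasJumpOn Γ (jump c a k s τ) (sigmaPlus c) (outerRight c) (innerRight c)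
  jump_sigmaMinus : HasJumpOn Γ (jump c a k s τ) (sigmaMinus c) (outerLeft c) (innerLeft c)
  coeff_zero : G 0 = 1
  asymptotic : ∀ (n : ℕ) (i j : Unit ⊕ Fin N),
    (fun μ : ℂ => Γ μ i j - ∑ m ∈ Finset.range (n + 1), G m i j / μ ^ m)
      =O[Bornology.cobounded ℂ ⊓ 𝓟 (contour c)ᶜ] (fun μ : ℂ => (μ ^ (n + 1))⁻¹)

/-- The gauge matrix `T(μ)`. -/
noncomputable def gauge (a : Fin N → ℝ) (s τ : ℝ) (μ : ℂ) : Mat N :=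
  Complex.exp (1 / ((N : ℂ) + 1) * ∑ j, theta τ (a j + s) μ) •
    diagonal (Sum.elim (fun _ => 1) (fun j => Complex.exp (-theta τ (a j + s) μ)))

/-- `Ψ(μ) = Γ(μ) T(μ)` at the parameters `s`, `τ`, for a family `Γ` of functions. -/
noncomputable def Psi (a : Fin N → ℝ) (Γ : ℝ → ℝ → ℂ → Mat N) (s τ : ℝ) (μ : ℂ) : Mat N :=
  Γ s τ μ * gauge a s τ μ

/-! ### The coefficient matrices of the Lax pair -/

/-- `A₁ = (N + 1)⁻¹ diag(-N, 1, …, 1)`. -/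
noncomputable def A₁ (N : ℕ) : Mat N :=
  (1 / ((N : ℂ) + 1)) • fromBlocks (-(N : ℂ) • 1) 0 0 1

/-- `A₀ = [[0, pᵀ], [-q, 0]]`, where `pᵀ` and `q` are the off-diagonal blocks of `Γ₁`. -/
def A₀ (Γ₁ : Mat N) : Mat N := fromBlocks 0 Γ₁.toBlocks₁₂ (-Γ₁.toBlocks₂₁) 0

noncomputable def laxA (Γ₁ : Mat N) (μ : ℂ) : Mat N := μ • A₁ N + A₀ Γ₁

/-- `X₁ = [Γ₁, A₁]`. -/
noncomputable def X₁ (Γ₁ : Mat N) : Mat N := Γ₁ * A₁ N - A₁ N * Γ₁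

/-- `X₂ = [Γ₂, A₁] - X₁ Γ₁`. -/
noncomputable def X₂ (Γ₁ Γ₂ : Mat N) : Mat N := Γ₂ * A₁ N - A₁ N * Γ₂ - X₁ Γ₁ * Γ₁

/-- `X₃ = [Γ₃, A₁] - X₁ Γ₂ - X₂ Γ₁`. -/
noncomputable def X₃ (Γ₁ Γ₂ Γ₃ : Mat N) : Mat N :=
  Γ₃ * A₁ N - A₁ N * Γ₃ - X₁ Γ₁ * Γ₂ - X₂ Γ₁ Γ₂ * Γ₁

noncomputable def tildeB₃ (N : ℕ) : Mat N := -A₁ N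

noncomputable def tildeB₁ (N : ℕ) (τ : ℝ) : Mat N := (τ : ℂ) • A₁ N

noncomputable def tildeB₀ (a : Fin N → ℝ) (s : ℝ) : Mat N :=
  (s : ℂ) • A₁ N + (1 / ((N : ℂ) + 1)) •
    diagonal (Sum.elim (fun _ => -∑ j, (a j : ℂ))
      (fun i => (N : ℂ) * (a i : ℂ) - ∑ j ∈ Finset.univ.erase i, (a j : ℂ)))

noncomputable def B₂ (Γ₁ : Mat N) : Mat N := -X₁ Γ₁

noncomputable def B₁ (Γ₁ Γ₂ : Mat N) : Mat N := -X₂ Γ₁ Γ₂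

noncomputable def B₀ (τ : ℝ) (Γ₁ Γ₂ Γ₃ : Mat N) : Mat N := (τ : ℂ) • X₁ Γ₁ - X₃ Γ₁ Γ₂ Γ₃

noncomputable def laxB (a : Fin N → ℝ) (s τ : ℝ) (Γ₁ Γ₂ Γ₃ : Mat N) (μ : ℂ) : Mat N :=
  μ ^ 3 • tildeB₃ N + μ ^ 2 • B₂ Γ₁ + μ • (tildeB₁ N τ + B₁ Γ₁ Γ₂)
    + (tildeB₀ a s + B₀ τ Γ₁ Γ₂ Γ₃)

noncomputable def C₁ (Γ₁ : Mat N) : Mat N := (1 / 2 : ℂ) • X₁ Γ₁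

noncomputable def C₀ (Γ₁ Γ₂ : Mat N) : Mat N := (1 / 2 : ℂ) • X₂ Γ₁ Γ₂

noncomputable def laxC (Γ₁ Γ₂ : Mat N) (μ : ℂ) : Mat N :=
  (μ ^ 2 / 2) • A₁ N + μ • C₁ Γ₁ + C₀ Γ₁ Γ₂

end

end Pearcey

/-! Conjugated by `T`, the jump matrix is constant on the imaginary axis and on `Σ`, in `μ` and in
the parameters. So a derivative of `Ψ` times `Ψ⁻¹` has no jump and is entire. The Lax matrices `P`
are the polynomials for which `Γ · (∂T T⁻¹) - P Γ = O(1/μ)`, which is what the recursion for `X₁`,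
`X₂`, `X₃` expresses, and Liouville's theorem then gives `∂Ψ = P Ψ`.

To make this precise, put `J = 1 + F` on the imaginary axis and `J = 1 + G` on `Σ`. Both `F` and `G`
are entire with square zero, so `Γ` restricted to the inner right region continues to an entire
function `E`, and on every region `Γ` is `E` times a product of jump factors
(`exists_entire_extension`, by Morera and removable singularities at `±c`). Since `det E` is entire
and tends to `1`, it equals `1`, and `E` has an entire inverse (`exists_isExtension`).

Two difficulties remain. The available estimates blow up like the inverse distance to the contour:
Cauchy's estimate for `∂_μ Γ`, and Cauchy integrals for the comparison of two solutions. Liouville's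
theorem is therefore replaced by `norm_le_of_norm_le_add_div_infDist`, a maximum principle on
rectangles that tolerates this singularity at the six points where the contour crosses the boundary.

Also, nothing is assumed about how `Γ` depends on `s` and `τ`, so differentiability has to be
proved. This is a stability statement, `norm_ratio_sub_one_le`: if the jumps at two parameters
differ by `κ / (1 + t²)`, the quotient of the solutions is `1 + O(κ / dist)`. The Cauchy integral of
the jump of the quotient (`norm_sub_le_of_jump`) involves the unknown solution on the contour. The
columns that occur there continue holomorphically across it, so Phragmén–Lindelöf bounds them by
values on `Re z = ±c/2`, and for small `κ` the bound closes on itself. With `D = T_t T_0⁻¹`, the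
difference quotient `t⁻¹ (E_t D E_0⁻¹ - 1) - P` is entire, and the maximum principle shows that it
tends to `0` (`tendsto_deformation`). -/

namespace Pearcey

/-! ### Integrals along segments and Cauchy's theorem on convex sets. -/

section SegmentIntegral

variable {F : Type*} [NormedAddCommGroup F] [NormedSpace ℂ F]

/-- The integral of `H` along the segment from `p` to `q`. -/
noncomputable def segInt (H : ℂ → F) (p q : ℂ) : F :=
  ∫ t in (0 : ℝ)..1, (q - p) • H (p + t * (q - p))

lemma add_mul_sub_mem {K : Set ℂ} (hK : Convex ℝ K) {p q : ℂ} (hp : p ∈ K) (hq : q ∈ K) {t : ℝ}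
    (ht : t ∈ Set.Icc (0 : ℝ) 1) : p + t * (q - p) ∈ K := by
  have := hK.add_smul_sub_mem hp hq ht
  simpa [Complex.real_smul] using this

lemma continuousOn_segInt {K : Set ℂ} (hK : Convex ℝ K) {H : ℂ → F} (hH : ContinuousOn H K)
    {p q : ℂ} (hp : p ∈ K) (hq : q ∈ K) :
    ContinuousOn (fun t : ℝ => (q - p) • H (p + t * (q - p))) (Set.Icc 0 1) := by
  refine ContinuousOn.const_smul (hH.comp (by fun_prop) fun t ht => ?_) _
  exact add_mul_sub_mem hK hp hq ht

lemma intervalIntegrable_segInt {K : Set ℂ} (hK : Convex ℝ K) {H : ℂ → F} (hH : ContinuousOn H K)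
    {p q : ℂ} (hp : p ∈ K) (hq : q ∈ K) :
    IntervalIntegrable (fun t : ℝ => (q - p) • H (p + t * (q - p))) MeasureTheory.volume 0 1 :=
  ContinuousOn.intervalIntegrable (by
    simpa [Set.uIcc_of_le zero_le_one] using continuousOn_segInt hK hH hp hq)

lemma segInt_sub {K : Set ℂ} (hK : Convex ℝ K) {H H' : ℂ → F} (hH : ContinuousOn H K)
    (hH' : ContinuousOn H' K) {p q : ℂ} (hp : p ∈ K) (hq : q ∈ K) :
    segInt (fun z => H z - H' z) p q = segInt H p q - segInt H' p q := by
  unfold segInt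
  rw [← intervalIntegral.integral_sub (intervalIntegrable_segInt hK hH hp hq)
    (intervalIntegrable_segInt hK hH' hp hq)]
  simp only [smul_sub]

lemma segInt_symm (H : ℂ → F) (p q : ℂ) : segInt H q p = -segInt H p q := by
  unfold segInt
  have := intervalIntegral.integral_comp_sub_left (a := 0) (b := 1)
    (fun t : ℝ => (p - q) • H (q + t * (p - q))) 1
  simp only [sub_self, sub_zero] at this
  rw [← this, ← intervalIntegral.integral_neg]
  congr 1
  ext t
  rw [← neg_smul]
  congr 2 <;> push_cast <;> ring

lemma segInt_comp_neg (H : ℂ → F) (p q : ℂ) :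
    segInt (fun z => -H (-z)) p q = segInt H (-p) (-q) := by
  unfold segInt
  congr 1
  ext t
  rw [smul_neg, ← neg_smul]
  congr 2 <;> ring

lemma norm_segInt_le {H : ℂ → F} {p q : ℂ} {δ : ℝ}
    (h : ∀ t ∈ Set.Icc (0 : ℝ) 1, ‖H (p + t * (q - p))‖ ≤ δ) :
    ‖segInt H p q‖ ≤ ‖q - p‖ * δ := by
  have := intervalIntegral.norm_integral_le_of_norm_le_const (a := (0 : ℝ)) (b := 1)
    (f := fun t : ℝ => (q - p) • H (p + t * (q - p))) (C := ‖q - p‖ * δ) (fun t ht => by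
      rw [norm_smul]
      rw [Set.uIoc_of_le zero_le_one] at ht
      exact mul_le_mul_of_nonneg_left (h t ⟨ht.1.le, ht.2⟩) (norm_nonneg _))
  simpa [segInt] using this

variable [CompleteSpace F]

lemma segInt_eq_sub {K : Set ℂ} (hK : Convex ℝ K) {H Φ : ℂ → F} (hH : ContinuousOn H K)
    (hΦ : ∀ z ∈ K, HasDerivWithinAt Φ (H z) K z) {p q : ℂ} (hp : p ∈ K) (hq : q ∈ K) :
    segInt H p q = Φ q - Φ p := by
  have hline : ∀ t : ℝ, HasDerivAt (fun t : ℝ => p + t * (q - p)) (q - p) t := fun t => by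
    simpa using ((hasDerivAt_id t).ofReal_comp.mul_const (q - p)).const_add p
  have key : ∀ t ∈ Set.Icc (0 : ℝ) 1, HasDerivWithinAt (fun t : ℝ => Φ (p + t * (q - p)))
      ((q - p) • H (p + t * (q - p))) (Set.Icc 0 1) t := fun t ht =>
    (hΦ _ (add_mul_sub_mem hK hp hq ht)).scomp t (hline t).hasDerivWithinAt
      fun u hu => add_mul_sub_mem hK hp hq hu
  have := intervalIntegral.integral_eq_sub_of_hasDerivAt_of_le (zero_le_one' ℝ)
    (fun t ht => (key t ht).continuousWithinAt)
    (fun t ht => (key t ⟨ht.1.le, ht.2.le⟩).hasDerivAt (Icc_mem_nhds ht.1 ht.2))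
    (intervalIntegrable_segInt hK hH hp hq)
  simpa [segInt] using this

/-- A holomorphic function on a convex set has a primitive there, up to the boundary. This is the
only form of Cauchy's theorem needed for the contour integrals. -/
lemma segInt_add_segInt {K : Set ℂ} (hK : Convex ℝ K) {H : ℂ → F} (hH : DifferentiableOn ℂ H K)
    {p q r : ℂ} (hp : p ∈ K) (hq : q ∈ K) (hr : r ∈ K) :
    segInt H p q + segInt H q r = segInt H p r := by
  obtain ⟨Φ, hΦ⟩ := hK.exists_forall_hasDerivWithinAt hH
  rw [segInt_eq_sub hK hH.continuousOn hΦ hp hq, segInt_eq_sub hK hH.continuousOn hΦ hq hr,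
    segInt_eq_sub hK hH.continuousOn hΦ hp hr]
  abel

end SegmentIntegral

/-! ### Cauchy's formula for the right half of the contour -/

lemma convex_wedge (c : ℝ) : Convex ℝ {z : ℂ | c + |z.im| ≤ z.re} := by
  intro z hz w hw s t hs ht hst
  simp only [Set.mem_ofPred_eq] at hz hw
  simp only [Set.mem_ofPred_eq, Complex.add_re, Complex.add_im, Complex.real_smul,
    Complex.mul_re, Complex.mul_im, Complex.ofReal_re, Complex.ofReal_im, zero_mul, sub_zero,
    add_zero]
  have h1 := abs_add_le (s * z.im) (t * w.im)
  rw [abs_mul, abs_mul, abs_of_nonneg hs, abs_of_nonneg ht] at h1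
  have h2 := mul_le_mul_of_nonneg_left hz hs
  have h3 := mul_le_mul_of_nonneg_left hw ht
  have h4 : c = s * c + t * c := by rw [← add_mul, hst, one_mul]
  nlinarith

lemma convex_upper (c : ℝ) : Convex ℝ {z : ℂ | 0 ≤ z.re ∧ 0 ≤ z.im ∧ z.re ≤ c + z.im} := by
  intro z hz w hw s t hs ht hst
  simp only [Set.mem_ofPred_eq] at hz hw
  simp only [Set.mem_ofPred_eq, Complex.add_re, Complex.add_im, Complex.real_smul,
    Complex.mul_re, Complex.mul_im, Complex.ofReal_re, Complex.ofReal_im, zero_mul, sub_zero,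
    add_zero]
  have h2 := mul_le_mul_of_nonneg_left hz.2.2 hs
  have h3 := mul_le_mul_of_nonneg_left hw.2.2 ht
  have h4 : c = s * c + t * c := by rw [← add_mul, hst, one_mul]
  exact ⟨add_nonneg (mul_nonneg hs hz.1) (mul_nonneg ht hw.1),
    add_nonneg (mul_nonneg hs hz.2.1) (mul_nonneg ht hw.2.1), by nlinarith⟩

lemma convex_lower (c : ℝ) : Convex ℝ {z : ℂ | 0 ≤ z.re ∧ z.im ≤ 0 ∧ z.re ≤ c - z.im} := by
  intro z hz w hw s t hs ht hst
  simp only [Set.mem_ofPred_eq] at hz hw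
  simp only [Set.mem_ofPred_eq, Complex.add_re, Complex.add_im, Complex.real_smul,
    Complex.mul_re, Complex.mul_im, Complex.ofReal_re, Complex.ofReal_im, zero_mul, sub_zero,
    add_zero]
  have h2 := mul_le_mul_of_nonneg_left hz.2.2 hs
  have h3 := mul_le_mul_of_nonneg_left hw.2.2 ht
  have h4 : c = s * c + t * c := by rw [← add_mul, hst, one_mul]
  exact ⟨add_nonneg (mul_nonneg hs hz.1) (mul_nonneg ht hw.1),
    by nlinarith [mul_nonneg hs (neg_nonneg.2 hz.2.1), mul_nonneg ht (neg_nonneg.2 hw.2.1)],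
    by nlinarith⟩

section HalfContour

variable {F : Type*} [NormedAddCommGroup F] [NormedSpace ℂ F]

lemma integral_inv_one_add_sq_le (ρ : ℝ) : ∫ u in (0 : ℝ)..ρ, (1 + u ^ 2)⁻¹ ≤ Real.pi / 2 := by
  rw [integral_inv_one_add_sq]
  simpa using (Real.arctan_lt_pi_div_two ρ).le

/-- The weight `(1 + t²)⁻¹` has integral at most `π / 2` on any `[0, ρ]`, so the bound does not
depend on the length of the truncated ray. -/
lemma norm_segInt_ray_le {H : ℂ → F} {p v : ℂ} {ρ η : ℝ} (hρ : 0 < ρ) (hη : 0 ≤ η)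
    (h : ∀ t : ℝ, 0 ≤ t → ‖H (p + t * v)‖ ≤ η * (1 + t ^ 2)⁻¹) :
    ‖segInt H p (p + ρ * v)‖ ≤ ‖v‖ * η * (Real.pi / 2) := by
  have hcont : Continuous fun u : ℝ => (1 + u ^ 2)⁻¹ :=
    Continuous.inv₀ (by fun_prop) fun u => by positivity
  have h1 : ‖segInt H p (p + ρ * v)‖ ≤
      ∫ t in (0 : ℝ)..1, ρ * (‖v‖ * η * (1 + (ρ * t) ^ 2)⁻¹) := by
    refine intervalIntegral.norm_integral_le_of_norm_le zero_le_one (MeasureTheory.ae_of_all _ fun t ht => ?_)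
      (Continuous.intervalIntegrable (by
        have := hcont.comp (continuous_const_mul ρ)
        simp only [Function.comp_def] at this
        fun_prop) _ _)
    have h2 := h (ρ * t) (mul_nonneg hρ.le ht.1.le)
    rw [norm_smul, add_sub_cancel_left, norm_mul, Complex.norm_real, Real.norm_of_nonneg hρ.le,
      show p + (t : ℂ) * (ρ * v) = p + ((ρ * t : ℝ) : ℂ) * v by push_cast; ring]
    calc ρ * ‖v‖ * ‖H (p + ((ρ * t : ℝ) : ℂ) * v)‖
        ≤ ρ * ‖v‖ * (η * (1 + (ρ * t) ^ 2)⁻¹) := by gcongr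
      _ = _ := by ring
  rw [intervalIntegral.integral_const_mul,
    intervalIntegral.integral_comp_mul_left (fun u => ‖v‖ * η * (1 + u ^ 2)⁻¹) hρ.ne',
    smul_eq_mul, ← mul_assoc, mul_inv_cancel₀ hρ.ne', one_mul,
    intervalIntegral.integral_const_mul, mul_zero, mul_one] at h1
  exact h1.trans (mul_le_mul_of_nonneg_left (integral_inv_one_add_sq_le ρ) (by positivity))

variable [CompleteSpace F]

/-- The inner right region is not convex, but cutting it along the real axis from `0` to `c` leaves
two convex pieces, and the wedge is convex already. The integrals along the cut cancel, and those
along the two rays combine into integrals of the jump `H' - H`. -/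
lemma segInt_right_half {c ρ : ℝ} (hc : 0 < c) (hρ : 0 < ρ) {H H' : ℂ → F}
    (hu : DifferentiableOn ℂ H {z | 0 ≤ z.re ∧ 0 ≤ z.im ∧ z.re ≤ c + z.im})
    (hl : DifferentiableOn ℂ H {z | 0 ≤ z.re ∧ z.im ≤ 0 ∧ z.re ≤ c - z.im})
    (hw : DifferentiableOn ℂ H' {z | c + |z.im| ≤ z.re}) :
    segInt H ⟨0, -ρ⟩ ⟨c + ρ, -ρ⟩ + segInt H' ⟨c + ρ, -ρ⟩ ⟨c + ρ, ρ⟩ + segInt H ⟨c + ρ, ρ⟩ ⟨0, ρ⟩ =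
      segInt H ⟨0, -ρ⟩ 0 + segInt H 0 ⟨0, ρ⟩ + segInt (fun z => H' z - H z) ⟨c, 0⟩ ⟨c + ρ, ρ⟩
        - segInt (fun z => H' z - H z) ⟨c, 0⟩ ⟨c + ρ, -ρ⟩ := by
  have hdu : Convex ℝ {z : ℂ | c + |z.im| = z.re ∧ 0 ≤ z.im} := by
    intro z hz w hw s t hs ht hst
    simp only [Set.mem_ofPred_eq] at hz hw
    rw [abs_of_nonneg hz.2] at hz
    rw [abs_of_nonneg hw.2] at hw
    have h0 : 0 ≤ s * z.im + t * w.im := add_nonneg (mul_nonneg hs hz.2) (mul_nonneg ht hw.2)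
    simp only [Set.mem_ofPred_eq, Complex.add_re, Complex.add_im, Complex.real_smul,
      Complex.mul_re, Complex.mul_im, Complex.ofReal_re, Complex.ofReal_im, zero_mul, sub_zero,
      add_zero]
    rw [abs_of_nonneg h0, ← hz.1, ← hw.1]
    exact ⟨by linear_combination -c * hst, h0⟩
  have hdl : Convex ℝ {z : ℂ | c + |z.im| = z.re ∧ z.im ≤ 0} := by
    intro z hz w hw s t hs ht hst
    simp only [Set.mem_ofPred_eq] at hz hw
    rw [abs_of_nonpos hz.2] at hz
    rw [abs_of_nonpos hw.2] at hw
    have h0 : s * z.im + t * w.im ≤ 0 := by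
      nlinarith [mul_nonneg hs (neg_nonneg.2 hz.2), mul_nonneg ht (neg_nonneg.2 hw.2)]
    simp only [Set.mem_ofPred_eq, Complex.add_re, Complex.add_im, Complex.real_smul,
      Complex.mul_re, Complex.mul_im, Complex.ofReal_re, Complex.ofReal_im, zero_mul, sub_zero,
      add_zero]
    rw [abs_of_nonpos h0, ← hz.1, ← hw.1]
    exact ⟨by linear_combination -c * hst, h0⟩
  have e1 : segInt (fun z => H' z - H z) ⟨c, 0⟩ ⟨c + ρ, ρ⟩ =
      segInt H' ⟨c, 0⟩ ⟨c + ρ, ρ⟩ - segInt H ⟨c, 0⟩ ⟨c + ρ, ρ⟩ := by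
    refine segInt_sub hdu (hw.continuousOn.mono fun z hz => hz.1.le)
      (hu.continuousOn.mono fun z hz => ?_) ?_ ?_
    · have := hz.1
      rw [abs_of_nonneg hz.2] at this
      exact ⟨by linarith [hz.2], hz.2, by linarith⟩
    · simp
    · simp [abs_of_pos hρ, hρ.le]
  have e2 : segInt (fun z => H' z - H z) ⟨c, 0⟩ ⟨c + ρ, -ρ⟩ =
      segInt H' ⟨c, 0⟩ ⟨c + ρ, -ρ⟩ - segInt H ⟨c, 0⟩ ⟨c + ρ, -ρ⟩ := by
    refine segInt_sub hdl (hw.continuousOn.mono fun z hz => hz.1.le)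
      (hl.continuousOn.mono fun z hz => ?_) ?_ ?_
    · have := hz.1
      rw [abs_of_nonpos hz.2] at this
      exact ⟨by linarith [hz.2], hz.2, by linarith⟩
    · simp
    · simp [abs_of_pos hρ, hρ.le]
  have u1 := segInt_add_segInt (convex_upper c) hu (p := 0) (q := ⟨c, 0⟩) (r := ⟨c + ρ, ρ⟩)
    (by simp [hc.le]) (by simp [hc.le]) (by simp; constructor <;> linarith)
  have u2 := segInt_add_segInt (convex_upper c) hu (p := 0) (q := ⟨c + ρ, ρ⟩) (r := ⟨0, ρ⟩)
    (by simp [hc.le]) (by simp; constructor <;> linarith) (by simp; constructor <;> linarith)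
  have l1 := segInt_add_segInt (convex_lower c) hl (p := 0) (q := ⟨c, 0⟩) (r := ⟨c + ρ, -ρ⟩)
    (by simp [hc.le]) (by simp [hc.le]) (by simp; constructor <;> linarith)
  have l2 := segInt_add_segInt (convex_lower c) hl (p := 0) (q := ⟨0, -ρ⟩) (r := ⟨c + ρ, -ρ⟩)
    (by simp [hc.le]) (by simp; constructor <;> linarith) (by simp; constructor <;> linarith)
  have w1 := segInt_add_segInt (convex_wedge c) hw (p := ⟨c, 0⟩) (q := ⟨c + ρ, -ρ⟩)
    (r := ⟨c + ρ, ρ⟩) (by simp) (by simp [abs_of_pos hρ]) (by simp [abs_of_pos hρ])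
  rw [e1, e2, segInt_symm H 0 ⟨0, -ρ⟩, ← u2, ← u1, ← w1]
  rw [← l1] at l2
  have l3 : segInt H ⟨0, -ρ⟩ ⟨c + ρ, -ρ⟩ =
      segInt H 0 ⟨c, 0⟩ + segInt H ⟨c, 0⟩ ⟨c + ρ, -ρ⟩ - segInt H 0 ⟨0, -ρ⟩ := by
    rw [← l2]; abel
  rw [l3]
  abel

end HalfContour

section CauchyBound

variable {F : Type*} [NormedAddCommGroup F] [NormedSpace ℂ F]

lemma hasDerivAt_log_smul (v : F) {z : ℂ} (hz : z ∈ Complex.slitPlane) :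
    HasDerivAt (fun z => Complex.log z • v) (z⁻¹ • v) z :=
  (Complex.hasDerivAt_log hz).smul_const v

variable [CompleteSpace F]

/-- On the slit plane `z⁻¹ • v` has the primitive `log z • v`; this isolates the leading term at
infinity. -/
lemma segInt_sub_inv_smul {K : Set ℂ} (hK : Convex ℝ K) (hKs : K ⊆ Complex.slitPlane) {H : ℂ → F}
    (hH : ContinuousOn H K) (v : F) {p q : ℂ} (hp : p ∈ K) (hq : q ∈ K) :
    segInt (fun z => H z - z⁻¹ • v) p q =
      segInt H p q - (Complex.log q • v - Complex.log p • v) := by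
  have hc : ContinuousOn (fun z : ℂ => z⁻¹ • v) K := fun z hz =>
    ((continuousAt_inv₀ (Complex.slitPlane_ne_zero (hKs hz))).smul
      continuousAt_const).continuousWithinAt
  rw [segInt_sub hK hH hc hp hq]
  congr 1
  exact segInt_eq_sub hK hc (fun z hz => (hasDerivAt_log_smul v (hKs hz)).hasDerivWithinAt) hp hq

lemma log_sub_log_im {ρ : ℝ} (hρ : 0 < ρ) :
    Complex.log ⟨0, ρ⟩ - Complex.log ⟨0, -ρ⟩ = Real.pi * Complex.I := by
  have h1 : (⟨0, ρ⟩ : ℂ) = ρ * Complex.I := by apply Complex.ext <;> simp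
  have h2 : (⟨0, -ρ⟩ : ℂ) = ρ * -Complex.I := by apply Complex.ext <;> simp
  rw [h1, h2, Complex.log_ofReal_mul hρ Complex.I_ne_zero,
    Complex.log_ofReal_mul hρ (neg_ne_zero.2 Complex.I_ne_zero), Complex.log_I, Complex.log_neg_I]
  ring

/-- On the three outer sides of the half rectangle the integrand is `v / z` up to `δ`, and `log`
increases by `π i` from `-iρ` to `iρ`. Cauchy's theorem turns the same integral into one along the
axis plus the jumps on the two rays, each at most `√2 η π / 2`. The outer sides have total length `2
(c + ρ) + 2 ρ`. -/
lemma norm_right_half_le {c ρ δ η : ℝ} (hc : 0 < c) (hρ : 0 < ρ) (hη : 0 ≤ η)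
    {H H' : ℂ → F}
    (hu : DifferentiableOn ℂ H {z | 0 ≤ z.re ∧ 0 ≤ z.im ∧ z.re ≤ c + z.im})
    (hl : DifferentiableOn ℂ H {z | 0 ≤ z.re ∧ z.im ≤ 0 ∧ z.re ≤ c - z.im})
    (hw : DifferentiableOn ℂ H' {z | c + |z.im| ≤ z.re}) (v : F)
    (hH : ∀ z : ℂ, 0 ≤ z.re → z.re ≤ c + ρ → |z.im| = ρ → ‖H z - z⁻¹ • v‖ ≤ δ)
    (hH' : ∀ z : ℂ, z.re = c + ρ → |z.im| ≤ ρ → ‖H' z - z⁻¹ • v‖ ≤ δ)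
    (hj : ∀ z : ℂ, z.re = c + |z.im| → ‖H' z - H z‖ ≤ η * (1 + z.im ^ 2)⁻¹) :
    ‖((Real.pi : ℂ) * Complex.I) • v - (segInt H ⟨0, -ρ⟩ 0 + segInt H 0 ⟨0, ρ⟩)‖ ≤
      4 * (c + ρ) * δ + √2 * Real.pi * η := by
  have key := segInt_right_half hc hρ hu hl hw
  have s1 := segInt_sub_inv_smul ((convex_lower c).inter (convex_halfSpace_im_lt 0))
    (fun z hz => Or.inr hz.2.ne) (hl.continuousOn.mono fun z hz => hz.1)
    v (p := ⟨0, -ρ⟩) (q := ⟨c + ρ, -ρ⟩)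
    ⟨by simp; constructor <;> linarith, by simpa using hρ⟩
    ⟨by simp; constructor <;> linarith, by simpa using hρ⟩
  have s3 := segInt_sub_inv_smul ((convex_upper c).inter (convex_halfSpace_im_gt 0))
    (fun z hz => Or.inr (ne_of_gt hz.2))
    (hu.continuousOn.mono fun z hz => hz.1)
    v (p := ⟨c + ρ, ρ⟩) (q := ⟨0, ρ⟩)
    ⟨by simp; constructor <;> linarith, by simpa using hρ⟩
    ⟨by simp; constructor <;> linarith, by simpa using hρ⟩
  have s2 := segInt_sub_inv_smul (convex_wedge c)
    (fun z hz => Or.inl (lt_of_lt_of_le (by positivity) hz)) hw.continuousOn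
    v (p := ⟨c + ρ, -ρ⟩) (q := ⟨c + ρ, ρ⟩) (by simp [abs_of_pos hρ]) (by simp [abs_of_pos hρ])
  have b1 : ‖segInt (fun z => H z - z⁻¹ • v) ⟨0, -ρ⟩ ⟨c + ρ, -ρ⟩‖ ≤ (c + ρ) * δ := by
    refine (norm_segInt_le (δ := δ) fun t ht => hH _ ?_ ?_ ?_).trans_eq ?_
    · simp; exact mul_nonneg ht.1 (by linarith)
    · simp; exact mul_le_of_le_one_left (by linarith) ht.2
    · simp [abs_of_pos hρ]
    · rw [show (⟨c + ρ, -ρ⟩ : ℂ) - ⟨0, -ρ⟩ = ((c + ρ : ℝ) : ℂ) by apply Complex.ext <;> simp,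
        Complex.norm_real, Real.norm_of_nonneg (by linarith)]
  have b3 : ‖segInt (fun z => H z - z⁻¹ • v) ⟨c + ρ, ρ⟩ ⟨0, ρ⟩‖ ≤ (c + ρ) * δ := by
    rw [segInt_symm, norm_neg]
    refine (norm_segInt_le (δ := δ) fun t ht => hH _ ?_ ?_ ?_).trans_eq ?_
    · simp; exact mul_nonneg ht.1 (by linarith)
    · simp; exact mul_le_of_le_one_left (by linarith) ht.2
    · simp [abs_of_pos hρ]
    · rw [show (⟨c + ρ, ρ⟩ : ℂ) - ⟨0, ρ⟩ = ((c + ρ : ℝ) : ℂ) by apply Complex.ext <;> simp,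
        Complex.norm_real, Real.norm_of_nonneg (by linarith)]
  have b2 : ‖segInt (fun z => H' z - z⁻¹ • v) ⟨c + ρ, -ρ⟩ ⟨c + ρ, ρ⟩‖ ≤ 2 * ρ * δ := by
    refine (norm_segInt_le (δ := δ) fun t ht => hH' _ ?_ ?_).trans_eq ?_
    · simp
    · simp only [Complex.add_im, Complex.mul_im, Complex.ofReal_re, Complex.sub_im, sub_neg_eq_add,
        Complex.ofReal_im, zero_mul, add_zero]
      rw [abs_le]
      constructor <;> nlinarith [ht.1, ht.2]
    · rw [show (⟨c + ρ, ρ⟩ : ℂ) - ⟨c + ρ, -ρ⟩ = ((2 * ρ : ℝ) : ℂ) * Complex.I by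
          apply Complex.ext <;> simp; ring, norm_mul,
        Complex.norm_real, Real.norm_of_nonneg (by linarith), Complex.norm_I, mul_one]
  have nv : ‖(⟨1, 1⟩ : ℂ)‖ = √2 := by
    rw [Complex.norm_def, Complex.normSq_mk]; norm_num
  have nv' : ‖(⟨1, -1⟩ : ℂ)‖ = √2 := by
    rw [Complex.norm_def, Complex.normSq_mk]; norm_num
  have b4 : ‖segInt (fun z => H' z - H z) ⟨c, 0⟩ ⟨c + ρ, ρ⟩‖ ≤ √2 * η * (Real.pi / 2) := by
    rw [show (⟨c + ρ, ρ⟩ : ℂ) = ⟨c, 0⟩ + ρ * ⟨1, 1⟩ by apply Complex.ext <;> simp, ← nv]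
    refine norm_segInt_ray_le hρ hη fun t ht => ?_
    simpa using hj (⟨c, 0⟩ + t * ⟨1, 1⟩) (by simp [abs_of_nonneg ht])
  have b5 : ‖segInt (fun z => H' z - H z) ⟨c, 0⟩ ⟨c + ρ, -ρ⟩‖ ≤ √2 * η * (Real.pi / 2) := by
    rw [show (⟨c + ρ, -ρ⟩ : ℂ) = ⟨c, 0⟩ + ρ * ⟨1, -1⟩ by apply Complex.ext <;> simp, ← nv']
    refine norm_segInt_ray_le hρ hη fun t ht => ?_
    simpa using hj (⟨c, 0⟩ + t * ⟨1, -1⟩) (by simp [abs_of_nonneg ht])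
  have hδ : 0 ≤ δ := (norm_nonneg _).trans (hH' ⟨c + ρ, 0⟩ rfl (by simp [hρ.le]))
  have e : ((Real.pi : ℂ) * Complex.I) • v - (segInt H ⟨0, -ρ⟩ 0 + segInt H 0 ⟨0, ρ⟩) =
      segInt (fun z => H' z - H z) ⟨c, 0⟩ ⟨c + ρ, ρ⟩
        - segInt (fun z => H' z - H z) ⟨c, 0⟩ ⟨c + ρ, -ρ⟩
        - (segInt (fun z => H z - z⁻¹ • v) ⟨0, -ρ⟩ ⟨c + ρ, -ρ⟩
          + segInt (fun z => H' z - z⁻¹ • v) ⟨c + ρ, -ρ⟩ ⟨c + ρ, ρ⟩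
          + segInt (fun z => H z - z⁻¹ • v) ⟨c + ρ, ρ⟩ ⟨0, ρ⟩) := by
    rw [s1, s2, s3, ← log_sub_log_im hρ, sub_smul]
    have key2 : segInt (fun z => H' z - H z) ⟨c, 0⟩ ⟨c + ρ, ρ⟩
        - segInt (fun z => H' z - H z) ⟨c, 0⟩ ⟨c + ρ, -ρ⟩ =
        segInt H ⟨0, -ρ⟩ ⟨c + ρ, -ρ⟩ + segInt H' ⟨c + ρ, -ρ⟩ ⟨c + ρ, ρ⟩
          + segInt H ⟨c + ρ, ρ⟩ ⟨0, ρ⟩ - (segInt H ⟨0, -ρ⟩ 0 + segInt H 0 ⟨0, ρ⟩) := by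
      rw [key]; abel
    rw [key2]
    abel
  rw [e]
  refine (norm_sub_le _ _).trans ?_
  have t1 := norm_sub_le (segInt (fun z => H' z - H z) ⟨c, 0⟩ ⟨c + ρ, ρ⟩)
    (segInt (fun z => H' z - H z) ⟨c, 0⟩ ⟨c + ρ, -ρ⟩)
  have t2 := norm_add₃_le (a := segInt (fun z => H z - z⁻¹ • v) ⟨0, -ρ⟩ ⟨c + ρ, -ρ⟩)
    (b := segInt (fun z => H' z - z⁻¹ • v) ⟨c + ρ, -ρ⟩ ⟨c + ρ, ρ⟩)
    (c := segInt (fun z => H z - z⁻¹ • v) ⟨c + ρ, ρ⟩ ⟨0, ρ⟩)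
  nlinarith [mul_nonneg hc.le hδ]

end CauchyBound

/-- The components of the complement of the contour. -/
inductive Region
  | outerRight
  | innerRight
  | innerLeft
  | outerLeft

namespace Region

/-- The open region. -/
def interior (c : ℝ) : Region → Set ℂ
  | outerRight => Pearcey.outerRight c
  | innerRight => Pearcey.innerRight c
  | innerLeft => Pearcey.innerLeft c
  | outerLeft => Pearcey.outerLeft c

/-- The closed region. -/
def closed (c : ℝ) : Region → Set ℂ
  | outerRight => {z | c + |z.im| ≤ z.re}
  | innerRight => {z | 0 ≤ z.re ∧ z.re ≤ c + |z.im|}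
  | innerLeft => {z | -(c + |z.im|) ≤ z.re ∧ z.re ≤ 0}
  | outerLeft => {z | z.re ≤ -(c + |z.im|)}

lemma interior_subset_closed (c : ℝ) (β : Region) : β.interior c ⊆ β.closed c := by
  cases β
  · exact fun z hz => le_of_lt (show c + |z.im| < z.re from hz)
  · exact fun z hz => ⟨hz.1.le, hz.2.le⟩
  · exact fun z hz => ⟨hz.1.le, hz.2.le⟩
  · exact fun z hz => le_of_lt (show z.re < -(c + |z.im|) from hz)

lemma notMem_closed {c : ℝ} (hc : 0 < c) {β γ : Region} (h : γ ≠ β) {z : ℂ}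
    (hz : z ∈ β.interior c) : z ∉ γ.closed c := by
  intro hz'
  have := abs_nonneg z.im
  cases β <;> cases γ <;>
    simp only [interior, closed, Pearcey.outerRight, Pearcey.innerRight, Pearcey.innerLeft,
      Pearcey.outerLeft, Set.mem_ofPred_eq, ne_eq, not_true_eq_false] at hz hz' h <;>
    grind

lemma mem_contour_iff {c : ℝ} {z : ℂ} :
    z ∈ contour c ↔ z.re = c + |z.im| ∨ z.re = -(c + |z.im|) ∨ z.re = 0 := by
  simp only [contour, sigma, sigmaPlus, sigmaMinus, imAxis, Set.mem_union, Set.mem_ofPred_eq,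
    or_assoc]

lemma exists_mem_interior {c : ℝ} {z : ℂ} (hz : z ∈ (contour c)ᶜ) :
    ∃ β : Region, z ∈ β.interior c := by
  rw [Set.mem_compl_iff, mem_contour_iff, not_or, not_or] at hz
  rcases lt_or_gt_of_ne hz.1 with h1 | h1
  · rcases lt_or_gt_of_ne hz.2.1 with h2 | h2
    · exact ⟨outerLeft, h2⟩
    · rcases lt_or_gt_of_ne hz.2.2 with h3 | h3
      · exact ⟨innerLeft, h2, h3⟩
      · exact ⟨innerRight, h3, h1⟩
  · exact ⟨outerRight, h1⟩

lemma interior_subset_compl {c : ℝ} (hc : 0 < c) (β : Region) : β.interior c ⊆ (contour c)ᶜ := by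
  intro z hz
  rw [Set.mem_compl_iff, mem_contour_iff]
  have := abs_nonneg z.im
  cases β <;>
    simp only [interior, Pearcey.outerRight, Pearcey.innerRight, Pearcey.innerLeft,
      Pearcey.outerLeft, Set.mem_ofPred_eq] at hz <;>
    grind

end Region

/-! ### Cauchy's formula on the whole contour: a small jump forces a nearly constant function. -/

section CauchyBound

variable {F : Type*} [NormedAddCommGroup F] [NormedSpace ℂ F] [CompleteSpace F]

open Classical in
/-- The difference quotient of `m γ` at `μ` with the value of `m β` at `μ`; for `γ = β` the
singularity at `μ` is removed. -/
noncomputable def quot (m : Region → ℂ → F) (β : Region) (μ : ℂ) (γ : Region) (z : ℂ) : F :=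
  if γ = β then dslope (m β) μ z else (z - μ)⁻¹ • (m γ z - m β μ)

omit [CompleteSpace F] in
lemma quot_of_ne (m : Region → ℂ → F) (β : Region) {μ : ℂ} (γ : Region) {z : ℂ} (hz : z ≠ μ) :
    quot m β μ γ z = (z - μ)⁻¹ • (m γ z - m β μ) := by
  unfold quot
  split_ifs with h
  · rw [dslope_of_ne _ hz, h, slope, vsub_eq_sub]
  · rfl

/-- The point `μ` lies in no closed region other than `β`, so the only pole is the removable one. -/
lemma differentiableOn_quot {c : ℝ} (hc : 0 < c) {m : Region → ℂ → F}
    (hm : ∀ γ, Differentiable ℂ (m γ)) {β : Region} {μ : ℂ} (hμ : μ ∈ β.interior c) (γ : Region) :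
    DifferentiableOn ℂ (quot m β μ γ) (γ.closed c) := by
  by_cases h : γ = β
  · have : quot m β μ γ = dslope (m β) μ := by
      ext z
      simp [quot, h]
    rw [this]
    exact ((Complex.differentiableOn_dslope univ_mem).2 (hm β).differentiableOn).mono
      (Set.subset_univ _)
  · have : quot m β μ γ = fun z => (z - μ)⁻¹ • (m γ z - m β μ) := by
      ext z
      simp [quot, h]
    rw [this]
    intro z hz
    have hne : z - μ ≠ 0 := sub_ne_zero.2 fun e => Region.notMem_closed hc h hμ (e ▸ hz)
    exact (((differentiableAt_id.sub_const μ).inv hne).smul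
      (((hm γ) z).sub_const _)).differentiableWithinAt

-- Expanding `(z - μ)⁻¹ = z⁻¹ + (z - μ)⁻¹ z⁻¹ μ`, the remainder is `O(ρ⁻²)`. Integrated over a
-- boundary of length `O(ρ)` it disappears as `ρ → ∞`, leaving the residue `L - m β μ`.
omit [CompleteSpace F] in
lemma norm_quot_sub_le {c : ℝ} {m : Region → ℂ → F} {L : F} {K r₀ ρ : ℝ} (hρ : 0 < ρ)
    (hK : ∀ γ : Region, ∀ z ∈ γ.closed c, r₀ ≤ ‖z‖ → ‖m γ z - L‖ ≤ K / ‖z‖) (β γ : Region)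
    {μ : ℂ} (h0 : r₀ ≤ ρ) (h1 : 2 * ‖μ‖ ≤ ρ) {z : ℂ} (hz : z ∈ γ.closed c) (hz' : ρ ≤ ‖z‖) :
    ‖quot m β μ γ z - z⁻¹ • (L - m β μ)‖ ≤ (2 * |K| + 2 * ‖μ‖ * ‖L - m β μ‖) / ρ ^ 2 := by
  have hzpos : 0 < ‖z‖ := hρ.trans_le hz'
  have h2 : ρ / 2 ≤ ‖z - μ‖ := by
    have := norm_sub_norm_le z μ
    linarith
  have hne : z - μ ≠ 0 := norm_pos_iff.1 (by linarith)
  have hne0 : z ≠ 0 := norm_pos_iff.1 hzpos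
  have h3 : ‖(z - μ)⁻¹‖ ≤ 2 / ρ := by
    rw [norm_inv]
    refine (inv_anti₀ (by positivity) h2).trans_eq ?_
    rw [inv_div]
  have h4 : ‖z⁻¹‖ ≤ 1 / ρ := by
    rw [norm_inv, one_div]
    exact inv_anti₀ hρ hz'
  have h5 : ‖m γ z - L‖ ≤ |K| / ρ := by
    refine (hK γ z hz (h0.trans hz')).trans ?_
    calc K / ‖z‖ ≤ |K| / ‖z‖ := by gcongr; exact le_abs_self K
      _ ≤ |K| / ρ := by gcongr
  have e : quot m β μ γ z - z⁻¹ • (L - m β μ) =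
      (z - μ)⁻¹ • (m γ z - L) + (z - μ)⁻¹ • (z⁻¹ * μ) • (L - m β μ) := by
    rw [quot_of_ne _ _ _ (sub_ne_zero.1 hne)]
    have : (z - μ)⁻¹ * (z⁻¹ * μ) = (z - μ)⁻¹ - z⁻¹ := by
      field_simp
      ring
    rw [smul_smul, this, sub_smul]
    simp only [smul_sub]
    abel
  rw [e]
  refine (norm_add_le _ _).trans ?_
  rw [norm_smul, norm_smul, norm_smul, norm_mul]
  calc ‖(z - μ)⁻¹‖ * ‖m γ z - L‖ + ‖(z - μ)⁻¹‖ * (‖z⁻¹‖ * ‖μ‖ * ‖L - m β μ‖)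
      ≤ 2 / ρ * (|K| / ρ) + 2 / ρ * (1 / ρ * ‖μ‖ * ‖L - m β μ‖) := by gcongr
    _ = _ := by field_simp

/-- A piecewise holomorphic function with jump `O(ε / (1 + t²))` along the contour and limit `L` at
infinity differs from `L` by `O(ε / d)` at distance `d` from the contour. -/
theorem norm_sub_le_of_jump {c : ℝ} (hc : 0 < c) {m : Region → ℂ → F}
    (hm : ∀ γ, Differentiable ℂ (m γ)) {L : F} {K r₀ : ℝ}
    (hK : ∀ γ : Region, ∀ z ∈ γ.closed c, r₀ ≤ ‖z‖ → ‖m γ z - L‖ ≤ K / ‖z‖) {ε : ℝ} (hε : 0 ≤ ε)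
    (hj₀ : ∀ z ∈ imAxis, ‖m .innerLeft z - m .innerRight z‖ ≤ ε * (1 + z.im ^ 2)⁻¹)
    (hjr : ∀ z ∈ sigmaPlus c, ‖m .outerRight z - m .innerRight z‖ ≤ ε * (1 + z.im ^ 2)⁻¹)
    (hjl : ∀ z ∈ sigmaMinus c, ‖m .outerLeft z - m .innerLeft z‖ ≤ ε * (1 + z.im ^ 2)⁻¹)
    {β : Region} {μ : ℂ} (hμ : μ ∈ β.interior c) {d : ℝ} (hd : 0 < d)
    (hdist : ∀ z ∈ contour c, d ≤ ‖z - μ‖) : ‖m β μ - L‖ ≤ 2 * ε / d := by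
  set v := L - m β μ with hv
  set C := 2 * |K| + 2 * ‖μ‖ * ‖v‖ with hC
  set η := ε / d with hη
  have hη0 : 0 ≤ η := by positivity
  set H := quot m β μ with hH
  have hdiff := differentiableOn_quot hc hm hμ
  have hjump : ∀ (γ γ' : Region) (z : ℂ), z ∈ contour c →
      ‖m γ z - m γ' z‖ ≤ ε * (1 + z.im ^ 2)⁻¹ → ‖H γ z - H γ' z‖ ≤ η * (1 + z.im ^ 2)⁻¹ := by
    intro γ γ' z hz h
    have hdz := hdist z hz
    have hne : z ≠ μ := sub_ne_zero.1 (norm_pos_iff.1 (hd.trans_le hdz))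
    rw [hH, quot_of_ne _ _ _ hne, quot_of_ne _ _ _ hne, ← smul_sub, sub_sub_sub_cancel_right,
      norm_smul, norm_inv, hη, div_eq_inv_mul, mul_assoc]
    gcongr
  -- The integral of `H` around the large rectangle is `2π i v` up to `O(1/ρ)`, and by Cauchy it
  -- reduces to the jumps of `H`. These are at most `η / (1 + t²)`, because `|z - μ| ≥ d` on the
  -- contour.
  have main : ∀ ρ : ℝ, 0 < ρ → c ≤ ρ → r₀ ≤ ρ → 2 * ‖μ‖ ≤ ρ →
      2 * Real.pi * ‖v‖ ≤ 16 * C / ρ + 4 * Real.pi * η := by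
    intro ρ hρ hcρ h0 h1
    have hest : ∀ γ : Region, ∀ z ∈ γ.closed c, ρ ≤ ‖z‖ → ‖H γ z - z⁻¹ • v‖ ≤ C / ρ ^ 2 :=
      fun γ z hz hz' => norm_quot_sub_le hρ hK β γ h0 h1 hz hz'
    have hCδ : 4 * (c + ρ) * (C / ρ ^ 2) ≤ 8 * C / ρ := by
      have hC0 : 0 ≤ C := by positivity
      rw [div_eq_mul_inv, div_eq_mul_inv]
      have : 4 * (c + ρ) * (C * (ρ ^ 2)⁻¹) ≤ 4 * (ρ + ρ) * (C * (ρ ^ 2)⁻¹) := by gcongr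
      refine this.trans_eq ?_
      field_simp
      ring
    have hR := norm_right_half_le hc hρ hη0 (H := H .innerRight) (H' := H .outerRight)
      ((hdiff .innerRight).mono fun z hz => ⟨hz.1, by
        rw [abs_of_nonneg hz.2.1]; exact hz.2.2⟩)
      ((hdiff .innerRight).mono fun z hz => ⟨hz.1, by
        rw [abs_of_nonpos hz.2.1]; exact hz.2.2⟩)
      (hdiff .outerRight) v (δ := C / ρ ^ 2)
      (fun z hz0 hz1 hz2 => hest _ z ⟨hz0, by rw [hz2]; exact hz1⟩
        (hz2.symm.le.trans (Complex.abs_im_le_norm z)))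
      (fun z hz0 hz1 => hest _ z (by
        change c + |z.im| ≤ z.re
        rw [hz0]; linarith) (by
          have := (le_abs_self _).trans (Complex.abs_re_le_norm z)
          linarith))
      (fun z hz => hjump _ _ z (Region.mem_contour_iff.2 (Or.inl hz)) (hjr z hz))
    -- The left half is the right half after `z ↦ -z`; the outer sign keeps the leading term `v /
    -- z`.
    have hL := norm_right_half_le hc hρ hη0 (H := fun z => -H .innerLeft (-z))
      (H' := fun z => -H .outerLeft (-z))
      (((hdiff .innerLeft).comp differentiable_neg.differentiableOn fun z hz => by
        simp only [Region.closed, Set.mem_ofPred_eq, Complex.neg_re, Complex.neg_im, abs_neg]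
        rw [abs_of_nonneg hz.2.1]
        exact ⟨by linarith [hz.2.2], by linarith [hz.1]⟩).neg)
      (((hdiff .innerLeft).comp differentiable_neg.differentiableOn fun z hz => by
        simp only [Region.closed, Set.mem_ofPred_eq, Complex.neg_re, Complex.neg_im, abs_neg]
        rw [abs_of_nonpos hz.2.1]
        exact ⟨by linarith [hz.2.2], by linarith [hz.1]⟩).neg)
      (((hdiff .outerLeft).comp differentiable_neg.differentiableOn fun z hz => by
        simp only [Region.closed, Set.mem_ofPred_eq, Complex.neg_re, Complex.neg_im, abs_neg]
          at hz ⊢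
        linarith).neg) v (δ := C / ρ ^ 2)
      (fun z hz0 hz1 hz2 => by
        have := hest .innerLeft (-z) (by
          simp only [Region.closed, Set.mem_ofPred_eq, Complex.neg_re, Complex.neg_im, abs_neg]
          rw [hz2]
          exact ⟨by linarith, by linarith⟩)
          (by rw [norm_neg]; exact hz2.symm.le.trans (Complex.abs_im_le_norm z))
        rwa [inv_neg, neg_smul, sub_neg_eq_add, ← norm_neg, neg_add, ← sub_eq_add_neg] at this)
      (fun z hz0 hz1 => by
        have := hest .outerLeft (-z) (by
          simp only [Region.closed, Set.mem_ofPred_eq, Complex.neg_re, Complex.neg_im, abs_neg]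
          linarith)
          (by
            rw [norm_neg]
            have := (le_abs_self _).trans (Complex.abs_re_le_norm z)
            linarith)
        rwa [inv_neg, neg_smul, sub_neg_eq_add, ← norm_neg, neg_add, ← sub_eq_add_neg] at this)
      (fun z hz => by
        have hz' : -z ∈ sigmaMinus c := by
          simp only [sigmaMinus, Set.mem_ofPred_eq, Complex.neg_re, Complex.neg_im, abs_neg, hz]
        have := hjump _ _ (-z) (Region.mem_contour_iff.2 (Or.inr (Or.inl hz'))) (hjl _ hz')
        rwa [Complex.neg_im, neg_sq, ← norm_neg, neg_sub, ← neg_sub_neg] at this)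
    rw [segInt_comp_neg, segInt_comp_neg, neg_zero,
      show -(⟨0, -ρ⟩ : ℂ) = ⟨0, ρ⟩ by apply Complex.ext <;> simp,
      show -(⟨0, ρ⟩ : ℂ) = ⟨0, -ρ⟩ by apply Complex.ext <;> simp] at hL
    have hconv : Convex ℝ {z : ℂ | z.re = 0} := by
      intro z hz w hw s t _ _ _
      simp only [Set.mem_ofPred_eq] at hz hw
      simp [hz, hw]
    have hcr : ContinuousOn (H .innerRight) {z : ℂ | z.re = 0} :=
      (hdiff .innerRight).continuousOn.mono fun z (hz : z.re = 0) =>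
        ⟨hz.symm.le, by rw [hz]; positivity⟩
    have hcl : ContinuousOn (H .innerLeft) {z : ℂ | z.re = 0} :=
      (hdiff .innerLeft).continuousOn.mono fun z (hz : z.re = 0) =>
        ⟨by rw [hz]; linarith [abs_nonneg z.im], hz.le⟩
    have e1 := segInt_sub hconv hcl hcr (p := 0) (q := ⟨0, ρ⟩) rfl rfl
    have e2 := segInt_sub hconv hcl hcr (p := 0) (q := ⟨0, -ρ⟩) rfl rfl
    have b1 : ‖segInt (fun z => H .innerLeft z - H .innerRight z) 0 ⟨0, ρ⟩‖ ≤
        1 * η * (Real.pi / 2) := by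
      rw [show (⟨0, ρ⟩ : ℂ) = 0 + ρ * Complex.I by apply Complex.ext <;> simp, ← Complex.norm_I]
      refine norm_segInt_ray_le hρ hη0 fun t ht => ?_
      have h0 : 0 + (t : ℂ) * Complex.I ∈ imAxis := by simp [imAxis]
      simpa using hjump _ _ _ (Region.mem_contour_iff.2 (Or.inr (Or.inr h0))) (hj₀ _ h0)
    have b2 : ‖segInt (fun z => H .innerLeft z - H .innerRight z) 0 ⟨0, -ρ⟩‖ ≤
        1 * η * (Real.pi / 2) := by
      rw [show (⟨0, -ρ⟩ : ℂ) = 0 + ρ * -Complex.I by apply Complex.ext <;> simp, ← Complex.norm_I,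
        ← norm_neg Complex.I]
      refine norm_segInt_ray_le hρ hη0 fun t ht => ?_
      have h0 : 0 + (t : ℂ) * -Complex.I ∈ imAxis := by simp [imAxis]
      simpa using hjump _ _ _ (Region.mem_contour_iff.2 (Or.inr (Or.inr h0))) (hj₀ _ h0)
    have e : (2 * Real.pi * Complex.I : ℂ) • v =
        (((Real.pi : ℂ) * Complex.I) • v -
          (segInt (H .innerRight) ⟨0, -ρ⟩ 0 + segInt (H .innerRight) 0 ⟨0, ρ⟩)) +
        (((Real.pi : ℂ) * Complex.I) • v -
          (segInt (H .innerLeft) ⟨0, ρ⟩ 0 + segInt (H .innerLeft) 0 ⟨0, -ρ⟩)) -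
        segInt (fun z => H .innerLeft z - H .innerRight z) 0 ⟨0, ρ⟩ +
        segInt (fun z => H .innerLeft z - H .innerRight z) 0 ⟨0, -ρ⟩ := by
      rw [e1, e2, segInt_symm _ 0 ⟨0, -ρ⟩, segInt_symm _ 0 ⟨0, ρ⟩,
        show (2 * Real.pi * Complex.I : ℂ) = Real.pi * Complex.I + Real.pi * Complex.I by ring,
        add_smul]
      abel
    have hn : ‖(2 * Real.pi * Complex.I : ℂ) • v‖ = 2 * Real.pi * ‖v‖ := by
      rw [norm_smul]
      simp [abs_of_pos Real.pi_pos]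
    rw [← hn, e]
    refine (norm_add_le _ _).trans ?_
    have n1 := norm_sub_le ((((Real.pi : ℂ) * Complex.I) • v -
          (segInt (H .innerRight) ⟨0, -ρ⟩ 0 + segInt (H .innerRight) 0 ⟨0, ρ⟩)) +
        (((Real.pi : ℂ) * Complex.I) • v -
          (segInt (H .innerLeft) ⟨0, ρ⟩ 0 + segInt (H .innerLeft) 0 ⟨0, -ρ⟩)))
        (segInt (fun z => H .innerLeft z - H .innerRight z) 0 ⟨0, ρ⟩)
    have n2 := norm_add_le (((Real.pi : ℂ) * Complex.I) • v -
          (segInt (H .innerRight) ⟨0, -ρ⟩ 0 + segInt (H .innerRight) 0 ⟨0, ρ⟩))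
        (((Real.pi : ℂ) * Complex.I) • v -
          (segInt (H .innerLeft) ⟨0, ρ⟩ 0 + segInt (H .innerLeft) 0 ⟨0, -ρ⟩))
    -- The two halves contribute `2 √2 π η` and the axis `π η`; with `√2 ≤ 3/2` the sum is at most
    -- `4 π η`.
    have hsqrt : √2 ≤ 3 / 2 := by
      rw [Real.sqrt_le_left (by norm_num)]
      norm_num
    have hsq : √2 * Real.pi * η ≤ 3 / 2 * Real.pi * η := by
      have := Real.pi_pos
      gcongr
    have h8 : 16 * C / ρ = 2 * (8 * C / ρ) := by ring
    linarith
  have hlim : Tendsto (fun ρ : ℝ => 16 * C / ρ + 4 * Real.pi * η) atTop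
      (𝓝 (0 + 4 * Real.pi * η)) :=
    (tendsto_const_nhds.div_atTop tendsto_id).add tendsto_const_nhds
  have hfin := ge_of_tendsto hlim (by
    filter_upwards [eventually_gt_atTop 0, eventually_ge_atTop c, eventually_ge_atTop r₀,
      eventually_ge_atTop (2 * ‖μ‖)] with ρ h1 h2 h3 h4
    exact main ρ h1 h2 h3 h4)
  rw [norm_sub_rev, ← hv, mul_div_assoc, ← hη]
  have := Real.pi_pos
  nlinarith

end CauchyBound

/-! ### A maximum principle with singular bounds near the contour. -/

section RectangleMaximum

lemma isClosed_contour (c : ℝ) : IsClosed (contour c) := by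
  have h : contour c = {z | z.re = c + |z.im|} ∪ {z | z.re = -(c + |z.im|)} ∪ {z | z.re = 0} := rfl
  rw [h]
  refine ((isClosed_eq ?_ ?_).union (isClosed_eq ?_ ?_)).union (isClosed_eq ?_ ?_) <;> fun_prop

lemma nonempty_contour (c : ℝ) : (contour c).Nonempty :=
  ⟨0, Region.mem_contour_iff.2 (Or.inr (Or.inr rfl))⟩

lemma infDist_contour_pos {c : ℝ} {μ : ℂ} (hμ : μ ∈ (contour c)ᶜ) :
    0 < Metric.infDist μ (contour c) :=
  ((isClosed_contour c).notMem_iff_infDist_pos (nonempty_contour c)).1 hμ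

lemma infDist_contour_le {c : ℝ} {μ z : ℂ} (hz : z ∈ contour c) :
    Metric.infDist μ (contour c) ≤ ‖z - μ‖ := by
  rw [← dist_eq_norm, dist_comm]
  exact Metric.infDist_le_dist_of_mem hz

/-- The points where the contour meets the boundary of the rectangle
`[-(c + ρ), c + ρ] × [-ρ, ρ]`. -/
noncomputable def crossing (c ρ : ℝ) : Fin 6 → ℂ :=
  ![⟨0, ρ⟩, ⟨0, -ρ⟩, ⟨c + ρ, ρ⟩, ⟨c + ρ, -ρ⟩, ⟨-(c + ρ), ρ⟩, ⟨-(c + ρ), -ρ⟩]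

lemma abs_im_crossing (c ρ : ℝ) (k : Fin 6) : |(crossing c ρ k).im| = |ρ| := by
  fin_cases k <;> simp [crossing]

lemma abs_re_crossing_le {c ρ : ℝ} (hc : 0 < c) (hρ : 0 < ρ) (k : Fin 6) :
    |(crossing c ρ k).re| ≤ c + ρ := by
  have h : |c + ρ| ≤ c + ρ := (abs_of_pos (by linarith)).le
  have h' : |-(c + ρ)| ≤ c + ρ := by rwa [abs_neg]
  fin_cases k <;> simp only [crossing] <;>
    first | exact h | exact h' | (simp; linarith)

lemma norm_le_of_re_im {z : ℂ} {a b : ℝ} (h1 : |z.re| ≤ a) (h2 : |z.im| ≤ b) : ‖z‖ ≤ a + b :=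
  (Complex.norm_le_abs_re_add_abs_im z).trans (add_le_add h1 h2)

/-- The contour crosses the sides of the rectangle at angles of at least 45 degrees. Hence along the
boundary the distance to the contour is comparable with the distance to the nearest crossing. -/
lemma exists_crossing_near {c ρ : ℝ} (hc : 0 < c) (hρ : 0 < ρ) {μ : ℂ}
    (hμ : (|μ.re| = c + ρ ∧ |μ.im| ≤ ρ) ∨ (|μ.re| ≤ c + ρ ∧ |μ.im| = ρ)) :
    ∃ k, ‖μ - crossing c ρ k‖ ≤ 2 * Metric.infDist μ (contour c) := by
  have hinf : ∀ x : ℝ, (∀ z ∈ contour c, x ≤ 2 * ‖z - μ‖) → x ≤ 2 * Metric.infDist μ (contour c) := by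
    intro x hx
    have : x / 2 ≤ Metric.infDist μ (contour c) := by
      refine (Metric.le_infDist (nonempty_contour c)).2 fun z hz => ?_
      rw [dist_comm, dist_eq_norm]
      linarith [hx z hz]
    linarith
  have hre : ∀ k, μ.re = (crossing c ρ k).re →
      ‖μ - crossing c ρ k‖ = |μ.im - (crossing c ρ k).im| := by
    intro k hk
    have : μ - crossing c ρ k = ((μ.im - (crossing c ρ k).im : ℝ) : ℂ) * Complex.I := by
      apply Complex.ext <;> simp [hk]
    rw [this, norm_mul, Complex.norm_I, mul_one, Complex.norm_real, Real.norm_eq_abs]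
  have him : ∀ k, μ.im = (crossing c ρ k).im →
      ‖μ - crossing c ρ k‖ = |μ.re - (crossing c ρ k).re| := by
    intro k hk
    have : μ - crossing c ρ k = ((μ.re - (crossing c ρ k).re : ℝ) : ℂ) := by
      apply Complex.ext <;> simp [hk]
    rw [this, Complex.norm_real, Real.norm_eq_abs]
  have hdiff : ∀ z : ℂ, |z.re - μ.re| ≤ ‖z - μ‖ ∧ |z.im - μ.im| ≤ ‖z - μ‖ := fun z =>
    ⟨by simpa using Complex.abs_re_le_norm (z - μ), by simpa using Complex.abs_im_le_norm (z - μ)⟩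
  rcases hμ with ⟨h1, h2⟩ | ⟨h1, h2⟩
  · have hside : ρ - |μ.im| ≤ 2 * Metric.infDist μ (contour c) := by
      refine hinf _ fun z hz => ?_
      obtain ⟨hr, hi⟩ := hdiff z
      rw [Region.mem_contour_iff] at hz
      grind
    rcases abs_eq (by linarith : 0 ≤ c + ρ) |>.1 h1 with h1 | h1 <;>
      rcases le_total 0 μ.im with h3 | h3
    · refine ⟨2, (hre 2 (by simpa [crossing] using h1)).trans_le (le_trans ?_ hside)⟩
      simp only [crossing]; simp; grind
    · refine ⟨3, (hre 3 (by simpa [crossing] using h1)).trans_le (le_trans ?_ hside)⟩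
      simp only [crossing]; simp; grind
    · refine ⟨4, (hre 4 (by simp [crossing, h1])).trans_le (le_trans ?_ hside)⟩
      simp only [crossing]; simp; grind
    · refine ⟨5, (hre 5 (by simp [crossing, h1])).trans_le (le_trans ?_ hside)⟩
      simp only [crossing]; simp; grind
  · have hside : min |μ.re| (c + ρ - |μ.re|) ≤ 2 * Metric.infDist μ (contour c) := by
      refine hinf _ fun z hz => ?_
      obtain ⟨hr, hi⟩ := hdiff z
      rw [Region.mem_contour_iff] at hz
      grind
    rcases abs_eq hρ.le |>.1 h2 with h2 | h2 <;>
      rcases le_total |μ.re| (c + ρ - |μ.re|) with h3 | h3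
    · rw [min_eq_left h3] at hside
      refine ⟨0, (him 0 (by simpa [crossing] using h2)).trans_le (le_trans ?_ hside)⟩
      simp [crossing]
    · rw [min_eq_right h3] at hside
      rcases le_total 0 μ.re with h4 | h4
      · refine ⟨2, (him 2 (by simpa [crossing] using h2)).trans_le (le_trans ?_ hside)⟩
        simp only [crossing]; simp; grind
      · refine ⟨4, (him 4 (by simpa [crossing] using h2)).trans_le (le_trans ?_ hside)⟩
        simp only [crossing]; simp; grind
    · rw [min_eq_left h3] at hside
      refine ⟨1, (him 1 (by simpa [crossing] using h2)).trans_le (le_trans ?_ hside)⟩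
      simp [crossing]
    · rw [min_eq_right h3] at hside
      rcases le_total 0 μ.re with h4 | h4
      · refine ⟨3, (him 3 (by simpa [crossing] using h2)).trans_le (le_trans ?_ hside)⟩
        simp only [crossing]; simp; grind
      · refine ⟨5, (him 5 (by simpa [crossing] using h2)).trans_le (le_trans ?_ hside)⟩
        simp only [crossing]; simp; grind

variable {F : Type*} [NormedAddCommGroup F] [NormedSpace ℂ F]

/-- A maximum principle for entire functions whose bound degenerates near the contour. -/
theorem norm_le_of_norm_le_add_div_infDist {c ρ a b : ℝ} (hc : 0 < c) (hρ : c ≤ ρ) (ha : 0 ≤ a)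
    (hb : 0 ≤ b) {f : ℂ → F} (hf : Differentiable ℂ f)
    (h : ∀ μ ∈ (contour c)ᶜ, ρ ≤ ‖μ‖ → ‖μ‖ ≤ 4 * ρ →
      ‖f μ‖ ≤ a + b / Metric.infDist μ (contour c)) {w : ℂ} (hw : 2 * ‖w‖ ≤ ρ) :
    ‖f w‖ ≤ 12 ^ 6 * (a + b / ρ) := by
  have hρ0 : 0 < ρ := hc.trans_le hρ
  -- A zero at each crossing compensates the singularity `b / infDist` on the boundary. Each factor
  -- is at most `6` there and at least `1/2` at `w`, whence the constant `6 ^ 6 * 2 ^ 6 = 12 ^ 6`.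
  set q : ℂ → ℂ := fun z => ∏ k, (z - crossing c ρ k) / ρ with hq
  have hqd : Differentiable ℂ q := by
    intro z
    refine DifferentiableAt.fun_finsetProd fun k _ => ?_
    fun_prop
  set U : Set ℂ := Set.Ioo (-(c + ρ)) (c + ρ) ×ℂ Set.Ioo (-ρ) ρ with hU
  have hqw : (1 / 2 : ℝ) ^ 6 ≤ ‖q w‖ := by
    simp only [hq, norm_prod, norm_div, Complex.norm_real, Real.norm_of_nonneg hρ0.le]
    have : ∀ k ∈ (Finset.univ : Finset (Fin 6)), (1 / 2 : ℝ) ≤ ‖w - crossing c ρ k‖ / ρ := by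
      intro k _
      rw [le_div_iff₀ hρ0]
      have h1 := norm_sub_norm_le (crossing c ρ k) w
      have h2 := Complex.abs_im_le_norm (crossing c ρ k)
      rw [abs_im_crossing, abs_of_pos hρ0] at h2
      rw [norm_sub_rev]
      linarith
    calc (1 / 2 : ℝ) ^ 6 = ∏ k : Fin 6, (1 / 2 : ℝ) := by simp
      _ ≤ _ := Finset.prod_le_prod (fun _ _ => by norm_num) this
  have hbd : ∀ z ∈ frontier U, ‖(fun z => q z • f z) z‖ ≤ 6 ^ 6 * (a + b / ρ) := by
    intro z hz
    have hz' : (|z.re| = c + ρ ∧ |z.im| ≤ ρ) ∨ (|z.re| ≤ c + ρ ∧ |z.im| = ρ) := by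
      rw [hU, Complex.frontier_reProdIm, frontier_Ioo (by linarith), frontier_Ioo (by linarith),
        closure_Ioo (by linarith), closure_Ioo (by linarith)] at hz
      rcases hz with hz | hz
      · right
        refine ⟨abs_le.2 hz.1, ?_⟩
        rcases hz.2 with e | e
        · rw [e, abs_neg, abs_of_pos hρ0]
        · rw [Set.mem_singleton_iff.1 e, abs_of_pos hρ0]
      · left
        refine ⟨?_, abs_le.2 hz.2⟩
        rcases hz.1 with e | e
        · rw [e, abs_neg, abs_of_pos (by linarith)]
        · rw [Set.mem_singleton_iff.1 e, abs_of_pos (by linarith)]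
    have hre : |z.re| ≤ c + ρ := by rcases hz' with h | h <;> linarith [h.1]
    have him : |z.im| ≤ ρ := by rcases hz' with h | h <;> linarith [h.2]
    have hfac : ∀ k, ‖(z - crossing c ρ k) / (ρ : ℂ)‖ ≤ 6 := by
      intro k
      rw [norm_div, Complex.norm_real, Real.norm_of_nonneg hρ0.le, div_le_iff₀ hρ0]
      have h1 := norm_le_of_re_im hre him
      have h2 := norm_le_of_re_im (abs_re_crossing_le hc hρ0 k)
        ((abs_im_crossing c ρ k).trans (abs_of_pos hρ0)).le
      linarith [norm_sub_le z (crossing c ρ k)]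
    obtain ⟨k, hk⟩ := exists_crossing_near hc hρ0 hz'
    have hqz : ‖q z‖ ≤ ‖z - crossing c ρ k‖ / ρ * 6 ^ 5 := by
      simp only [hq, norm_prod]
      rw [← Finset.mul_prod_erase Finset.univ _ (Finset.mem_univ k), norm_div, Complex.norm_real,
        Real.norm_of_nonneg hρ0.le]
      gcongr
      refine (Finset.prod_le_prod (fun _ _ => norm_nonneg _) fun j _ => hfac j).trans_eq ?_
      rw [Finset.prod_const, Finset.card_erase_of_mem (Finset.mem_univ k), Finset.card_univ,
        Fintype.card_fin]
    have hqz' : ‖q z‖ ≤ 6 ^ 6 := by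
      simp only [hq, norm_prod]
      refine (Finset.prod_le_prod (fun _ _ => norm_nonneg _) fun j _ => hfac j).trans_eq ?_
      simp
    show ‖q z • f z‖ ≤ _
    rw [norm_smul]
    -- At boundary points on the contour there is no bound on `f`, but these are crossings and `q`
    -- vanishes.
    by_cases hzc : z ∈ contour c
    · rw [Metric.infDist_zero_of_mem hzc, mul_zero] at hk
      have : ‖q z‖ ≤ 0 := hqz.trans (by rw [le_antisymm hk (norm_nonneg _)]; simp)
      rw [le_antisymm this (norm_nonneg _), zero_mul]
      positivity
    · have hd := infDist_contour_pos hzc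
      have hlow : ρ ≤ ‖z‖ := by
        rcases hz' with h | h
        · have := Complex.abs_re_le_norm z
          linarith [h.1]
        · have := Complex.abs_im_le_norm z
          linarith [h.2]
      have hup : ‖z‖ ≤ 4 * ρ := by linarith [norm_le_of_re_im hre him]
      calc ‖q z‖ * ‖f z‖ ≤ ‖q z‖ * (a + b / Metric.infDist z (contour c)) := by
            gcongr
            exact h z hzc hlow hup
        _ = ‖q z‖ * a + ‖q z‖ * (b / Metric.infDist z (contour c)) := by ring
        _ ≤ 6 ^ 6 * a + (2 * Metric.infDist z (contour c) / ρ * 6 ^ 5)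
              * (b / Metric.infDist z (contour c)) := by
            gcongr
            exact hqz.trans (by gcongr)
        _ = 6 ^ 6 * a + 2 * 6 ^ 5 * (b / ρ) := by field_simp
        _ ≤ _ := by
            have : 0 ≤ b / ρ := by positivity
            linarith
  have hbdd : Bornology.IsBounded U := by
    refine (Metric.isBounded_ball (x := (0 : ℂ)) (r := c + ρ + ρ + 1)).subset fun z hz => ?_
    rw [mem_ball_zero_iff]
    have := norm_le_of_re_im (abs_le.2 ⟨hz.1.1.le, hz.1.2.le⟩) (abs_le.2 ⟨hz.2.1.le, hz.2.2.le⟩)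
    linarith
  have hwU : w ∈ U := by
    have h1 := Complex.abs_re_le_norm w
    have h2 := Complex.abs_im_le_norm w
    have h3 := norm_nonneg w
    exact ⟨abs_lt.1 (by linarith), abs_lt.1 (by linarith)⟩
  have hmax := Complex.norm_le_of_forall_mem_frontier_norm_le hbdd
    (hqd.smul hf).diffContOnCl hbd (subset_closure hwU)
  simp only [Pi.smul_apply', norm_smul] at hmax
  have h1 : (1 / 2 : ℝ) ^ 6 * ‖f w‖ ≤ 6 ^ 6 * (a + b / ρ) :=
    (mul_le_mul_of_nonneg_right hqw (norm_nonneg _)).trans hmax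
  linarith

end RectangleMaximum

/-! ### Solutions as entire functions; stability of the quotient of two solutions. -/

section Extension

variable {𝔸 : Type*} [NormedRing 𝔸] [NormedAlgebra ℂ 𝔸]

namespace Region

/-- The product of the jump factors `1 + F` (imaginary axis) and `1 + G` (`Σ`) that relates the
inner right region to the given one. -/
def mult (F G : 𝔸) : Region → 𝔸
  | outerRight => 1 + G
  | innerRight => 1
  | innerLeft => 1 + F
  | outerLeft => (1 + F) * (1 + G)

/-- The inverse of `Region.mult`, when `F` and `G` have square zero. -/
def multInv (F G : 𝔸) : Region → 𝔸
  | outerRight => 1 - G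
  | innerRight => 1
  | innerLeft => 1 - F
  | outerLeft => (1 - G) * (1 - F)

omit [NormedAlgebra ℂ 𝔸] in
lemma one_add_mul_one_sub {F : 𝔸} (hF : F * F = 0) : (1 + F) * (1 - F) = 1 := by
  rw [add_mul, mul_sub F, hF]; simp

omit [NormedAlgebra ℂ 𝔸] in
lemma one_sub_mul_one_add {F : 𝔸} (hF : F * F = 0) : (1 - F) * (1 + F) = 1 := by
  rw [sub_mul, mul_add F, hF]; simp

omit [NormedAlgebra ℂ 𝔸] in
lemma mult_mul_multInv {F G : 𝔸} (hF : F * F = 0) (hG : G * G = 0) (β : Region) :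
    mult F G β * multInv F G β = 1 := by
  cases β
  · exact one_add_mul_one_sub hG
  · exact one_mul 1
  · exact one_add_mul_one_sub hF
  · change (1 + F) * (1 + G) * ((1 - G) * (1 - F)) = 1
    rw [mul_assoc, ← mul_assoc (1 + G), one_add_mul_one_sub hG, one_mul, one_add_mul_one_sub hF]

omit [NormedAlgebra ℂ 𝔸] in
lemma multInv_mul_mult {F G : 𝔸} (hF : F * F = 0) (hG : G * G = 0) (β : Region) :
    multInv F G β * mult F G β = 1 := by
  cases β
  · exact one_sub_mul_one_add hG
  · exact one_mul 1
  · exact one_sub_mul_one_add hF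
  · change (1 - G) * (1 - F) * ((1 + F) * (1 + G)) = 1
    rw [mul_assoc, ← mul_assoc (1 - F), one_sub_mul_one_add hF, one_mul, one_sub_mul_one_add hG]

lemma differentiable_mult {F G : ℂ → 𝔸} (hF : Differentiable ℂ F) (hG : Differentiable ℂ G)
    (β : Region) : Differentiable ℂ fun z => mult (F z) (G z) β := by
  cases β <;> simp only [mult]
  · exact hG.const_add 1
  · exact differentiable_const _
  · exact hF.const_add 1
  · exact (hF.const_add 1).mul (hG.const_add 1)

lemma differentiable_multInv {F G : ℂ → 𝔸} (hF : Differentiable ℂ F) (hG : Differentiable ℂ G)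
    (β : Region) : Differentiable ℂ fun z => multInv (F z) (G z) β := by
  cases β <;> simp only [multInv]
  · exact hG.const_sub 1
  · exact differentiable_const _
  · exact hF.const_sub 1
  · exact (hG.const_sub 1).mul (hF.const_sub 1)

end Region

/-- The entire function `E` extends, from the inner right region, a solution of the Riemann-Hilbert
problem with jump matrices `1 + F` on the imaginary axis and `1 + G` on `Σ`; its restriction to the
closed region `β` is `E * β.mult F G`. The idempotent `e` fixes the block structure. -/
structure IsExtension (c : ℝ) (e : 𝔸) (F G E E' : ℂ → 𝔸) : Prop where
  diff_F : Differentiable ℂ F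
  diff_G : Differentiable ℂ G
  diff_E : Differentiable ℂ E
  diff_E' : Differentiable ℂ E'
  F_mul : ∀ z, F z * e = F z
  mul_F : ∀ z, e * F z = 0
  mul_G : ∀ z, e * G z = G z
  G_mul : ∀ z, G z * e = 0
  mul_inv : ∀ z, E z * E' z = 1
  inv_mul : ∀ z, E' z * E z = 1
  bound : ∃ K, ∀ (β : Region), ∀ z ∈ β.closed c,
    ‖E z * β.mult (F z) (G z) - 1‖ ≤ K / (1 + ‖z‖)
  bound_inv : ∃ K, ∀ (β : Region), ∀ z ∈ β.closed c, ‖β.multInv (F z) (G z) * E' z‖ ≤ K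

omit [NormedAlgebra ℂ 𝔸] in
lemma mul_eq_zero_of_mul_eq {e F F' : 𝔸} (h : F * e = F) (h' : e * F' = 0) : F * F' = 0 := by
  rw [← h, mul_assoc, h', mul_zero]

variable {c : ℝ} {e : 𝔸} {F G E E' F₀ G₀ E₀ E₀' : ℂ → 𝔸}

namespace IsExtension

lemma F_mul_F (h : IsExtension c e F G E E') (z : ℂ) : F z * F z = 0 :=
  mul_eq_zero_of_mul_eq (h.F_mul z) (h.mul_F z)

lemma G_mul_G (h : IsExtension c e F G E E') (z : ℂ) : G z * G z = 0 := by
  nth_rewrite 2 [← h.mul_G z]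
  rw [← mul_assoc, h.G_mul, zero_mul]

lemma value_mul_inv (h : IsExtension c e F G E E') (β : Region) (z : ℂ) :
    E z * β.mult (F z) (G z) * (β.multInv (F z) (G z) * E' z) = 1 := by
  rw [mul_assoc, ← mul_assoc (β.mult _ _), Region.mult_mul_multInv (h.F_mul_F z) (h.G_mul_G z),
    one_mul, h.mul_inv]

lemma inv_mul_value (h : IsExtension c e F G E E') (β : Region) (z : ℂ) :
    β.multInv (F z) (G z) * E' z * (E z * β.mult (F z) (G z)) = 1 := by
  rw [mul_assoc, ← mul_assoc (E' z), h.inv_mul, one_mul,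
    Region.multInv_mul_mult (h.F_mul_F z) (h.G_mul_G z)]

lemma exists_bound (h : IsExtension c e F G E E') : ∃ B, 0 < B ∧
    (∀ (β : Region), ∀ z ∈ β.closed c, ‖E z * β.mult (F z) (G z)‖ ≤ B) ∧
    (∀ (β : Region), ∀ z ∈ β.closed c, ‖β.multInv (F z) (G z) * E' z‖ ≤ B) ∧
    (∀ (β : Region), ∀ z ∈ β.closed c, ‖E z * β.mult (F z) (G z) - 1‖ ≤ B / (1 + ‖z‖)) := by
  obtain ⟨K, hK⟩ := h.bound
  obtain ⟨K', hK'⟩ := h.bound_inv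
  have h1 := norm_nonneg (1 : 𝔸)
  refine ⟨|K| + |K'| + ‖(1 : 𝔸)‖ + 1, by positivity, fun β z hz => ?_, fun β z hz => ?_,
    fun β z hz => ?_⟩
  · have := hK β z hz
    have h2 : K / (1 + ‖z‖) ≤ |K| := by
      rw [div_le_iff₀ (by positivity)]
      nlinarith [le_abs_self K, abs_nonneg K, norm_nonneg z]
    have h3 := norm_sub_norm_le (E z * β.mult (F z) (G z)) 1
    linarith [abs_nonneg K']
  · have := hK' β z hz
    linarith [le_abs_self K', abs_nonneg K]
  · refine (hK β z hz).trans ?_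
    gcongr
    linarith [le_abs_self K, abs_nonneg K']

end IsExtension

/-- The a priori bound `B` only serves as the growth condition of Phragmén–Lindelöf and does not
enter the conclusion. The same holds in `norm_le_of_half_plane`. -/
lemma diff_PhragmenLindelof_strip {δ S B : ℝ} (hδ : 0 < δ) {f : ℂ → 𝔸} (hf : Differentiable ℂ f)
    (hB : ∀ z : ℂ, |z.re| ≤ δ → ‖f z‖ ≤ B) (hS : ∀ z : ℂ, |z.re| = δ → ‖f z‖ ≤ S) {z : ℂ}
    (hz : z.re = 0) : ‖f z‖ ≤ S := by
  refine PhragmenLindelof.vertical_strip (a := -δ) (b := δ) hf.diffContOnCl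
    ⟨0, by have := Real.pi_pos; have : 0 < δ - -δ := by linarith
           positivity, 0, ?_⟩
    (fun w hw => hS w (by rw [hw, abs_neg, abs_of_pos hδ]))
    (fun w hw => hS w (by rw [hw, abs_of_pos hδ])) (by linarith) (by linarith)
  refine Asymptotics.IsBigO.of_bound B ?_
  rw [eventually_inf_principal]
  refine Eventually.of_forall fun w hw => ?_
  simpa using hB w (abs_le.2 ⟨hw.1.le, hw.2.le⟩)

lemma norm_le_of_half_plane {δ S B : ℝ} {f : ℂ → 𝔸} (hf : Differentiable ℂ f)
    (hB : ∀ z : ℂ, δ ≤ z.re → ‖f z‖ ≤ B) (hS : ∀ z : ℂ, z.re = δ → ‖f z‖ ≤ S) {z : ℂ}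
    (hz : δ ≤ z.re) : ‖f z‖ ≤ S := by
  have hd : Differentiable ℂ fun w => f (w + δ) := hf.comp (differentiable_id.add_const _)
  have := PhragmenLindelof.right_half_plane_of_bounded_on_real (f := fun w => f (w + δ)) (C := S)
    (z := z - δ) hd.diffContOnCl ⟨0, by norm_num, 0, ?_⟩ ⟨B, ?_⟩ (fun x => hS _ (by simp))
    (by simpa using hz)
  · simpa using this
  · refine Asymptotics.IsBigO.of_bound B ?_
    rw [eventually_inf_principal]
    refine Eventually.of_forall fun w hw => ?_
    have : (0 : ℝ) < w.re := hw
    simpa using hB (w + δ) (by simpa using this.le)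
  · rw [eventually_map]
    filter_upwards [eventually_ge_atTop 0] with x hx
    exact hB _ (by simpa using hx)

/-- The quotient of two solutions, in the region `β`. -/
def ratio (F G E F₀ G₀ E₀' : ℂ → 𝔸) (β : Region) (z : ℂ) : 𝔸 :=
  E z * β.mult (F z) (G z) * (β.multInv (F₀ z) (G₀ z) * E₀' z)

/-- Products such as `F F₀` vanish by the block structure, so the jump is linear in `F - F₀`. The
idempotent is inserted so that the unknown solution enters only through `E (1 - e)`, which has no
jump across the axis; on `Σ` the same role is played by `E e` and `E (1 + F) e`. -/
lemma ratio_jump_imAxis (h : IsExtension c e F G E E') (h₀ : IsExtension c e F₀ G₀ E₀ E₀') (z : ℂ) :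
    ratio F G E F₀ G₀ E₀' .innerLeft z - ratio F G E F₀ G₀ E₀' .innerRight z =
      E z * (1 - e) * (F z - F₀ z) * (Region.innerRight.multInv (F₀ z) (G₀ z) * E₀' z) := by
  have h1 := mul_eq_zero_of_mul_eq (h.F_mul z) (h₀.mul_F z)
  have h2 : (1 - e) * (F z - F₀ z) = F z - F₀ z := by
    rw [sub_mul, mul_sub e, h.mul_F, h₀.mul_F]; simp
  have h3 : (1 + F z) * (1 - F₀ z) = 1 + (F z - F₀ z) := by
    rw [add_mul, mul_sub (F z), h1]; simp; abel
  rw [mul_assoc (E z), h2]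
  simp only [ratio, Region.mult, Region.multInv, mul_one, one_mul]
  rw [mul_assoc (E z), ← mul_assoc (1 + F z), h3, add_mul, mul_add, one_mul]
  simp [mul_assoc]

lemma ratio_jump_aux (h : IsExtension c e F G E E') (h₀ : IsExtension c e F₀ G₀ E₀ E₀') (z : ℂ) :
    (1 + G z) * (1 - G₀ z) = 1 + e * (G z - G₀ z) := by
  have h1 : G z * G₀ z = 0 := by rw [← h₀.mul_G z, ← mul_assoc, h.G_mul, zero_mul]
  rw [mul_sub e, h.mul_G, h₀.mul_G, add_mul, mul_sub (G z), h1]; simp; abel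

lemma ratio_jump_sigmaPlus (h : IsExtension c e F G E E') (h₀ : IsExtension c e F₀ G₀ E₀ E₀')
    (z : ℂ) :
    ratio F G E F₀ G₀ E₀' .outerRight z - ratio F G E F₀ G₀ E₀' .innerRight z =
      E z * e * (G z - G₀ z) * (Region.innerRight.multInv (F₀ z) (G₀ z) * E₀' z) := by
  have h3 := ratio_jump_aux h h₀ z
  simp only [ratio, Region.mult, Region.multInv, mul_one, one_mul]
  rw [mul_assoc (E z), ← mul_assoc (1 + G z), h3, add_mul, mul_add, one_mul]
  simp [mul_assoc]

lemma ratio_jump_sigmaMinus (h : IsExtension c e F G E E') (h₀ : IsExtension c e F₀ G₀ E₀ E₀')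
    (z : ℂ) :
    ratio F G E F₀ G₀ E₀' .outerLeft z - ratio F G E F₀ G₀ E₀' .innerLeft z =
      E z * (1 + F z) * e * (G z - G₀ z) *
        (Region.innerLeft.multInv (F₀ z) (G₀ z) * E₀' z) := by
  have h3 := ratio_jump_aux h h₀ z
  simp only [ratio, Region.mult, Region.multInv]
  have h4 : E z * ((1 + F z) * (1 + G z)) * ((1 - G₀ z) * (1 - F₀ z) * E₀' z) =
      E z * (1 + F z) * ((1 + G z) * (1 - G₀ z)) * ((1 - F₀ z) * E₀' z) := by
    simp only [mul_assoc]
  rw [h4, h3, mul_add, add_mul, mul_one]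
  simp [mul_assoc]

lemma mem_closed_inner {c : ℝ} {z : ℂ} (hz : |z.re| ≤ c / 2) (hc : 0 < c) :
    (0 ≤ z.re ∧ z ∈ Region.innerRight.closed c) ∨ (z.re ≤ 0 ∧ z ∈ Region.innerLeft.closed c) := by
  obtain ⟨h1, h2⟩ := abs_le.1 hz
  have := abs_nonneg z.im
  rcases le_total 0 z.re with h | h
  · exact Or.inl ⟨h, h, by linarith⟩
  · exact Or.inr ⟨h, by linarith, h⟩

/-- Since `(1 + F) (1 - e) = 1 - e` and `(1 + G) e = e`, the three products are values of the
solution times a constant on both sides of their part of the contour. They are thus bounded on the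
strip `|Re z| ≤ c/2` or on a half plane beyond `±c/2`, and Phragmén–Lindelöf moves the bound from
the lines `Re z = ±c/2`, at distance `c/2` from the contour, to the contour itself. -/
lemma norm_value_mul_le (hc : 0 < c) (h : IsExtension c e F G E E') {S : ℝ}
    (hr : ∀ z : ℂ, z.re = c / 2 → ‖E z‖ ≤ S) (hl : ∀ z : ℂ, z.re = -(c / 2) → ‖E z * (1 + F z)‖ ≤ S) :
    (∀ z ∈ imAxis, ‖E z * (1 - e)‖ ≤ S * ‖1 - e‖) ∧
    (∀ z ∈ sigmaPlus c, ‖E z * e‖ ≤ S * ‖e‖) ∧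
    (∀ z ∈ sigmaMinus c, ‖E z * (1 + F z) * e‖ ≤ S * ‖e‖) := by
  obtain ⟨B, hB0, hB, -, -⟩ := h.exists_bound
  have hle : ∀ x : 𝔸, ∀ (b : ℝ) (y : 𝔸), ‖y‖ ≤ b → ‖y * x‖ ≤ b * ‖x‖ := fun x b y hy =>
    (norm_mul_le _ _).trans (by gcongr)
  have hF : ∀ z, E z * (1 + F z) * (1 - e) = E z * (1 - e) := fun z => by
    rw [mul_assoc, add_mul, one_mul, mul_sub (F z), h.F_mul]; simp
  have hG : ∀ z, (1 + G z) * e = e := fun z => by rw [add_mul, h.G_mul]; simp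
  refine ⟨fun z hz => ?_, fun z hz => ?_, fun z hz => ?_⟩
  · refine diff_PhragmenLindelof_strip (δ := c / 2) (B := B * ‖1 - e‖) (by linarith)
      (h.diff_E.mul_const _) (fun w hw => ?_) (fun w hw => ?_) hz
    · rcases mem_closed_inner hw hc with ⟨-, hw'⟩ | ⟨-, hw'⟩
      · simpa [Region.mult] using hle (1 - e) B _ (hB _ w hw')
      · rw [← hF]
        exact hle (1 - e) B _ (hB _ w hw')
    · rcases (abs_eq (by linarith)).1 hw with hw | hw
      · exact hle _ _ _ (hr w hw)
      · rw [← hF]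
        exact hle _ _ _ (hl w hw)
  · have hz' : z.re = c + |z.im| := hz
    refine norm_le_of_half_plane (δ := c / 2) (B := B * ‖e‖) (f := fun z => E z * e)
      (h.diff_E.mul_const _) (fun w hw => ?_) (fun w hw => hle _ _ _ (hr w hw))
      (by linarith [abs_nonneg z.im])
    rcases le_total w.re (c + |w.im|) with hw' | hw'
    · simpa [Region.mult] using hle e B _ (hB .innerRight w ⟨by linarith, hw'⟩)
    · have := hle e B _ (hB .outerRight w hw')
      rwa [Region.mult, mul_assoc, hG] at this
  · have hz' : z.re = -(c + |z.im|) := hz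
    have := norm_le_of_half_plane (δ := c / 2) (S := S * ‖e‖) (B := B * ‖e‖)
      (f := fun z => E (-z) * (1 + F (-z)) * e) (z := -z)
      (((h.diff_E.comp differentiable_neg).mul
        ((h.diff_F.comp differentiable_neg).const_add 1)).mul_const _)
      (fun w hw => ?_) (fun w hw => hle _ _ _ (hl _ (by simp [hw])))
      (by simp; linarith [abs_nonneg z.im])
    · simpa using this
    rcases le_total w.re (c + |w.im|) with hw' | hw'
    · exact hle e B _ (hB .innerLeft (-w) (by
        simp only [Region.closed, Set.mem_ofPred_eq, Complex.neg_re, Complex.neg_im, abs_neg]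
        constructor <;> linarith))
    · have := hle e B _ (hB .outerLeft (-w) (by
        simp only [Region.closed, Set.mem_ofPred_eq, Complex.neg_re, Complex.neg_im, abs_neg]
        linarith))
      rwa [Region.mult, ← mul_assoc, mul_assoc _ _ e, hG] at this

lemma differentiable_ratio (h : IsExtension c e F G E E') (h₀ : IsExtension c e F₀ G₀ E₀ E₀')
    (β : Region) : Differentiable ℂ (ratio F G E F₀ G₀ E₀' β) :=
  (h.diff_E.mul (Region.differentiable_mult h.diff_F h.diff_G β)).mul
    ((Region.differentiable_multInv h₀.diff_F h₀.diff_G β).mul h₀.diff_E')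

lemma ratio_sub_one (h₀ : IsExtension c e F₀ G₀ E₀ E₀') (β : Region) (z : ℂ) :
    ratio F G E F₀ G₀ E₀' β z - 1 =
      ((E z * β.mult (F z) (G z) - 1) - (E₀ z * β.mult (F₀ z) (G₀ z) - 1)) *
        (β.multInv (F₀ z) (G₀ z) * E₀' z) := by
  rw [sub_sub_sub_cancel_right, sub_mul, h₀.value_mul_inv, ratio]

lemma exists_norm_ratio_sub_one_le (h : IsExtension c e F G E E')
    (h₀ : IsExtension c e F₀ G₀ E₀ E₀') :
    ∃ K, ∀ β : Region, ∀ z ∈ β.closed c, 1 ≤ ‖z‖ →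
      ‖ratio F G E F₀ G₀ E₀' β z - 1‖ ≤ K / ‖z‖ := by
  obtain ⟨B, hB0, -, -, hB⟩ := h.exists_bound
  obtain ⟨B₀, hB₀0, -, hB₀', hB₀⟩ := h₀.exists_bound
  refine ⟨(B + B₀) * B₀, fun β z hz hz1 => ?_⟩
  rw [ratio_sub_one h₀]
  refine (norm_mul_le _ _).trans ?_
  have h1 : ‖(E z * β.mult (F z) (G z) - 1) - (E₀ z * β.mult (F₀ z) (G₀ z) - 1)‖ ≤
      (B + B₀) / ‖z‖ := by
    refine (norm_sub_le _ _).trans ?_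
    rw [add_div]
    refine add_le_add ((hB β z hz).trans ?_) ((hB₀ β z hz).trans ?_) <;> gcongr <;> linarith
  calc _ ≤ (B + B₀) / ‖z‖ * B₀ := by
        gcongr
        exact hB₀' β z hz
    _ = _ := by ring

variable [CompleteSpace 𝔸]

/-- The jump estimate with limit `1` at infinity, still conditional on a bound `S` for the perturbed
solution on `Re z = ±c/2`. Bootstrapping will remove `S`. -/
lemma norm_ratio_sub_one_le_of_bound (hc : 0 < c) (h : IsExtension c e F G E E')
    (h₀ : IsExtension c e F₀ G₀ E₀ E₀') {B κ S : ℝ} (hκ : 0 ≤ κ) (hB0 : 0 ≤ B) (hS0 : 0 ≤ S)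
    (hB : ∀ (β : Region), ∀ z ∈ β.closed c, ‖β.multInv (F₀ z) (G₀ z) * E₀' z‖ ≤ B)
    (hF : ∀ z ∈ imAxis, ‖F z - F₀ z‖ ≤ κ * (1 + z.im ^ 2)⁻¹)
    (hG : ∀ z ∈ sigma c, ‖G z - G₀ z‖ ≤ κ * (1 + z.im ^ 2)⁻¹)
    (hr : ∀ z : ℂ, z.re = c / 2 → ‖E z‖ ≤ S) (hl : ∀ z : ℂ, z.re = -(c / 2) → ‖E z * (1 + F z)‖ ≤ S)
    {β : Region} {z : ℂ} (hz : z ∈ β.interior c) {d : ℝ} (hd : 0 < d)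
    (hdist : ∀ w ∈ contour c, d ≤ ‖w - z‖) :
    ‖ratio F G E F₀ G₀ E₀' β z - 1‖ ≤ 2 * (S * (‖e‖ + ‖1 - e‖) * κ * B) / d := by
  obtain ⟨K, hK⟩ := exists_norm_ratio_sub_one_le h h₀
  obtain ⟨p1, p2, p3⟩ := norm_value_mul_le hc h hr hl
  have hmul : ∀ (x y w : 𝔸) (t : ℝ) (z : ℂ), (t = ‖e‖ ∨ t = ‖1 - e‖) → ‖x‖ ≤ S * t →
      ‖y‖ ≤ κ * (1 + z.im ^ 2)⁻¹ → ‖w‖ ≤ B →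
      ‖x * y * w‖ ≤ S * (‖e‖ + ‖1 - e‖) * κ * B * (1 + z.im ^ 2)⁻¹ := by
    intro x y w t z ht hx hy hw
    have ht' : t ≤ ‖e‖ + ‖1 - e‖ := by
      rcases ht with rfl | rfl <;> linarith [norm_nonneg e, norm_nonneg (1 - e)]
    calc ‖x * y * w‖ ≤ ‖x‖ * ‖y‖ * ‖w‖ :=
          (norm_mul_le _ _).trans (by gcongr; exact norm_mul_le _ _)
      _ ≤ (S * (‖e‖ + ‖1 - e‖)) * (κ * (1 + z.im ^ 2)⁻¹) * B := by
          gcongr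
          exact hx.trans (by gcongr)
      _ = _ := by ring
  refine norm_sub_le_of_jump hc (differentiable_ratio h h₀) hK (by positivity)
    (fun w hw => ?_) (fun w hw => ?_) (fun w hw => ?_) hz hd hdist
  · have hw' : w.re = 0 := hw
    rw [ratio_jump_imAxis h h₀]
    exact hmul _ _ _ _ _ (Or.inr rfl) (p1 w hw) (hF w hw)
      (hB _ w ⟨hw'.symm.le, by rw [hw']; positivity⟩)
  · have hw' : w.re = c + |w.im| := hw
    rw [ratio_jump_sigmaPlus h h₀]
    exact hmul _ _ _ _ _ (Or.inl rfl) (p2 w hw) (hG w (Or.inl hw))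
      (hB _ w ⟨by rw [hw']; positivity, hw'.le⟩)
  · have hw' : w.re = -(c + |w.im|) := hw
    rw [ratio_jump_sigmaMinus h h₀]
    exact hmul _ _ _ _ _ (Or.inl rfl) (p3 w hw) (hG w (Or.inr hw))
      (hB _ w ⟨hw'.symm.le, by rw [hw']; linarith [abs_nonneg w.im]⟩)

/-- Stability of solutions: the quotient of two solutions with close jump matrices is close
to `1`. -/
theorem norm_ratio_sub_one_le (hc : 0 < c) (h : IsExtension c e F G E E')
    (h₀ : IsExtension c e F₀ G₀ E₀ E₀') {B κ : ℝ} (hκ : 0 ≤ κ) (hB0 : 0 < B)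
    (hB : ∀ (β : Region), ∀ z ∈ β.closed c, ‖E₀ z * β.mult (F₀ z) (G₀ z)‖ ≤ B)
    (hB' : ∀ (β : Region), ∀ z ∈ β.closed c, ‖β.multInv (F₀ z) (G₀ z) * E₀' z‖ ≤ B)
    (hF : ∀ z ∈ imAxis, ‖F z - F₀ z‖ ≤ κ * (1 + z.im ^ 2)⁻¹)
    (hG : ∀ z ∈ sigma c, ‖G z - G₀ z‖ ≤ κ * (1 + z.im ^ 2)⁻¹)
    (hsmall : 8 * (‖e‖ + ‖1 - e‖) * B ^ 2 * κ ≤ c)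
    {β : Region} {z : ℂ} (hz : z ∈ β.interior c) :
    ‖ratio F G E F₀ G₀ E₀' β z - 1‖ ≤
      4 * (‖e‖ + ‖1 - e‖) * B ^ 2 * κ / Metric.infDist z (contour c) := by
  set n := ‖e‖ + ‖1 - e‖ with hn
  have hn0 : 0 ≤ n := by positivity
  let P : ℝ → Prop := fun S => (∀ z : ℂ, z.re = c / 2 → ‖E z‖ ≤ S) ∧
    (∀ z : ℂ, z.re = -(c / 2) → ‖E z * (1 + F z)‖ ≤ S)
  -- A bound on the two lines controls the jump, and Cauchy's formula at distance `c/2` returns a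
  -- bound on the same lines; `hsmall` makes the feedback factor `1/2`.
  have step : ∀ S, 0 ≤ S → P S → P (B + S / 2) := by
    intro S hS hP
    have key : ∀ (β : Region) (z : ℂ), |z.re| = c / 2 → z ∈ β.interior c →
        ‖E z * β.mult (F z) (G z)‖ ≤ B + S / 2 := by
      intro β z hre hz
      have hdist : ∀ w ∈ contour c, c / 2 ≤ ‖w - z‖ := by
        intro w hw
        have h1 : |w.re - z.re| ≤ ‖w - z‖ := by simpa using Complex.abs_re_le_norm (w - z)
        refine le_trans ?_ h1
        have := abs_nonneg w.im
        rw [Region.mem_contour_iff] at hw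
        grind
      have hr := norm_ratio_sub_one_le_of_bound hc h h₀ hκ hB0.le hS hB' hF hG hP.1 hP.2 hz
        (half_pos hc) hdist
      have e1 : E z * β.mult (F z) (G z) = E₀ z * β.mult (F₀ z) (G₀ z) +
          (ratio F G E F₀ G₀ E₀' β z - 1) * (E₀ z * β.mult (F₀ z) (G₀ z)) := by
        rw [sub_mul, one_mul, ratio, mul_assoc, h₀.inv_mul_value, mul_one]
        abel
      have hBz := hB β z (β.interior_subset_closed c hz)
      rw [e1]
      refine (norm_add_le _ _).trans (add_le_add hBz ((norm_mul_le _ _).trans ?_))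
      calc _ ≤ 2 * (S * n * κ * B) / (c / 2) * B := by gcongr
        _ = S * (8 * n * B ^ 2 * κ) / (2 * c) := by field_simp; ring
        _ ≤ S * c / (2 * c) := by gcongr
        _ = S / 2 := by field_simp
    refine ⟨fun z hz => ?_, fun z hz => ?_⟩
    · have := key .innerRight z (by rw [hz, abs_of_pos (half_pos hc)])
        ⟨by linarith, by linarith [abs_nonneg z.im]⟩
      simpa [Region.mult] using this
    · exact key .innerLeft z (by rw [hz, abs_neg, abs_of_pos (half_pos hc)])
        ⟨by linarith [abs_nonneg z.im], by linarith⟩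
  obtain ⟨A, hA0, hA, -, -⟩ := h.exists_bound
  -- Iteration towards the fixed point `2 B` of `S ↦ B + S / 2` removes the a priori constant `A`,
  -- which depends on the perturbed solution. The limiting bound involves only the reference
  -- solution.
  have hiter : ∀ n : ℕ, P (2 * B + A * (1 / 2) ^ n) := by
    intro n
    induction n with
    | zero =>
      refine ⟨fun z hz => ?_, fun z hz => ?_⟩
      · have := hA .innerRight z ⟨by linarith, by linarith [abs_nonneg z.im]⟩
        simp only [Region.mult, mul_one] at this
        linarith
      · have := hA .innerLeft z ⟨by linarith [abs_nonneg z.im], by linarith⟩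
        simp only [Region.mult] at this
        linarith
    | succ n ih =>
      have := step _ (by positivity) ih
      convert this using 1
      ring
  have hlim : Tendsto (fun n : ℕ => 2 * B + A * (1 / 2 : ℝ) ^ n) atTop (𝓝 (2 * B)) := by
    have := (tendsto_pow_atTop_nhds_zero_of_lt_one (r := (1 / 2 : ℝ)) (by norm_num)
      (by norm_num)).const_mul A
    simpa using this.const_add (2 * B)
  have hP : P (2 * B) := ⟨fun z hz => ge_of_tendsto' hlim fun n => (hiter n).1 z hz,
    fun z hz => ge_of_tendsto' hlim fun n => (hiter n).2 z hz⟩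
  have := norm_ratio_sub_one_le_of_bound hc h h₀ hκ hB0.le (by positivity) hB' hF hG hP.1 hP.2 hz
    (infDist_contour_pos (β.interior_subset_compl hc hz)) (fun w hw => infDist_contour_le hw)
  refine this.trans_eq ?_
  rw [hn]
  ring

end Extension

/-! ### The differential equations, by Liouville-type arguments. -/

section LaxEquations

variable {𝔸 : Type*} [NormedRing 𝔸] [NormedAlgebra ℂ 𝔸]
variable {c : ℝ} {e : 𝔸} {F G E E' F₀ G₀ E₀ E₀' : ℂ → 𝔸}

/-- If the coefficients of nonnegative powers cancel in `Γ N - P Γ`, where `N` and `P` are cubic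
polynomials and `Γ = 1 + G₁ / z + G₂ / z² + G₃ / z³ + O(z⁻⁴)`, then it is `O(1 / z)`. -/
lemma exists_norm_mul_sub_mul_le (G₁ G₂ G₃ N₀ N₁ N₂ N₃ P₀ P₁ P₂ P₃ : 𝔸) (C : ℝ) (hC : 0 ≤ C)
    (h3 : N₃ - P₃ = 0) (h2 : G₁ * N₃ - P₃ * G₁ + (N₂ - P₂) = 0)
    (h1 : G₂ * N₃ - P₃ * G₂ + (G₁ * N₂ - P₂ * G₁) + (N₁ - P₁) = 0)
    (h0 : G₃ * N₃ - P₃ * G₃ + (G₂ * N₂ - P₂ * G₂) + (G₁ * N₁ - P₁ * G₁) + (N₀ - P₀) = 0) :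
    ∃ K, 0 ≤ K ∧ ∀ (z : ℂ) (g : 𝔸), 1 ≤ ‖z‖ →
      ‖g - (1 + z⁻¹ • G₁ + (z⁻¹) ^ 2 • G₂ + (z⁻¹) ^ 3 • G₃)‖ ≤ C / ‖z‖ ^ 4 →
      ‖g * (z ^ 3 • N₃ + z ^ 2 • N₂ + z • N₁ + N₀) -
        (z ^ 3 • P₃ + z ^ 2 • P₂ + z • P₁ + P₀) * g‖ ≤ K / ‖z‖ := by
  -- The surviving coefficients of `z⁻¹`, `z⁻²` and `z⁻³`.
  set K₁ := G₁ * N₀ - P₀ * G₁ + (G₂ * N₁ - P₁ * G₂) + (G₃ * N₂ - P₂ * G₃) with hK₁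
  set K₂ := G₂ * N₀ - P₀ * G₂ + (G₃ * N₁ - P₁ * G₃) with hK₂
  set K₃ := G₃ * N₀ - P₀ * G₃ with hK₃
  set n := ‖N₃‖ + ‖N₂‖ + ‖N₁‖ + ‖N₀‖ with hn
  set p := ‖P₃‖ + ‖P₂‖ + ‖P₁‖ + ‖P₀‖ with hp
  refine ⟨C * n + p * C + (‖K₁‖ + ‖K₂‖ + ‖K₃‖), by positivity, fun z g hz hg => ?_⟩
  have hz0 : 0 < ‖z‖ := by linarith
  have hz0' : z ≠ 0 := norm_pos_iff.1 hz0
  set r := g - (1 + z⁻¹ • G₁ + (z⁻¹) ^ 2 • G₂ + (z⁻¹) ^ 3 • G₃) with hr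
  have hpoly : ∀ a b d f : 𝔸, ‖z ^ 3 • a + z ^ 2 • b + z • d + f‖ ≤
      (‖a‖ + ‖b‖ + ‖d‖ + ‖f‖) * ‖z‖ ^ 3 := by
    intro a b d f
    have k1 : ‖z‖ ≤ ‖z‖ ^ 3 := le_self_pow₀ hz (by norm_num)
    have k2 : ‖z‖ ^ 2 ≤ ‖z‖ ^ 3 := pow_le_pow_right₀ hz (by norm_num)
    have k0 : 1 ≤ ‖z‖ ^ 3 := one_le_pow₀ hz
    calc _ ≤ ‖z ^ 3 • a‖ + ‖z ^ 2 • b‖ + ‖z • d‖ + ‖f‖ := by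
          refine (norm_add_le _ _).trans (add_le_add_left ?_ _)
          exact norm_add₃_le
      _ = ‖z‖ ^ 3 * ‖a‖ + ‖z‖ ^ 2 * ‖b‖ + ‖z‖ * ‖d‖ + 1 * ‖f‖ := by
          simp only [norm_smul, norm_pow, one_mul]
      _ ≤ ‖z‖ ^ 3 * ‖a‖ + ‖z‖ ^ 3 * ‖b‖ + ‖z‖ ^ 3 * ‖d‖ + ‖z‖ ^ 3 * ‖f‖ := by gcongr
      _ = _ := by ring
  have key : g * (z ^ 3 • N₃ + z ^ 2 • N₂ + z • N₁ + N₀) -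
        (z ^ 3 • P₃ + z ^ 2 • P₂ + z • P₁ + P₀) * g =
      r * (z ^ 3 • N₃ + z ^ 2 • N₂ + z • N₁ + N₀) -
        (z ^ 3 • P₃ + z ^ 2 • P₂ + z • P₁ + P₀) * r +
      (z⁻¹ • K₁ + (z⁻¹) ^ 2 • K₂ + (z⁻¹) ^ 3 • K₃) := by
    have hg' : g = r + (1 + z⁻¹ • G₁ + (z⁻¹) ^ 2 • G₂ + (z⁻¹) ^ 3 • G₃) := by rw [hr]; abel
    have hzero : z ^ 3 • (N₃ - P₃) + z ^ 2 • (G₁ * N₃ - P₃ * G₁ + (N₂ - P₂)) +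
        z • (G₂ * N₃ - P₃ * G₂ + (G₁ * N₂ - P₂ * G₁) + (N₁ - P₁)) +
        (G₃ * N₃ - P₃ * G₃ + (G₂ * N₂ - P₂ * G₂) + (G₁ * N₁ - P₁ * G₁) + (N₀ - P₀)) = 0 := by
      rw [h3, h2, h1, h0]; simp
    have main : (1 + z⁻¹ • G₁ + (z⁻¹) ^ 2 • G₂ + (z⁻¹) ^ 3 • G₃) *
          (z ^ 3 • N₃ + z ^ 2 • N₂ + z • N₁ + N₀) -
        (z ^ 3 • P₃ + z ^ 2 • P₂ + z • P₁ + P₀) *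
          (1 + z⁻¹ • G₁ + (z⁻¹) ^ 2 • G₂ + (z⁻¹) ^ 3 • G₃) =
        z ^ 3 • (N₃ - P₃) + z ^ 2 • (G₁ * N₃ - P₃ * G₁ + (N₂ - P₂)) +
        z • (G₂ * N₃ - P₃ * G₂ + (G₁ * N₂ - P₂ * G₁) + (N₁ - P₁)) +
        (G₃ * N₃ - P₃ * G₃ + (G₂ * N₂ - P₂ * G₂) + (G₁ * N₁ - P₁ * G₁) + (N₀ - P₀)) +
        (z⁻¹ • K₁ + (z⁻¹) ^ 2 • K₂ + (z⁻¹) ^ 3 • K₃) := by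
      rw [hK₁, hK₂, hK₃]
      simp only [add_mul, mul_add, smul_mul_assoc, mul_smul_comm, smul_smul, one_mul, mul_one,
        smul_add, smul_sub]
      match_scalars <;> field_simp
    rw [hzero, zero_add] at main
    rw [← main]
    nth_rewrite 1 2 [hg']
    rw [add_mul, mul_add (z ^ 3 • P₃ + z ^ 2 • P₂ + z • P₁ + P₀) r]
    abel
  rw [key]
  have b1 : ‖r * (z ^ 3 • N₃ + z ^ 2 • N₂ + z • N₁ + N₀)‖ ≤ C * n / ‖z‖ := by
    refine (norm_mul_le _ _).trans ?_
    calc _ ≤ C / ‖z‖ ^ 4 * (n * ‖z‖ ^ 3) := by gcongr; exact hpoly _ _ _ _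
      _ = _ := by field_simp
  have b2 : ‖(z ^ 3 • P₃ + z ^ 2 • P₂ + z • P₁ + P₀) * r‖ ≤ p * C / ‖z‖ := by
    refine (norm_mul_le _ _).trans ?_
    calc _ ≤ (p * ‖z‖ ^ 3) * (C / ‖z‖ ^ 4) := by gcongr; exact hpoly _ _ _ _
      _ = _ := by field_simp
  have hinv : ‖z‖⁻¹ ≤ 1 := inv_le_one_of_one_le₀ hz
  have hinv0 : 0 ≤ ‖z‖⁻¹ := by positivity
  have b3 : ‖z⁻¹ • K₁ + (z⁻¹) ^ 2 • K₂ + (z⁻¹) ^ 3 • K₃‖ ≤ (‖K₁‖ + ‖K₂‖ + ‖K₃‖) / ‖z‖ := by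
    refine norm_add₃_le.trans ?_
    simp only [norm_smul, norm_pow, norm_inv]
    have k2 : ‖z‖⁻¹ ^ 2 ≤ ‖z‖⁻¹ := pow_le_of_le_one hinv0 hinv (by norm_num)
    have k3 : ‖z‖⁻¹ ^ 3 ≤ ‖z‖⁻¹ := pow_le_of_le_one hinv0 hinv (by norm_num)
    calc _ ≤ ‖z‖⁻¹ * ‖K₁‖ + ‖z‖⁻¹ * ‖K₂‖ + ‖z‖⁻¹ * ‖K₃‖ := by gcongr
      _ = _ := by ring
  calc _ ≤ C * n / ‖z‖ + p * C / ‖z‖ + (‖K₁‖ + ‖K₂‖ + ‖K₃‖) / ‖z‖ :=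
        (norm_add_le _ _).trans (add_le_add ((norm_sub_le _ _).trans (add_le_add b1 b2)) b3)
    _ = _ := by ring

/-- The boundary lines are graphs over the imaginary part with slope at most `1`. A displacement by
half the distance moves a point horizontally relative to them by at most the full distance, so it
cannot cross. -/
lemma closedBall_subset_closed {c : ℝ} {β : Region} {z : ℂ} (hz : z ∈ β.interior c) :
    Metric.closedBall z (Metric.infDist z (contour c) / 2) ⊆ β.closed c := by
  intro w hw
  rw [Metric.mem_closedBall, dist_eq_norm] at hw
  have h1 : |w.re - z.re| ≤ ‖w - z‖ := by simpa using Complex.abs_re_le_norm (w - z)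
  have h2 : |w.im - z.im| ≤ ‖w - z‖ := by simpa using Complex.abs_im_le_norm (w - z)
  have hx : ∀ x : ℝ, (⟨x, z.im⟩ : ℂ) ∈ contour c → Metric.infDist z (contour c) ≤ |x - z.re| := by
    intro x hx
    refine (infDist_contour_le hx).trans_eq ?_
    rw [show (⟨x, z.im⟩ : ℂ) - z = ((x - z.re : ℝ) : ℂ) by apply Complex.ext <;> simp,
      Complex.norm_real, Real.norm_eq_abs]
  have k1 := hx (c + |z.im|) (Region.mem_contour_iff.2 (Or.inl rfl))
  have k2 := hx (-(c + |z.im|)) (Region.mem_contour_iff.2 (Or.inr (Or.inl rfl)))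
  have k3 := hx 0 (Region.mem_contour_iff.2 (Or.inr (Or.inr rfl)))
  cases β <;>
    simp only [Region.interior, Region.closed, Pearcey.outerRight, Pearcey.innerRight,
      Pearcey.innerLeft, Pearcey.outerLeft, Set.mem_ofPred_eq] at hz ⊢ <;> grind

lemma infDist_contour_le_norm (z : ℂ) : Metric.infDist z (contour c) ≤ ‖z‖ := by
  simpa using infDist_contour_le (c := c) (μ := z) (z := 0)
    (Region.mem_contour_iff.2 (Or.inr (Or.inr rfl)))

/-- Cauchy's estimate on the disc of half the distance to the contour. As `0` lies on the contour,
points of this disc have modulus at least `‖z‖ / 2`. -/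
lemma norm_deriv_value_le (h : IsExtension c e F G E E') (hc : 0 < c) {B : ℝ} (hB0 : 0 ≤ B)
    (hB : ∀ (β : Region), ∀ z ∈ β.closed c, ‖E z * β.mult (F z) (G z) - 1‖ ≤ B / (1 + ‖z‖))
    {β : Region} {z : ℂ} (hz : z ∈ β.interior c) :
    ‖deriv (fun z => E z * β.mult (F z) (G z)) z‖ ≤
      4 * B / ‖z‖ / Metric.infDist z (contour c) := by
  have hd := infDist_contour_pos (β.interior_subset_compl hc hz)
  have hdz := infDist_contour_le_norm (c := c) z
  have hdiff : Differentiable ℂ fun z => E z * β.mult (F z) (G z) :=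
    h.diff_E.mul (Region.differentiable_mult h.diff_F h.diff_G β)
  have hz0 : 0 < ‖z‖ := hd.trans_le hdz
  have := Complex.norm_deriv_le_of_forall_mem_sphere_norm_le (c := z)
    (R := Metric.infDist z (contour c) / 2) (C := 2 * B / ‖z‖)
    (f := fun z => E z * β.mult (F z) (G z) - 1) (half_pos hd) (hdiff.sub_const 1).diffContOnCl
    (fun w hw => by
      refine (hB β w (closedBall_subset_closed hz (Metric.sphere_subset_closedBall hw))).trans ?_
      rw [mem_sphere_iff_norm] at hw
      have h1 := norm_sub_norm_le z w
      rw [norm_sub_rev] at h1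
      rw [div_le_div_iff₀ (by positivity) hz0]
      nlinarith)
  rw [deriv_sub_const] at this
  refine this.trans_eq ?_
  field_simp
  ring

/-- The map `[W, ·]` is a derivation that kills `1`, so the equation for `F` and `G` passes to
products of `1 + F` and `1 + G`. -/
lemma Region.hasDerivAt_mult {W : ℂ → 𝔸} {z : ℂ}
    (hF : HasDerivAt F (W z * F z - F z * W z) z) (hG : HasDerivAt G (W z * G z - G z * W z) z)
    (β : Region) : HasDerivAt (fun z => β.mult (F z) (G z))
      (W z * β.mult (F z) (G z) - β.mult (F z) (G z) * W z) z := by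
  cases β
  · exact (hG.const_add 1).congr_deriv (by simp [Region.mult, mul_add, add_mul])
  · exact (hasDerivAt_const z _).congr_deriv (by simp [Region.mult])
  · exact (hF.const_add 1).congr_deriv (by simp [Region.mult, mul_add, add_mul])
  · refine ((hF.const_add 1).mul (hG.const_add 1)).congr_deriv ?_
    simp only [Region.mult]
    noncomm_ring

variable [CompleteSpace 𝔸]

/-- The equation in the spectral variable. -/
theorem deriv_mul_inv_add_eq (h : IsExtension c e F G E E') (hc : 0 < c) {W P : ℂ → 𝔸}
    (hW : Differentiable ℂ W) (hP : Differentiable ℂ P)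
    (hFW : ∀ z, HasDerivAt F (W z * F z - F z * W z) z)
    (hGW : ∀ z, HasDerivAt G (W z * G z - G z * W z) z) {C r₀ : ℝ} (hC0 : 0 ≤ C)
    (hC : ∀ (β : Region), ∀ z ∈ β.interior c, r₀ ≤ ‖z‖ →
      ‖E z * β.mult (F z) (G z) * W z - P z * (E z * β.mult (F z) (G z))‖ ≤ C / ‖z‖) (w : ℂ) :
    deriv E w + E w * W w = P w * E w := by
  obtain ⟨B, hB0, -, hB', hB⟩ := h.exists_bound
  have hdE : Differentiable ℂ (deriv E) := h.diff_E.deriv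
  -- This is `∂Ψ Ψ⁻¹ - P` on the inner right region. By `hfβ` it is given by the same expression in
  -- the solution on every region, so asymptotics in all directions apply to one entire function.
  set f : ℂ → 𝔸 := fun z => deriv E z * E' z + E z * W z * E' z - P z with hf
  have hfd : Differentiable ℂ f :=
    ((hdE.mul h.diff_E').add ((h.diff_E.mul hW).mul h.diff_E')).sub hP
  have hmult : ∀ (β : Region) (z : ℂ), HasDerivAt (fun z => β.mult (F z) (G z))
      (W z * β.mult (F z) (G z) - β.mult (F z) (G z) * W z) z := fun β z =>
    β.hasDerivAt_mult (hFW z) (hGW z)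
  have hfβ : ∀ (β : Region) (z : ℂ), f z =
      deriv (fun z => E z * β.mult (F z) (G z)) z * (β.multInv (F z) (G z) * E' z) +
      (E z * β.mult (F z) (G z) * W z - P z * (E z * β.mult (F z) (G z))) *
        (β.multInv (F z) (G z) * E' z) := by
    intro β z
    have hd : deriv (fun z => E z * β.mult (F z) (G z)) z =
        deriv E z * β.mult (F z) (G z) +
          E z * (W z * β.mult (F z) (G z) - β.mult (F z) (G z) * W z) :=
      ((h.diff_E z).hasDerivAt.mul (hmult β z)).deriv
    have h1 := Region.mult_mul_multInv (h.F_mul_F z) (h.G_mul_G z) β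
    have h2 : deriv E z * β.mult (F z) (G z) +
          E z * (W z * β.mult (F z) (G z) - β.mult (F z) (G z) * W z) +
          (E z * β.mult (F z) (G z) * W z - P z * (E z * β.mult (F z) (G z))) =
        (deriv E z + E z * W z - P z * E z) * β.mult (F z) (G z) := by noncomm_ring
    rw [hd, ← add_mul, h2, mul_assoc, ← mul_assoc (β.mult _ _), h1, one_mul, sub_mul, add_mul,
      mul_assoc (P z), h.mul_inv, mul_one]
  have hest : ∀ ρ : ℝ, c ≤ ρ → r₀ ≤ ρ → 2 * ‖w‖ ≤ ρ →
      ‖f w‖ ≤ 12 ^ 6 * (C * B / ρ + 4 * B * B / ρ / ρ) := by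
    intro ρ h1 h2 h3
    have hρ : 0 < ρ := hc.trans_le h1
    refine norm_le_of_norm_le_add_div_infDist hc h1 (by positivity) (by positivity) hfd
      (fun μ hμ hμ1 hμ2 => ?_) h3
    obtain ⟨β, hβ⟩ := Region.exists_mem_interior hμ
    have hd := infDist_contour_pos hμ
    have hinv := hB' β μ (β.interior_subset_closed c hβ)
    have hμ0 : 0 < ‖μ‖ := hρ.trans_le hμ1
    rw [hfβ β μ, add_comm]
    refine (norm_add_le _ _).trans (add_le_add ((norm_mul_le _ _).trans ?_)
      ((norm_mul_le _ _).trans ?_))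
    · calc _ ≤ C / ‖μ‖ * B := by gcongr; exact hC β μ hβ (h2.trans hμ1)
        _ ≤ C / ρ * B := by gcongr
        _ = _ := by ring
    · calc _ ≤ 4 * B / ‖μ‖ / Metric.infDist μ (contour c) * B := by
            gcongr
            exact norm_deriv_value_le h hc hB0.le hB hβ
        _ ≤ 4 * B / ρ / Metric.infDist μ (contour c) * B := by gcongr
        _ = _ := by ring
  have hlim : Tendsto (fun ρ : ℝ => 12 ^ 6 * (C * B / ρ + 4 * B * B / ρ / ρ)) atTop (𝓝 0) := by
    have h1 : Tendsto (fun ρ : ℝ => C * B / ρ) atTop (𝓝 0) := tendsto_const_nhds.div_atTop tendsto_id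
    have h2 : Tendsto (fun ρ : ℝ => 4 * B * B / ρ / ρ) atTop (𝓝 0) :=
      (tendsto_const_nhds.div_atTop tendsto_id).div_atTop tendsto_id
    simpa using (h1.add h2).const_mul (12 ^ 6)
  have hfw : ‖f w‖ ≤ 0 := ge_of_tendsto hlim (by
    filter_upwards [eventually_ge_atTop c, eventually_ge_atTop r₀,
      eventually_ge_atTop (2 * ‖w‖)] with ρ h1 h2 h3
    exact hest ρ h1 h2 h3)
  have hfw' : deriv E w * E' w + E w * W w * E' w = P w := sub_eq_zero.1 (norm_le_zero_iff.1 hfw)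
  rw [← hfw', add_mul, mul_assoc, mul_assoc (E w * W w), h.inv_mul, mul_one, mul_one]

/-- The equation in a deformation parameter `t`. -/
theorem tendsto_deformation {Ft Gt Et Et' D : ℝ → ℂ → 𝔸} (h₀ : IsExtension c e F₀ G₀ E₀ E₀')
    (ht : ∀ᶠ t in 𝓝 0, IsExtension c e (Ft t) (Gt t) (Et t) (Et' t)) (hc : 0 < c) {κ : ℝ}
    (hκ : 0 ≤ κ)
    (hF : ∀ᶠ t in 𝓝 0, ∀ z ∈ imAxis, ‖Ft t z - F₀ z‖ ≤ κ * |t| * (1 + z.im ^ 2)⁻¹)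
    (hG : ∀ᶠ t in 𝓝 0, ∀ z ∈ sigma c, ‖Gt t z - G₀ z‖ ≤ κ * |t| * (1 + z.im ^ 2)⁻¹)
    (hD : ∀ t, Differentiable ℂ (D t)) (hDF : ∀ t z, Ft t z * D t z = D t z * F₀ z)
    (hDG : ∀ t z, Gt t z * D t z = D t z * G₀ z) {N P : ℂ → 𝔸} (hP : Differentiable ℂ P)
    (hDN : ∀ R : ℝ, ∃ A, 0 ≤ A ∧ ∀ᶠ t in 𝓝[≠] (0 : ℝ), ∀ z : ℂ, ‖z‖ ≤ R → ‖D t z‖ ≤ ‖(1 : 𝔸)‖ + 1 ∧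
      ‖(t⁻¹ : ℂ) • (D t z - 1) - N z‖ ≤ A * |t|) {C r₀ : ℝ} (hC0 : 0 ≤ C)
    (hC : ∀ (β : Region), ∀ z ∈ β.interior c, r₀ ≤ ‖z‖ →
      ‖E₀ z * β.mult (F₀ z) (G₀ z) * N z - P z * (E₀ z * β.mult (F₀ z) (G₀ z))‖ ≤ C / ‖z‖)
    (w : ℂ) :
    Tendsto (fun t : ℝ => (t⁻¹ : ℂ) • (Et t w * D t w * E₀' w - 1)) (𝓝[≠] 0) (𝓝 (P w)) := by
  obtain ⟨B, hB0, hB, hB', -⟩ := h₀.exists_bound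
  set n := ‖e‖ + ‖1 - e‖ with hn
  set b := 4 * n * B ^ 2 * κ * (B * (‖(1 : 𝔸)‖ + 1) * B) with hb
  have hb0 : 0 ≤ b := by positivity
  rw [Metric.tendsto_nhds]
  intro ε hε
  have hlim : Tendsto (fun ρ : ℝ => 12 ^ 6 * (C * B / ρ + b / ρ)) atTop (𝓝 0) := by
    have h1 : Tendsto (fun ρ : ℝ => C * B / ρ) atTop (𝓝 0) := tendsto_const_nhds.div_atTop tendsto_id
    have h2 : Tendsto (fun ρ : ℝ => b / ρ) atTop (𝓝 0) := tendsto_const_nhds.div_atTop tendsto_id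
    simpa using (h1.add h2).const_mul (12 ^ 6)
  -- The radius is fixed before `t`: in `b` the factor `|t|` of the jump difference cancels against
  -- `t⁻¹`, so these terms are small uniformly in `t`. On the rectangle of size `ρ` only the error
  -- of `D` then depends on `t`.
  obtain ⟨ρ, hρε, hρc, hρr, hρw⟩ := ((hlim.eventually_lt_const (half_pos hε)).and
    ((eventually_ge_atTop c).and ((eventually_ge_atTop r₀).and
      (eventually_ge_atTop (2 * ‖w‖))))).exists
  have hρ : 0 < ρ := hc.trans_le hρc
  obtain ⟨A, hA0, hA⟩ := hDN (4 * ρ)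
  have hsmall1 : ∀ᶠ t : ℝ in 𝓝 0, 8 * n * B ^ 2 * (κ * |t|) < c := by
    have : Tendsto (fun t : ℝ => 8 * n * B ^ 2 * (κ * |t|)) (𝓝 0) (𝓝 0) :=
      Continuous.tendsto' (by fun_prop) _ _ (by simp)
    exact this.eventually_lt_const hc
  have hsmall2 : ∀ᶠ t : ℝ in 𝓝 0, 12 ^ 6 * (B * (A * |t|) * B) < ε / 2 := by
    have : Tendsto (fun t : ℝ => 12 ^ 6 * (B * (A * |t|) * B)) (𝓝 0) (𝓝 0) :=
      Continuous.tendsto' (by fun_prop) _ _ (by simp)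
    exact this.eventually_lt_const (half_pos hε)
  filter_upwards [hA, nhdsWithin_le_nhds hsmall1, nhdsWithin_le_nhds hsmall2,
    nhdsWithin_le_nhds ht, nhdsWithin_le_nhds hF, nhdsWithin_le_nhds hG,
    self_mem_nhdsWithin] with t hAt hs1 hs2 htE hFt hGt ht0
  have ht0' : t ≠ 0 := ht0
  have htabs : 0 < |t| := abs_pos.2 ht0'
  set f : ℂ → 𝔸 := fun z => (t⁻¹ : ℂ) • (Et t z * D t z * E₀' z - 1) - P z with hf
  have hfd : Differentiable ℂ f :=
    ((((htE.diff_E.mul (hD t)).mul h₀.diff_E').sub_const 1).const_smul (t⁻¹ : ℂ)).sub hP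
  -- Since `D` intertwines the jump factors, `E_t D E_0⁻¹` is the same whichever region is used to
  -- express it.
  have hmD : ∀ (β : Region) (z : ℂ), β.mult (Ft t z) (Gt t z) * D t z =
      D t z * β.mult (F₀ z) (G₀ z) := by
    intro β z
    have h1 : (1 + Ft t z) * D t z = D t z * (1 + F₀ z) := by
      rw [add_mul, mul_add, hDF]; simp
    have h2 : (1 + Gt t z) * D t z = D t z * (1 + G₀ z) := by
      rw [add_mul, mul_add, hDG]; simp
    cases β
    · exact h2
    · simp [Region.mult]
    · exact h1
    · simp only [Region.mult]
      rw [mul_assoc, h2, ← mul_assoc, h1, mul_assoc]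
  -- Three errors: the difference quotient of `D` is not yet `N`; `g N - P g` is only `O(1/z)`; the
  -- quotient of the solutions is not `1`.
  have hfβ : ∀ (β : Region) (z : ℂ), f z =
      (E₀ z * β.mult (F₀ z) (G₀ z) * ((t⁻¹ : ℂ) • (D t z - 1) - N z) *
        (β.multInv (F₀ z) (G₀ z) * E₀' z) +
      (E₀ z * β.mult (F₀ z) (G₀ z) * N z - P z * (E₀ z * β.mult (F₀ z) (G₀ z))) *
        (β.multInv (F₀ z) (G₀ z) * E₀' z)) +
      (t⁻¹ : ℂ) • ((ratio (Ft t) (Gt t) (Et t) F₀ G₀ E₀' β z - 1) *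
        (E₀ z * β.mult (F₀ z) (G₀ z) * D t z * (β.multInv (F₀ z) (G₀ z) * E₀' z))) := by
    intro β z
    have hv := h₀.value_mul_inv β z
    have h1 : ratio (Ft t) (Gt t) (Et t) F₀ G₀ E₀' β z *
        (E₀ z * β.mult (F₀ z) (G₀ z) * D t z * (β.multInv (F₀ z) (G₀ z) * E₀' z)) =
        Et t z * D t z * E₀' z := by
      have h2 : ratio (Ft t) (Gt t) (Et t) F₀ G₀ E₀' β z *
        (E₀ z * β.mult (F₀ z) (G₀ z) * D t z * (β.multInv (F₀ z) (G₀ z) * E₀' z)) =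
        Et t z * β.mult (Ft t z) (Gt t z) * (β.multInv (F₀ z) (G₀ z) * E₀' z *
          (E₀ z * β.mult (F₀ z) (G₀ z))) * (D t z * (β.multInv (F₀ z) (G₀ z) * E₀' z)) := by
        simp only [ratio, mul_assoc]
      rw [h2, h₀.inv_mul_value, mul_one, mul_assoc (Et t z), ← mul_assoc (β.mult _ _), hmD,
        mul_assoc (D t z), ← mul_assoc (β.mult _ _),
        Region.mult_mul_multInv (h₀.F_mul_F z) (h₀.G_mul_G z), one_mul, mul_assoc]
    rw [sub_mul (ratio _ _ _ _ _ _ _ _), h1, one_mul, ← add_mul]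
    set g := E₀ z * β.mult (F₀ z) (G₀ z) with hg
    set g' := β.multInv (F₀ z) (G₀ z) * E₀' z with hg'
    have h3 : g * ((t⁻¹ : ℂ) • (D t z - 1) - N z) + (g * N z - P z * g) =
        (t⁻¹ : ℂ) • (g * D t z - g) - P z * g := by
      rw [mul_sub, mul_smul_comm, mul_sub, mul_one]
      abel
    rw [h3, sub_mul, smul_mul_assoc, sub_mul, mul_assoc (P z), hv, mul_one, hf]
    simp only [smul_sub]
    abel
  have hest := norm_le_of_norm_le_add_div_infDist (a := B * (A * |t|) * B + C * B / ρ) (b := b)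
    hc hρc (by positivity) hb0 hfd (fun μ hμ hμ1 hμ2 => by
      obtain ⟨β, hβ⟩ := Region.exists_mem_interior hμ
      have hcl := β.interior_subset_closed c hβ
      have hd := infDist_contour_pos hμ
      obtain ⟨hD1, hD2⟩ := hAt μ hμ2
      have hμ0 : 0 < ‖μ‖ := hρ.trans_le hμ1
      have hr := norm_ratio_sub_one_le hc htE h₀ (by positivity) hB0 hB hB' hFt hGt hs1.le hβ
      rw [hfβ β μ]
      refine (norm_add_le _ _).trans (add_le_add ((norm_add_le _ _).trans (add_le_add ?_ ?_)) ?_)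
      · refine (norm_mul_le _ _).trans ?_
        gcongr
        · refine (norm_mul_le _ _).trans ?_
          gcongr
          exact hB β μ hcl
        · exact hB' β μ hcl
      · refine (norm_mul_le _ _).trans ?_
        calc _ ≤ C / ‖μ‖ * B := by
              gcongr
              · exact hC β μ hβ (hρr.trans hμ1)
              · exact hB' β μ hcl
          _ ≤ C / ρ * B := by gcongr
          _ = _ := by ring
      · have hlast : ‖E₀ μ * β.mult (F₀ μ) (G₀ μ) * D t μ * (β.multInv (F₀ μ) (G₀ μ) * E₀' μ)‖ ≤
            B * (‖(1 : 𝔸)‖ + 1) * B := by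
          refine (norm_mul_le _ _).trans ?_
          gcongr
          · refine (norm_mul_le _ _).trans ?_
            gcongr
            exact hB β μ hcl
          · exact hB' β μ hcl
        rw [norm_smul, norm_inv, Complex.norm_real, Real.norm_eq_abs]
        calc _ ≤ |t|⁻¹ * (4 * n * B ^ 2 * (κ * |t|) / Metric.infDist μ (contour c) *
                (B * (‖(1 : 𝔸)‖ + 1) * B)) := by
              gcongr
              exact (norm_mul_le _ _).trans (by gcongr)
          _ = _ := by
              rw [hb]
              field_simp) hρw
  rw [dist_eq_norm]
  refine hest.trans_lt ?_
  calc _ = 12 ^ 6 * (B * (A * |t|) * B) + 12 ^ 6 * (C * B / ρ + b / ρ) := by ring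
    _ < ε / 2 + ε / 2 := add_lt_add hs2 hρε
    _ = ε := by ring

end LaxEquations

/-! ### Holomorphic continuation across the contour. -/

section Gluing

variable {F : Type*} [NormedAddCommGroup F] [NormedSpace ℂ F]

lemma wedgeIntegral_eq_neg_of_split {f : ℂ → F} {z w : ℂ} (x : ℝ)
    (hx : x ∈ Set.uIcc z.re w.re)
    (hf : ContinuousOn f (Set.uIcc z.re w.re ×ℂ Set.uIcc z.im w.im))
    (h1 : Complex.wedgeIntegral z ⟨x, w.im⟩ f = -Complex.wedgeIntegral ⟨x, w.im⟩ z f)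
    (h2 : Complex.wedgeIntegral ⟨x, z.im⟩ w f = -Complex.wedgeIntegral w ⟨x, z.im⟩ f) :
    Complex.wedgeIntegral z w f = -Complex.wedgeIntegral w z f := by
  rw [← add_eq_zero_iff_eq_neg, Complex.wedgeIntegral_add_wedgeIntegral_eq] at h1 h2 ⊢
  simp only at h1 h2
  have hint : ∀ y ∈ Set.uIcc z.im w.im, ∀ a ∈ Set.uIcc z.re w.re, ∀ b ∈ Set.uIcc z.re w.re,
      IntervalIntegrable (fun t : ℝ => f (t + y * Complex.I)) MeasureTheory.volume a b := by
    intro y hy a ha b hb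
    refine ContinuousOn.intervalIntegrable (hf.comp (by fun_prop) fun t ht => ?_)
    rw [Complex.mem_reProdIm]
    have := Set.uIcc_subset_uIcc ha hb ht
    simpa using ⟨this, hy⟩
  have s1 := intervalIntegral.integral_add_adjacent_intervals
    (hint z.im Set.left_mem_uIcc _ Set.left_mem_uIcc x hx)
    (hint z.im Set.left_mem_uIcc x hx _ Set.right_mem_uIcc)
  have s2 := intervalIntegral.integral_add_adjacent_intervals
    (hint w.im Set.right_mem_uIcc _ Set.left_mem_uIcc x hx)
    (hint w.im Set.right_mem_uIcc x hx _ Set.right_mem_uIcc)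
  rw [← s1, ← s2, ← add_zero (0 : F)]
  nth_rewrite 1 [← h1]
  rw [← h2]
  abel

variable [CompleteSpace F]

/-- Holomorphic continuation across a vertical line. -/
lemma differentiableOn_of_vertical_line {U : Set ℂ} (hU : IsOpen U) {f : ℂ → F}
    (hf : ContinuousOn f U) (x : ℝ) (hd : ∀ z ∈ U, z.re ≠ x → DifferentiableAt ℂ f z) :
    DifferentiableOn ℂ f U := by
  -- Morera: a rectangle met by the line is cut along it, and on each half Cauchy's theorem needs
  -- differentiability only in the open rectangle.
  refine (Complex.isConservativeOn_and_continuousOn_iff_isDifferentiableOn hU).1 ⟨?_, hf⟩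
  have key : ∀ z w : ℂ, Complex.Rectangle z w ⊆ U → x ∉ Set.Ioo (min z.re w.re) (max z.re w.re) →
      Complex.wedgeIntegral z w f = -Complex.wedgeIntegral w z f := by
    intro z w hzw hx
    rw [← add_eq_zero_iff_eq_neg, Complex.wedgeIntegral_add_wedgeIntegral_eq]
    refine Complex.integral_boundary_rect_eq_zero_of_continuousOn_of_differentiableOn f z w
      (hf.mono hzw) fun y hy => (hd y (hzw ?_) ?_).differentiableWithinAt
    · exact ⟨Set.Ioo_subset_Icc_self hy.1, Set.Ioo_subset_Icc_self hy.2⟩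
    · rintro rfl
      exact hx hy.1
  intro z w hzw
  by_cases hx : x ∈ Set.Ioo (min z.re w.re) (max z.re w.re)
  · have hx' : x ∈ Set.uIcc z.re w.re := Set.Ioo_subset_Icc_self hx
    refine wedgeIntegral_eq_neg_of_split x hx' (hf.mono hzw) (key _ _ ?_ ?_) (key _ _ ?_ ?_)
    · exact fun y hy => hzw ⟨Set.uIcc_subset_uIcc_left hx' hy.1, hy.2⟩
    · rintro ⟨h1, h2⟩
      simp only [min_lt_iff, lt_max_iff, lt_self_iff_false, or_false] at h1 h2
      exact lt_asymm h1 h2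
    · exact fun y hy => hzw ⟨Set.uIcc_subset_uIcc_right hx' hy.1, hy.2⟩
    · rintro ⟨h1, h2⟩
      simp only [min_lt_iff, lt_max_iff, lt_self_iff_false, false_or] at h1 h2
      exact lt_asymm h1 h2
  · exact key z w hzw hx

/-- Holomorphic continuation across a line. -/
lemma differentiableAt_of_line {f : ℂ → F} {p v : ℂ} {r : ℝ} (hr : 0 < r) (hv : v ≠ 0)
    (hf : ContinuousOn f (Metric.ball p r))
    (hd : ∀ z ∈ Metric.ball p r, ((z - p) * v).re ≠ 0 → DifferentiableAt ℂ f z) :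
    DifferentiableAt ℂ f p := by
  have hcont : Continuous fun w : ℂ => p + w / v := by fun_prop
  set U : Set ℂ := (fun w : ℂ => p + w / v) ⁻¹' Metric.ball p r with hUdef
  have hU : IsOpen U := Metric.isOpen_ball.preimage hcont
  have hg := differentiableOn_of_vertical_line hU (f := fun w => f (p + w / v))
    (hf.comp hcont.continuousOn fun w hw => hw) 0 (fun w hw hw0 => by
      have h1 : DifferentiableAt ℂ f (p + w / v) := hd _ hw (by
        rw [add_sub_cancel_left, div_mul_cancel₀ _ hv]
        exact hw0)
      exact h1.comp w (by fun_prop))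
  have h0 : (0 : ℂ) ∈ U := by simp [hUdef, hr]
  have h1 : DifferentiableAt ℂ (fun w => f (p + w / v)) 0 := hg.differentiableAt (hU.mem_nhds h0)
  have h2 : f = (fun w => f (p + w / v)) ∘ fun z => (z - p) * v := by
    ext z
    simp [hv]
  rw [h2]
  refine DifferentiableAt.comp p ?_ (by fun_prop)
  simpa using h1

/-- Away from the two corners the contour is locally a straight line. The radius stays below the
distance `c` of the axis from `Σ` and the height of `p` above its corner. -/
lemma exists_line_of_mem_contour {c : ℝ} (hc : 0 < c) {p : ℂ} (hp : p ∈ contour c) (h1 : p ≠ c)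
    (h2 : p ≠ -c) : ∃ v : ℂ, v ≠ 0 ∧ ∃ r > 0, ∀ z ∈ Metric.ball p r, z ∈ contour c →
      ((z - p) * v).re = 0 := by
  have hre : ∀ z : ℂ, |z.re - p.re| ≤ dist z p ∧ |z.im - p.im| ≤ dist z p := fun z => by
    rw [dist_eq_norm]
    exact ⟨by simpa using Complex.abs_re_le_norm (z - p),
      by simpa using Complex.abs_im_le_norm (z - p)⟩
  have hne : ∀ b : ℝ, (⟨1, b⟩ : ℂ) ≠ 0 := fun b h => by simpa using congrArg Complex.re h
  simp only [Metric.mem_ball, Region.mem_contour_iff, Complex.mul_re, Complex.sub_re,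
    Complex.sub_im] at hp ⊢
  rcases hp with hp | hp | hp
  · have him : p.im ≠ 0 := fun h => h1 (by
      apply Complex.ext <;> simp [hp, h])
    rcases lt_or_gt_of_ne him with him | him
    · refine ⟨⟨1, -1⟩, hne _, min c (-p.im), by simp [hc, him], fun z hz hzc => ?_⟩
      have := hre z
      rw [lt_min_iff] at hz
      simp only
      grind
    · refine ⟨⟨1, 1⟩, hne _, min c p.im, by simp [hc, him], fun z hz hzc => ?_⟩
      have := hre z
      rw [lt_min_iff] at hz
      simp only
      grind
  · have him : p.im ≠ 0 := fun h => h2 (by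
      apply Complex.ext <;> simp [hp, h])
    rcases lt_or_gt_of_ne him with him | him
    · refine ⟨⟨1, 1⟩, hne _, min c (-p.im), by simp [hc, him], fun z hz hzc => ?_⟩
      have := hre z
      rw [lt_min_iff] at hz
      simp only
      grind
    · refine ⟨⟨1, -1⟩, hne _, min c p.im, by simp [hc, him], fun z hz hzc => ?_⟩
      have := hre z
      rw [lt_min_iff] at hz
      simp only
      grind
  · refine ⟨⟨1, 0⟩, hne _, c, hc, fun z hz hzc => ?_⟩
    have := hre z
    have := abs_nonneg z.im
    simp only
    grind

/-- A continuous function that is holomorphic off the contour is entire. -/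
theorem differentiable_of_continuous_of_contour {c : ℝ} (hc : 0 < c) {f : ℂ → F}
    (hf : Continuous f) (hd : ∀ z ∈ (contour c)ᶜ, DifferentiableAt ℂ f z) :
    Differentiable ℂ f := by
  have h1 : ∀ p : ℂ, p ≠ c → p ≠ -c → DifferentiableAt ℂ f p := by
    intro p hpc hpc'
    by_cases hp : p ∈ contour c
    · obtain ⟨v, hv, r, hr, h⟩ := exists_line_of_mem_contour hc hp hpc hpc'
      exact differentiableAt_of_line hr hv hf.continuousOn fun z hz hz0 =>
        hd z fun hzc => hz0 (h z hz hzc)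
    · exact hd p hp
  -- The corners `±c` are isolated, hence removable by continuity.
  have h2 : ∀ p : ℂ, (∀ᶠ z in 𝓝[≠] p, DifferentiableAt ℂ f z) → DifferentiableAt ℂ f p :=
    fun p h => (Complex.analyticAt_of_differentiable_on_punctured_nhds_of_continuousAt h
      hf.continuousAt).differentiableAt
  have hcc : (c : ℂ) ≠ -c := by
    intro h
    have := congrArg Complex.re h
    simp at this
    linarith
  intro p
  by_cases hp : p = c
  · refine h2 p ?_
    filter_upwards [self_mem_nhdsWithin, nhdsWithin_le_nhds
      (isOpen_ne.mem_nhds (show p ≠ -c by rwa [hp]))] with z hz hz'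
    exact h1 z (by rw [← hp]; exact hz) hz'
  · by_cases hp' : p = -c
    · refine h2 p ?_
      filter_upwards [self_mem_nhdsWithin, nhdsWithin_le_nhds (isOpen_ne.mem_nhds hp)] with z hz hz'
      exact h1 z hz' (by rw [← hp']; exact hz)
    · exact h1 p hp hp'

end Gluing

lemma dense_compl_contour (c : ℝ) : Dense (contour c)ᶜ := by
  rw [Metric.dense_iff]
  intro p r hr
  have hfin : ({c + |p.im|, -(c + |p.im|), 0} : Set ℝ).Finite := by simp
  obtain ⟨x, hx, hx1, hx2⟩ :=
    (hfin.countable.dense_compl ℝ).exists_between (show p.re < p.re + r by linarith)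
  refine ⟨⟨x, p.im⟩, ?_, ?_⟩
  · rw [Metric.mem_ball, dist_eq_norm,
      show (⟨x, p.im⟩ : ℂ) - p = ((x - p.re : ℝ) : ℂ) by apply Complex.ext <;> simp,
      Complex.norm_real, Real.norm_eq_abs, abs_of_pos (by linarith)]
    linarith
  · rw [Set.mem_compl_iff, Region.mem_contour_iff]
    simpa using hx

namespace Region

lemma isOpen_interior (c : ℝ) (β : Region) : IsOpen (β.interior c) := by
  have h1 : IsOpen {z : ℂ | c + |z.im| < z.re} := isOpen_lt (by fun_prop) (by fun_prop)
  have h2 : IsOpen {z : ℂ | z.re < c + |z.im|} := isOpen_lt (by fun_prop) (by fun_prop)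
  have h3 : IsOpen {z : ℂ | -(c + |z.im|) < z.re} := isOpen_lt (by fun_prop) (by fun_prop)
  have h4 : IsOpen {z : ℂ | z.re < -(c + |z.im|)} := isOpen_lt (by fun_prop) (by fun_prop)
  have h5 : IsOpen {z : ℂ | 0 < z.re} := isOpen_lt (by fun_prop) (by fun_prop)
  have h6 : IsOpen {z : ℂ | z.re < 0} := isOpen_lt (by fun_prop) (by fun_prop)
  cases β
  · exact h1
  · exact h5.inter h2
  · exact h3.inter h6
  · exact h4

lemma closed_subset_closure {c : ℝ} (hc : 0 < c) (β : Region) :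
    β.closed c ⊆ closure (β.interior c) := by
  intro p hp
  have h0 := abs_nonneg p.im
  rw [Metric.mem_closure_iff]
  intro r hr
  have key : ∃ t : ℝ, |t| < r ∧ p + t ∈ β.interior c := by
    cases β
    · refine ⟨r / 2, by rw [abs_of_pos] <;> linarith, ?_⟩
      simp only [closed, interior, Pearcey.outerRight, Set.mem_ofPred_eq] at hp ⊢
      simp
      linarith
    · simp only [closed, interior, Pearcey.innerRight, Set.mem_ofPred_eq] at hp ⊢
      by_cases h : p.re < c / 2
      · refine ⟨min r c / 2, ?_, ?_⟩
        · rw [abs_of_pos (by positivity)]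
          linarith [min_le_left r c]
        · have := min_le_right r c
          have h3 : 0 < min r c := lt_min hr hc
          simp
          constructor <;> linarith
      · refine ⟨-(min r (c / 2)) / 2, ?_, ?_⟩
        · have h3 : 0 < min r (c / 2) := by positivity
          rw [neg_div, abs_neg, abs_of_pos (by positivity)]
          linarith [min_le_left r (c / 2)]
        · have := min_le_right r (c / 2)
          have h3 : 0 < min r (c / 2) := by positivity
          simp
          constructor <;> linarith
    · simp only [closed, interior, Pearcey.innerLeft, Set.mem_ofPred_eq] at hp ⊢
      by_cases h : -(c / 2) < p.re
      · refine ⟨-(min r c) / 2, ?_, ?_⟩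
        · have h3 : 0 < min r c := lt_min hr hc
          rw [neg_div, abs_neg, abs_of_pos (by positivity)]
          linarith [min_le_left r c]
        · have := min_le_right r c
          have h3 : 0 < min r c := lt_min hr hc
          simp
          constructor <;> linarith
      · refine ⟨(min r (c / 2)) / 2, ?_, ?_⟩
        · rw [abs_of_pos (by positivity)]
          linarith [min_le_left r (c / 2)]
        · have := min_le_right r (c / 2)
          have h3 : 0 < min r (c / 2) := by positivity
          simp
          constructor <;> linarith
    · refine ⟨-(r / 2), by rw [abs_neg, abs_of_pos] <;> linarith, ?_⟩
      simp only [closed, interior, Pearcey.outerLeft, Set.mem_ofPred_eq] at hp ⊢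
      simp
      linarith
  obtain ⟨t, ht, hmem⟩ := key
  refine ⟨p + t, hmem, ?_⟩
  rw [dist_eq_norm, sub_add_cancel_left, norm_neg, Complex.norm_real]
  exact ht

open Classical in
/-- The region that contains a given point. -/
noncomputable def of (c : ℝ) (z : ℂ) : Region :=
  if h : ∃ β : Region, z ∈ β.interior c then h.choose else innerRight

lemma of_eq {c : ℝ} (hc : 0 < c) {β : Region} {z : ℂ} (hz : z ∈ β.interior c) : of c z = β := by
  have h : ∃ β : Region, z ∈ β.interior c := ⟨β, hz⟩
  rw [of, dif_pos h]
  by_contra hne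
  exact notMem_closed hc hne hz (interior_subset_closed c _ h.choose_spec)

end Region

/-! ### The entire continuation of a solution. -/

section Extension

variable {𝔸 : Type*} [NormedRing 𝔸] [NormedAlgebra ℂ 𝔸] [CompleteSpace 𝔸]

theorem exists_entire_extension {c : ℝ} (hc : 0 < c) {Γ F G : ℂ → 𝔸} (hF : Differentiable ℂ F)
    (hG : Differentiable ℂ G) (hFF : ∀ z, F z * F z = 0) (hGG : ∀ z, G z * G z = 0)
    (hΓ : ∀ z ∈ (contour c)ᶜ, DifferentiableAt ℂ Γ z)
    (h₀ : ∀ μ ∈ imAxis, ∃ Γp Γm, Tendsto Γ (𝓝[innerLeft c] μ) (𝓝 Γp) ∧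
      Tendsto Γ (𝓝[innerRight c] μ) (𝓝 Γm) ∧ Γp = Γm * (1 + F μ))
    (hp : ∀ μ ∈ sigmaPlus c, ∃ Γp Γm, Tendsto Γ (𝓝[outerRight c] μ) (𝓝 Γp) ∧
      Tendsto Γ (𝓝[innerRight c] μ) (𝓝 Γm) ∧ Γp = Γm * (1 + G μ))
    (hm : ∀ μ ∈ sigmaMinus c, ∃ Γp Γm, Tendsto Γ (𝓝[outerLeft c] μ) (𝓝 Γp) ∧
      Tendsto Γ (𝓝[innerLeft c] μ) (𝓝 Γm) ∧ Γp = Γm * (1 + G μ)) :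
    ∃ E : ℂ → 𝔸, Differentiable ℂ E ∧
      ∀ (β : Region), ∀ z ∈ β.interior c, E z * β.mult (F z) (G z) = Γ z := by
  -- Undoing the jump factors makes the two one-sided limits agree at every contour point. The
  -- values of `f` on the contour are immaterial: only limits from the complement are used.
  set f : ℂ → 𝔸 := fun z => Γ z * (Region.of c z).multInv (F z) (G z) with hf
  have hfβ : ∀ (β : Region), ∀ z ∈ β.interior c, f z = Γ z * β.multInv (F z) (G z) := by
    intro β z hz
    simp only [hf, Region.of_eq hc hz]
  have hfd : ∀ z ∈ (contour c)ᶜ, DifferentiableAt ℂ f z := by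
    intro z hz
    obtain ⟨β, hβ⟩ := Region.exists_mem_interior hz
    have h1 : DifferentiableAt ℂ (fun z => Γ z * β.multInv (F z) (G z)) z :=
      (hΓ z hz).mul (Region.differentiable_multInv hF hG β z)
    refine h1.congr_of_eventuallyEq ?_
    filter_upwards [(β.isOpen_interior c).mem_nhds hβ] with w hw using hfβ β w hw
  have hlim : ∀ (β : Region) (p : ℂ) (L : 𝔸), Tendsto Γ (𝓝[β.interior c] p) (𝓝 L) →
      Tendsto f (𝓝[β.interior c] p) (𝓝 (L * β.multInv (F p) (G p))) := by
    intro β p L hL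
    have h1 : Tendsto (fun z => β.multInv (F z) (G z)) (𝓝[β.interior c] p)
        (𝓝 (β.multInv (F p) (G p))) :=
      (Region.differentiable_multInv hF hG β p).continuousAt.tendsto.mono_left nhdsWithin_le_nhds
    refine (hL.mul h1).congr' ?_
    filter_upwards [self_mem_nhdsWithin] with z hz using (hfβ β z hz).symm
  -- Each contour point, corners included, has a neighbourhood that meets only two regions.
  have hglue : ∀ (β γ : Region) (p : ℂ) (L : 𝔸) (O : Set ℂ), IsOpen O → p ∈ O →
      (O ∩ (contour c)ᶜ ⊆ β.interior c ∪ γ.interior c) →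
      Tendsto f (𝓝[β.interior c] p) (𝓝 L) → Tendsto f (𝓝[γ.interior c] p) (𝓝 L) →
      Tendsto f (𝓝[(contour c)ᶜ] p) (𝓝 L) := by
    intro β γ p L O hO hpO hsub h1 h2
    have h3 : Tendsto f (𝓝[β.interior c ∪ γ.interior c] p) (𝓝 L) := by
      rw [nhdsWithin_union]
      exact h1.sup h2
    refine h3.mono_left (nhdsWithin_le_iff.2 ?_)
    exact mem_of_superset (inter_mem (mem_nhdsWithin_of_mem_nhds (hO.mem_nhds hpO))
      self_mem_nhdsWithin) hsub
  have hex : ∀ p, ∃ L, Tendsto f (𝓝[(contour c)ᶜ] p) (𝓝 L) := by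
    intro p
    by_cases hpc : p ∈ contour c
    · have hpc' := hpc
      rw [Region.mem_contour_iff] at hpc'
      have habs := abs_nonneg p.im
      rcases hpc' with h | h | h
      · obtain ⟨Γp, Γm, l1, l2, e⟩ := hp p h
        refine ⟨Γm, hglue .outerRight .innerRight p _ {z | 0 < z.re}
          (isOpen_lt (by fun_prop) (by fun_prop)) (by simp; linarith) ?_ ?_ ?_⟩
        · rintro z ⟨hz, hz'⟩
          rw [Set.mem_compl_iff, Region.mem_contour_iff] at hz'
          simp only [Set.mem_ofPred_eq, Region.interior, outerRight, innerRight,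
            Set.mem_union] at hz ⊢
          grind
        · have := hlim .outerRight p _ l1
          rwa [e, Region.multInv, mul_assoc, Region.one_add_mul_one_sub (hGG p), mul_one] at this
        · simpa [Region.multInv] using hlim .innerRight p _ l2
      · obtain ⟨Γp, Γm, l1, l2, e⟩ := hm p h
        refine ⟨Γm * (1 - F p), hglue .outerLeft .innerLeft p _ {z | z.re < 0}
          (isOpen_lt (by fun_prop) (by fun_prop)) (by simp; linarith) ?_ ?_ ?_⟩
        · rintro z ⟨hz, hz'⟩
          rw [Set.mem_compl_iff, Region.mem_contour_iff] at hz'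
          simp only [Set.mem_ofPred_eq, Region.interior, outerLeft, innerLeft,
            Set.mem_union] at hz ⊢
          grind
        · have := hlim .outerLeft p _ l1
          rwa [e, Region.multInv, mul_assoc, ← mul_assoc (1 + G p),
            Region.one_add_mul_one_sub (hGG p), one_mul] at this
        · exact hlim .innerLeft p _ l2
      · obtain ⟨Γp, Γm, l1, l2, e⟩ := h₀ p h
        refine ⟨Γm, hglue .innerLeft .innerRight p _ {z | |z.re| < c + |z.im|}
          (isOpen_lt (by fun_prop) (by fun_prop)) (by simp [h]; linarith) ?_ ?_ ?_⟩
        · rintro z ⟨hz, hz'⟩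
          rw [Set.mem_compl_iff, Region.mem_contour_iff] at hz'
          simp only [Set.mem_ofPred_eq, Region.interior, innerRight, innerLeft,
            Set.mem_union] at hz ⊢
          grind
        · have := hlim .innerLeft p _ l1
          rwa [e, Region.multInv, mul_assoc, Region.one_add_mul_one_sub (hFF p), mul_one] at this
        · simpa [Region.multInv] using hlim .innerRight p _ l2
    · exact ⟨f p, (hfd p hpc).continuousAt.tendsto.mono_left nhdsWithin_le_nhds⟩
  set E := extendFrom (contour c)ᶜ f with hE
  have hEf : ∀ z ∈ (contour c)ᶜ, E z = f z := fun z hz =>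
    extendFrom_eq (subset_closure hz)
      ((hfd z hz).continuousAt.tendsto.mono_left nhdsWithin_le_nhds)
  refine ⟨E, differentiable_of_continuous_of_contour hc
    (continuous_extendFrom (dense_compl_contour c) hex) fun z hz => ?_, fun β z hz => ?_⟩
  · refine (hfd z hz).congr_of_eventuallyEq ?_
    filter_upwards [(isClosed_contour c).isOpen_compl.mem_nhds hz] with w hw using hEf w hw
  · rw [hEf z (β.interior_subset_compl hc hz), hfβ β z hz, mul_assoc,
      Region.multInv_mul_mult (hFF z) (hGG z), mul_one]

end Extension

-- Matrix-valued functions, with a submultiplicative norm so that the results for normed algebras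
-- apply.

attribute [local instance] Matrix.linftyOpNormedRing Matrix.linftyOpNormedAlgebra

section MatrixValued

variable {ι : Type*} [Fintype ι] [DecidableEq ι]

lemma eq_sum_smul_single (A : Matrix ι ι ℂ) :
    A = ∑ i, ∑ j, A i j • (single i j (1 : ℂ) : Matrix ι ι ℂ) := by
  conv_lhs => rw [matrix_eq_sum_single A]
  simp [smul_single]

lemma hasDerivAt_matrix {A : ℂ → Matrix ι ι ℂ} {A' : Matrix ι ι ℂ} {z : ℂ}
    (h : ∀ i j, HasDerivAt (fun z => A z i j) (A' i j) z) : HasDerivAt A A' z := by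
  have h1 : A = fun z => ∑ i, ∑ j, A z i j • (single i j (1 : ℂ) : Matrix ι ι ℂ) :=
    funext fun z => eq_sum_smul_single (A z)
  rw [h1, eq_sum_smul_single A']
  exact HasDerivAt.fun_sum fun i _ => HasDerivAt.fun_sum fun j _ => (h i j).smul_const _

lemma differentiableAt_matrix {A : ℂ → Matrix ι ι ℂ} {z : ℂ}
    (h : ∀ i j, DifferentiableAt ℂ (fun z => A z i j) z) : DifferentiableAt ℂ A z :=
  (hasDerivAt_matrix (A' := fun i j => deriv (fun z => A z i j) z)
    fun i j => (h i j).hasDerivAt).differentiableAt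

/-- A matrix entry, as a continuous linear map. -/
noncomputable def entryCLM (i j : ι) : Matrix ι ι ℂ →L[ℂ] ℂ :=
  LinearMap.toContinuousLinearMap (entryLinearMap ℂ ℂ i j)

omit [DecidableEq ι] in
lemma entryCLM_apply (i j : ι) (A : Matrix ι ι ℂ) : entryCLM i j A = A i j := rfl

lemma differentiableAt_entry {A : ℂ → Matrix ι ι ℂ} {z : ℂ} (h : DifferentiableAt ℂ A z)
    (i j : ι) : DifferentiableAt ℂ (fun z => A z i j) z :=
  (entryCLM i j).differentiableAt.comp z h

lemma isBigO_matrix {α : Type*} {l : Filter α} {A : α → Matrix ι ι ℂ} {g : α → ℂ}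
    (h : ∀ i j, (fun z => A z i j) =O[l] g) : A =O[l] g := by
  have h1 : A = fun z => ∑ i, ∑ j, A z i j • (single i j (1 : ℂ) : Matrix ι ι ℂ) :=
    funext fun z => eq_sum_smul_single (A z)
  rw [h1]
  refine Asymptotics.IsBigO.fun_sum fun i _ => Asymptotics.IsBigO.fun_sum fun j _ => ?_
  refine Asymptotics.IsBigO.trans ?_ (h i j)
  refine Asymptotics.IsBigO.of_bound ‖(single i j (1 : ℂ) : Matrix ι ι ℂ)‖
    (Eventually.of_forall fun z => ?_)
  rw [norm_smul, mul_comm]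

lemma norm_matrix_le {A : Matrix ι ι ℂ} {C : ℝ} (h : ∀ i j, ‖A i j‖ ≤ C) :
    ‖A‖ ≤ (∑ i : ι, ∑ j : ι, ‖(single i j (1 : ℂ) : Matrix ι ι ℂ)‖) * C := by
  conv_lhs => rw [eq_sum_smul_single A]
  rw [Finset.sum_mul]
  refine norm_sum_le_of_le _ fun i _ => ?_
  rw [Finset.sum_mul]
  refine norm_sum_le_of_le _ fun j _ => ?_
  rw [norm_smul, mul_comm]
  gcongr
  exact h i j

lemma norm_diagonal_le {v : ι → ℂ} {C : ℝ} (hC : 0 ≤ C) (h : ∀ i, ‖v i‖ ≤ C) :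
    ‖(diagonal v : Matrix ι ι ℂ)‖ ≤ C := by
  rw [linfty_opNorm_diagonal]
  exact (pi_norm_le_iff_of_nonneg hC).2 h

lemma differentiableAt_det {A : ℂ → Matrix ι ι ℂ} {z : ℂ}
    (h : ∀ i j, DifferentiableAt ℂ (fun z => A z i j) z) :
    DifferentiableAt ℂ (fun z => (A z).det) z := by
  simp only [det_apply]
  refine DifferentiableAt.fun_sum fun σ _ => DifferentiableAt.const_smul ?_ _
  exact DifferentiableAt.fun_finsetProd fun i _ => h _ _

lemma differentiableAt_adjugate {A : ℂ → Matrix ι ι ℂ} {z : ℂ}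
    (h : DifferentiableAt ℂ A z) : DifferentiableAt ℂ (fun z => (A z).adjugate) z := by
  refine differentiableAt_matrix fun i j => ?_
  simp only [adjugate_apply]
  refine differentiableAt_det fun k l => ?_
  simp only [updateRow_apply]
  split_ifs
  · exact differentiableAt_const _
  · exact differentiableAt_entry h k l

end MatrixValued

/-! ### From asymptotics to uniform bounds on the closed regions. -/

section Bounds

variable {𝔸 : Type*} [NormedRing 𝔸]

lemma exists_forall_mem_closed_of_interior {c : ℝ} (hc : 0 < c) {f : Region → ℂ → 𝔸}
    (hf : ∀ β, Continuous (f β)) {C r₀ : ℝ}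
    (h : ∀ (β : Region), ∀ z ∈ β.interior c, r₀ < ‖z‖ → ‖f β z - 1‖ ≤ C / (1 + ‖z‖)) :
    ∀ (β : Region), ∀ z ∈ β.closed c, r₀ < ‖z‖ → ‖f β z - 1‖ ≤ C / (1 + ‖z‖) := by
  intro β z hz hr
  have hcl : IsClosed {w : ℂ | ‖f β w - 1‖ ≤ C / (1 + ‖w‖)} := by
    refine isClosed_le (((hf β).sub continuous_const).norm)
      (continuous_const.div (by fun_prop) fun w => by positivity)
  have hmem : z ∈ closure (β.interior c ∩ {w | r₀ < ‖w‖}) := by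
    rw [Set.inter_comm]
    exact (isOpen_lt continuous_const continuous_norm).inter_closure
      ⟨hr, β.closed_subset_closure hc hz⟩
  exact closure_minimal (fun w hw => h β w hw.1 hw.2) hcl hmem

lemma exists_bound_of_large {c : ℝ} {f : Region → ℂ → 𝔸} (hf : ∀ β, Continuous (f β)) {C r₀ : ℝ}
    (h : ∀ (β : Region), ∀ z ∈ β.closed c, r₀ < ‖z‖ → ‖f β z - 1‖ ≤ C / (1 + ‖z‖)) :
    ∃ K, ∀ (β : Region), ∀ z ∈ β.closed c, ‖f β z - 1‖ ≤ K / (1 + ‖z‖) := by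
  have hK : ∀ β, ∃ K, ∀ z ∈ Metric.closedBall (0 : ℂ) r₀, ‖f β z - 1‖ ≤ K := fun β =>
    (isCompact_closedBall 0 r₀).exists_bound_of_continuousOn
      ((hf β).sub continuous_const).continuousOn
  choose K hK using hK
  set K' := |K .outerRight| + |K .innerRight| + |K .innerLeft| + |K .outerLeft| with hK'
  have hle : ∀ β, K β ≤ K' := by
    intro β
    have h1 := abs_nonneg (K .outerRight)
    have h2 := abs_nonneg (K .innerRight)
    have h3 := abs_nonneg (K .innerLeft)
    have h4 := abs_nonneg (K .outerLeft)
    have := le_abs_self (K β)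
    cases β <;> linarith
  have hK'0 : 0 ≤ K' := by positivity
  refine ⟨K' * (1 + |r₀|) + |C|, fun β z hz => ?_⟩
  rw [le_div_iff₀ (by positivity)]
  rcases le_or_gt ‖z‖ r₀ with hr | hr
  · have h1 := (hK β z (by simpa using hr)).trans (hle β)
    have h2 : 1 + ‖z‖ ≤ 1 + |r₀| := by linarith [le_abs_self r₀]
    have := mul_le_mul h1 h2 (by positivity) hK'0
    linarith [abs_nonneg C]
  · have h1 := h β z hz hr
    rw [le_div_iff₀ (by positivity)] at h1
    have : 0 ≤ K' * (1 + |r₀|) := by positivity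
    linarith [le_abs_self C]

/-- Where `‖f - 1‖ ≤ 1/2`, the identity `f' = 1 - (f - 1) f'` gives `‖f'‖ ≤ 2 ‖1‖`; the rest is
compact. -/
lemma exists_bound_inv {c : ℝ} {f f' : Region → ℂ → 𝔸} (hf' : ∀ β, Continuous (f' β))
    (hinv : ∀ β z, f β z * f' β z = 1) {K : ℝ}
    (h : ∀ (β : Region), ∀ z ∈ β.closed c, ‖f β z - 1‖ ≤ K / (1 + ‖z‖)) :
    ∃ K', ∀ (β : Region), ∀ z ∈ β.closed c, ‖f' β z‖ ≤ K' := by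
  have hB : ∀ β, ∃ B, ∀ z ∈ Metric.closedBall (0 : ℂ) (2 * |K|), ‖f' β z‖ ≤ B := fun β =>
    (isCompact_closedBall 0 _).exists_bound_of_continuousOn (hf' β).continuousOn
  choose B hB using hB
  set B' := |B .outerRight| + |B .innerRight| + |B .innerLeft| + |B .outerLeft| with hB'
  have hle : ∀ β, B β ≤ B' := by
    intro β
    have h1 := abs_nonneg (B .outerRight)
    have h2 := abs_nonneg (B .innerRight)
    have h3 := abs_nonneg (B .innerLeft)
    have h4 := abs_nonneg (B .outerLeft)
    have := le_abs_self (B β)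
    cases β <;> linarith
  have hB'0 : 0 ≤ B' := by positivity
  refine ⟨B' + 2 * ‖(1 : 𝔸)‖, fun β z hz => ?_⟩
  rcases le_or_gt ‖z‖ (2 * |K|) with hr | hr
  · have h1 := (hB β z (by simpa using hr)).trans (hle β)
    linarith [norm_nonneg (1 : 𝔸)]
  · have h1 : ‖f β z - 1‖ ≤ 1 / 2 := by
      refine (h β z hz).trans ?_
      rw [div_le_iff₀ (by positivity)]
      linarith [le_abs_self K]
    have h2 : f' β z = 1 - (f β z - 1) * f' β z := by
      rw [sub_mul, hinv]; simp
    have h3 : ‖f' β z‖ ≤ ‖(1 : 𝔸)‖ + 1 / 2 * ‖f' β z‖ := by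
      conv_lhs => rw [h2]
      refine (norm_sub_le _ _).trans ?_
      gcongr
      exact (norm_mul_le _ _).trans (by gcongr)
    linarith

end Bounds

/-! ### The Riemann–Hilbert problem as an instance of the abstract setting. -/

section Blocks

variable {N : ℕ}

/-- The projection to the first block. -/
def blockProj (N : ℕ) : Mat N := fromBlocks 1 0 0 0

/-- The entire continuation of the lower left block of the jump on the imaginary axis. -/
noncomputable def fMat (a : Fin N → ℝ) (k : Fin (N + 1) → ℝ) (s τ : ℝ) (z : ℂ) : Mat N :=
  fromBlocks 0 0
    (replicateCol Unit fun j => -rootDiff k j * Complex.exp (-theta τ (a j + s) z)) 0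

/-- The entire continuation of the upper right block of the jump on `Σ`. -/
noncomputable def gMat (a : Fin N → ℝ) (k : Fin (N + 1) → ℝ) (s τ : ℝ) (z : ℂ) : Mat N :=
  fromBlocks 0
    (replicateRow Unit fun j => -rootDiff k j * Complex.exp (theta τ (a j + s) z)) 0 0

variable {c : ℝ} {a : Fin N → ℝ} {k : Fin (N + 1) → ℝ} {s τ : ℝ}

lemma jump_imAxis (hc : 0 < c) {z : ℂ} (hz : z ∈ imAxis) :
    jump c a k s τ z = 1 + fMat a k s τ z := by
  have h1 : z ∉ sigma c := by
    have h0 : z.re = 0 := hz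
    have := abs_nonneg z.im
    rintro (h | h)
    · have h' : z.re = c + |z.im| := h
      linarith
    · have h' : z.re = -(c + |z.im|) := h
      linarith
  have hg : gVec c a k s τ z = 0 := by
    ext j
    simp [gVec, Set.indicator_of_notMem h1]
  have hf : fVec a k s τ z = fun j => -rootDiff k j * Complex.exp (-theta τ (a j + s) z) := by
    ext j
    simp [fVec, Set.indicator_of_mem hz]
  rw [jump, fMat, hg, hf, ← fromBlocks_one, fromBlocks_add]
  simp

lemma jump_sigma (hc : 0 < c) {z : ℂ} (hz : z ∈ sigma c) :
    jump c a k s τ z = 1 + gMat a k s τ z := by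
  have h1 : z ∉ imAxis := by
    intro h0
    have h0 : z.re = 0 := h0
    have := abs_nonneg z.im
    rcases hz with h | h
    · have h' : z.re = c + |z.im| := h
      linarith
    · have h' : z.re = -(c + |z.im|) := h
      linarith
  have hg : fVec a k s τ z = 0 := by
    ext j
    simp [fVec, Set.indicator_of_notMem h1]
  have hf : gVec c a k s τ z = fun j => -rootDiff k j * Complex.exp (theta τ (a j + s) z) := by
    ext j
    simp [gVec, Set.indicator_of_mem hz]
  rw [jump, gMat, hg, hf, ← fromBlocks_one, fromBlocks_add]
  simp

lemma differentiable_theta (τ x : ℝ) : Differentiable ℂ (theta τ x) := by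
  unfold theta
  fun_prop

lemma differentiable_fMat : Differentiable ℂ (fMat a k s τ) := by
  intro z
  refine differentiableAt_matrix fun i j => ?_
  have := fun x => differentiable_theta τ x z
  rcases i with i | i <;> rcases j with j | j <;>
    simp only [fMat, fromBlocks_apply₁₁, fromBlocks_apply₁₂, fromBlocks_apply₂₁,
      fromBlocks_apply₂₂, replicateCol_apply, Matrix.zero_apply, differentiableAt_const]
  exact (((this (a i + s)).neg).cexp).const_mul _

lemma differentiable_gMat : Differentiable ℂ (gMat a k s τ) := by
  intro z
  refine differentiableAt_matrix fun i j => ?_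
  have := fun x => differentiable_theta τ x z
  rcases i with i | i <;> rcases j with j | j <;>
    simp only [gMat, fromBlocks_apply₁₁, fromBlocks_apply₁₂, fromBlocks_apply₂₁,
      fromBlocks_apply₂₂, replicateRow_apply, Matrix.zero_apply, differentiableAt_const]
  exact ((this (a j + s)).cexp).const_mul _

lemma fMat_mul (z : ℂ) : fMat a k s τ z * blockProj N = fMat a k s τ z := by
  simp [fMat, blockProj, fromBlocks_multiply]

lemma mul_fMat (z : ℂ) : blockProj N * fMat a k s τ z = 0 := by
  simp [fMat, blockProj, fromBlocks_multiply]

lemma mul_gMat (z : ℂ) : blockProj N * gMat a k s τ z = gMat a k s τ z := by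
  simp [gMat, blockProj, fromBlocks_multiply]

lemma gMat_mul (z : ℂ) : gMat a k s τ z * blockProj N = 0 := by
  simp [gMat, blockProj, fromBlocks_multiply]

lemma det_mult (β : Region) (z : ℂ) : (β.mult (fMat a k s τ z) (gMat a k s τ z)).det = 1 := by
  have hf : (1 + fMat a k s τ z).det = 1 := by
    rw [fMat, ← fromBlocks_one, fromBlocks_add]
    simp
  have hg : (1 + gMat a k s τ z).det = 1 := by
    rw [gMat, ← fromBlocks_one, fromBlocks_add]
    simp
  cases β <;> simp [Region.mult, hf, hg]

lemma exists_expansion_bound {Γ : ℂ → Mat N} {G : ℕ → Mat N} (h : IsRHPSolution c a k s τ Γ G)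
    (n : ℕ) : ∃ C r₀ : ℝ, 0 ≤ C ∧ 1 ≤ r₀ ∧ ∀ z ∈ (contour c)ᶜ, r₀ ≤ ‖z‖ →
      ‖Γ z - ∑ m ∈ Finset.range (n + 1), (z⁻¹) ^ m • G m‖ ≤ C / ‖z‖ ^ (n + 1) := by
  have h1 : (fun z : ℂ => Γ z - ∑ m ∈ Finset.range (n + 1), (z⁻¹) ^ m • G m)
      =O[Bornology.cobounded ℂ ⊓ 𝓟 (contour c)ᶜ] (fun μ : ℂ => (μ ^ (n + 1))⁻¹) := by
    refine isBigO_matrix fun i j => ?_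
    refine (h.asymptotic n i j).congr_left fun z => ?_
    rw [Matrix.sub_apply, Matrix.sum_apply]
    congr 1
    refine Finset.sum_congr rfl fun m _ => ?_
    rw [Matrix.smul_apply, smul_eq_mul, inv_pow, div_eq_inv_mul]
  obtain ⟨C, hC, hb⟩ := h1.exists_nonneg
  rw [Asymptotics.IsBigOWith, eventually_inf_principal, hasBasis_cobounded_norm.eventually_iff]
    at hb
  obtain ⟨r, -, hr⟩ := hb
  refine ⟨C, max 1 r, hC, le_max_left _ _, fun z hz hzr => ?_⟩
  refine (hr ((le_max_right _ _).trans hzr) hz).trans_eq ?_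
  rw [norm_inv, norm_pow, div_eq_mul_inv]

theorem exists_isExtension (hc : 0 < c) {Γ : ℂ → Mat N} {G : ℕ → Mat N}
    (h : IsRHPSolution c a k s τ Γ G) :
    ∃ E E' : ℂ → Mat N, IsExtension c (blockProj N) (fMat a k s τ) (gMat a k s τ) E E' ∧
      ∀ (β : Region), ∀ z ∈ β.interior c,
        E z * β.mult (fMat a k s τ z) (gMat a k s τ z) = Γ z := by
  have hFF : ∀ z, fMat a k s τ z * fMat a k s τ z = 0 := fun z =>
    mul_eq_zero_of_mul_eq (fMat_mul z) (mul_fMat z)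
  have hGG : ∀ z, gMat a k s τ z * gMat a k s τ z = 0 := fun z => by
    simp [gMat, fromBlocks_multiply]
  obtain ⟨E, hE, hEΓ⟩ := exists_entire_extension hc (Γ := Γ) (differentiable_fMat (a := a) (k := k)
    (s := s) (τ := τ)) (differentiable_gMat (a := a) (k := k) (s := s) (τ := τ)) hFF hGG
    (fun z hz => differentiableAt_matrix fun i j => (h.analytic i j z hz).differentiableAt)
    (fun μ hμ => by
      obtain ⟨Γp, Γm, h1, h2, h3⟩ := h.jump_imAxis μ hμ
      exact ⟨Γp, Γm, h1, h2, by rw [h3, jump_imAxis hc hμ]⟩)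
    (fun μ hμ => by
      obtain ⟨Γp, Γm, h1, h2, h3⟩ := h.jump_sigmaPlus μ hμ
      exact ⟨Γp, Γm, h1, h2, by rw [h3, jump_sigma hc (Or.inl hμ)]⟩)
    (fun μ hμ => by
      obtain ⟨Γp, Γm, h1, h2, h3⟩ := h.jump_sigmaMinus μ hμ
      exact ⟨Γp, Γm, h1, h2, by rw [h3, jump_sigma hc (Or.inr hμ)]⟩)
  obtain ⟨C, r₀, hC, hr₀, hexp⟩ := exists_expansion_bound h 0
  have hlarge : ∀ (β : Region), ∀ z ∈ β.interior c, r₀ < ‖z‖ →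
      ‖E z * β.mult (fMat a k s τ z) (gMat a k s τ z) - 1‖ ≤ 2 * C / (1 + ‖z‖) := by
    intro β z hz hr
    have h1 := hexp z (β.interior_subset_compl hc hz) hr.le
    simp only [zero_add, Finset.range_one, Finset.sum_singleton, pow_zero, one_smul, pow_one,
      h.coeff_zero] at h1
    rw [hEΓ β z hz]
    refine h1.trans ?_
    rw [div_le_div_iff₀ (by linarith) (by positivity)]
    nlinarith
  have hmultd : ∀ β : Region, Differentiable ℂ
      fun z => β.mult (fMat a k s τ z) (gMat a k s τ z) := fun β =>
    Region.differentiable_mult differentiable_fMat differentiable_gMat β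
  have hcont : ∀ β : Region, Continuous
      fun z => E z * β.mult (fMat a k s τ z) (gMat a k s τ z) := fun β =>
    (hE.mul (hmultd β)).continuous
  have hcl := exists_forall_mem_closed_of_interior hc
    (f := fun β z => E z * β.mult (fMat a k s τ z) (gMat a k s τ z)) hcont hlarge
  obtain ⟨K, hK⟩ := exists_bound_of_large
    (f := fun β z => E z * β.mult (fMat a k s τ z) (gMat a k s τ z)) hcont hcl
  -- All jump factors have determinant `1`, so `det E` is the determinant of the solution in every
  -- region. It is entire and tends to `1`; Liouville applies, and the adjugate is an entire
  -- inverse.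
  have hdet : ∀ z, (E z).det = 1 := by
    intro z
    have hd : Differentiable ℂ fun z => (E z).det := fun z =>
      differentiableAt_det fun i j => differentiableAt_entry (hE z) i j
    refine hd.apply_eq_of_tendsto_cocompact z ?_
    rw [← Metric.cobounded_eq_cocompact, Metric.tendsto_nhds]
    intro ε hε
    have hdetc : ContinuousAt (fun A : Mat N => A.det) 1 :=
      (continuous_id.matrix_det (R := ℂ) (A := fun A : Mat N => A)).continuousAt
    obtain ⟨δ, hδ, hδε⟩ := Metric.continuousAt_iff.1 hdetc ε hε
    rw [hasBasis_cobounded_norm.eventually_iff]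
    refine ⟨(|K| + 1) / δ, trivial, fun w hw => ?_⟩
    have hw' : (|K| + 1) / δ ≤ ‖w‖ := hw
    have hreg : ∃ β : Region, w ∈ β.closed c := by
      by_cases hwc : w ∈ contour c
      · rw [Region.mem_contour_iff] at hwc
        have := abs_nonneg w.im
        rcases hwc with e | e | e
        · exact ⟨.outerRight, e.symm.le⟩
        · exact ⟨.outerLeft, e.le⟩
        · exact ⟨.innerRight, e.symm.le, by rw [e]; linarith⟩
      · obtain ⟨β, hβ⟩ := Region.exists_mem_interior hwc
        exact ⟨β, β.interior_subset_closed c hβ⟩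
    obtain ⟨β, hβ⟩ := hreg
    have h1 : dist (E w * β.mult (fMat a k s τ w) (gMat a k s τ w)) 1 < δ := by
      rw [dist_eq_norm]
      refine (hK β w hβ).trans_lt ?_
      rw [div_lt_iff₀ (by positivity)]
      rw [div_le_iff₀ hδ] at hw'
      nlinarith [le_abs_self K]
    have h2 := hδε h1
    simp only [det_mul, det_mult, mul_one, det_one] at h2
    exact h2
  have hmi : ∀ z, E z * (E z).adjugate = 1 := fun z => by rw [mul_adjugate, hdet, one_smul]
  have him : ∀ z, (E z).adjugate * E z = 1 := fun z => by rw [adjugate_mul, hdet, one_smul]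
  have hadj : Differentiable ℂ fun z => (E z).adjugate := fun z =>
    differentiableAt_adjugate (hE z)
  refine ⟨E, fun z => (E z).adjugate, ⟨differentiable_fMat, differentiable_gMat, hE, hadj,
    fMat_mul, mul_fMat, mul_gMat, gMat_mul, hmi, him, ⟨K, hK⟩, ?_⟩, hEΓ⟩
  refine exists_bound_inv
    (f := fun β z => E z * β.mult (fMat a k s τ z) (gMat a k s τ z))
    (f' := fun β z => β.multInv (fMat a k s τ z) (gMat a k s τ z) * (E z).adjugate)
    (fun β => ((Region.differentiable_multInv differentiable_fMat differentiable_gMat β).mul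
      hadj).continuous) (fun β z => ?_) hK
  rw [mul_assoc, ← mul_assoc (β.mult _ _), Region.mult_mul_multInv (hFF z) (hGG z), one_mul, hmi]

end Blocks

/-! ### Decay of the jumps along the contour. -/

section Estimates

lemma norm_exp_sub_one_le_mul_exp (u : ℂ) :
    ‖Complex.exp u - 1‖ ≤ ‖u‖ * Real.exp ‖u‖ := by
  refine (Complex.norm_exp_sub_sum_le_norm_mul_exp u 1).trans' ?_ |>.trans_eq ?_
  · simp
  · simp

/-- From `|e^{tλ} - 1| ≤ |t| |λ| e^{|λ|}`, with `|λ| ≤ e^{|λ|}` and `1 + y² ≤ e^{y²}`. All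
polynomial factors thus move into the exponent, where the quartic decay of the phase absorbs them.
-/
lemma norm_exp_add_sub_exp_le {u lam : ℂ} {t y M : ℝ} (ht : |t| ≤ 1)
    (h : y ^ 2 + 2 * ‖lam‖ + u.re ≤ M) :
    ‖Complex.exp (u + t * lam) - Complex.exp u‖ ≤ Real.exp M * |t| * (1 + y ^ 2)⁻¹ := by
  have hn : ‖(t : ℂ) * lam‖ = |t| * ‖lam‖ := by rw [norm_mul, Complex.norm_real, Real.norm_eq_abs]
  have h1 := norm_exp_sub_one_le_mul_exp (t * lam)
  rw [hn] at h1
  have h2 : |t| * ‖lam‖ ≤ ‖lam‖ := mul_le_of_le_one_left (norm_nonneg _) ht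
  have h3 : 1 + y ^ 2 ≤ Real.exp (y ^ 2) := by linarith [Real.add_one_le_exp (y ^ 2)]
  have h4 : ‖lam‖ ≤ Real.exp ‖lam‖ := by linarith [Real.add_one_le_exp ‖lam‖]
  rw [← div_eq_mul_inv, le_div_iff₀ (by positivity), Complex.exp_add, ← mul_sub_one, norm_mul,
    Complex.norm_exp]
  calc Real.exp u.re * ‖Complex.exp (t * lam) - 1‖ * (1 + y ^ 2)
      ≤ Real.exp u.re * (|t| * Real.exp ‖lam‖ * Real.exp ‖lam‖) * Real.exp (y ^ 2) := by
        gcongr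
        exact h1.trans (by gcongr)
    _ = Real.exp (y ^ 2 + 2 * ‖lam‖ + u.re) * |t| := by
        rw [show y ^ 2 + 2 * ‖lam‖ + u.re = u.re + ‖lam‖ + ‖lam‖ + y ^ 2 by ring, Real.exp_add,
          Real.exp_add, Real.exp_add]
        ring
    _ ≤ Real.exp M * |t| := by gcongr

lemma theta_re (τ x : ℝ) (z : ℂ) : (theta τ x z).re =
    (z.re ^ 4 - 6 * z.re ^ 2 * z.im ^ 2 + z.im ^ 4) / 4 - τ * (z.re ^ 2 - z.im ^ 2) / 2
      - x * z.re := by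
  obtain ⟨p, q⟩ := z
  have h2 : (⟨p, q⟩ : ℂ) ^ 2 = ⟨p ^ 2 - q ^ 2, 2 * p * q⟩ := by
    rw [pow_two]
    apply Complex.ext <;> simp <;> ring
  have h4 : (⟨p, q⟩ : ℂ) ^ 4 = ⟨p ^ 4 - 6 * p ^ 2 * q ^ 2 + q ^ 4, 4 * p * q * (p ^ 2 - q ^ 2)⟩ := by
    rw [pow_mul (⟨p, q⟩ : ℂ) 2 2, h2, pow_two]
    apply Complex.ext <;> simp <;> ring
  rw [theta, h2, h4]
  simp

lemma exists_theta_bound_imAxis (τ : ℝ) : ∃ M : ℝ, ∀ (x : ℝ), ∀ z ∈ imAxis,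
    z.im ^ 2 + 2 * (1 + ‖z‖ ^ 2) + (-theta τ x z).re ≤ M := by
  -- At `z = i y` the left side is `2 + (3 - τ/2) y² - y⁴/4`; the `x`-term is imaginary. Complete
  -- the square.
  refine ⟨2 + (3 - τ / 2) ^ 2, fun x z hz => ?_⟩
  have hz : z.re = 0 := hz
  rw [Complex.neg_re, theta_re, Complex.sq_norm, Complex.normSq_apply, hz]
  nlinarith [sq_nonneg (z.im ^ 2 / 2 - (3 - τ / 2))]

/-- With `v = |z.im|` and `|z.re| = c + v`, the quartic part of the real phase is `c⁴/4 + c³ v - 2 c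
v³ - v⁴`. Its term `-v⁴` dominates the `5 v²` from `z.im² + 2 ‖z‖²` and all linear terms, which `B`
collects. -/
lemma exists_theta_bound_sigma {c : ℝ} (hc : 0 < c) (τ x : ℝ) : ∃ M : ℝ, ∀ z ∈ sigma c,
    z.im ^ 2 + 2 * (1 + ‖z‖ ^ 2) + (theta τ x z).re ≤ M := by
  set B := c ^ 3 + |τ| * c + |x| + 4 * c with hB
  refine ⟨(5 + B) ^ 2 + B + (c ^ 4 / 4 + |τ| * c ^ 2 + |x| * c + 2 + 2 * c ^ 2), fun z hz => ?_⟩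
  rw [theta_re, Complex.sq_norm, Complex.normSq_apply]
  set v := |z.im| with hv
  have hv0 : 0 ≤ v := abs_nonneg _
  have hre2 : z.re ^ 2 = (c + v) ^ 2 := by
    rcases hz with h | h
    · have h : z.re = c + v := h
      rw [h]
    · have h : z.re = -(c + v) := h
      rw [h, neg_sq]
  have hre : |z.re| = c + v := by
    rw [← abs_of_nonneg (show 0 ≤ c + v by positivity)]
    exact (sq_eq_sq_iff_abs_eq_abs _ _).1 hre2
  have him2 : z.im ^ 2 = v ^ 2 := (sq_abs _).symm
  have hx : -(x * z.re) ≤ |x| * (c + v) := by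
    rw [← hre, ← abs_mul]
    exact neg_le_abs _
  have hτ : -(τ * (c ^ 2 + 2 * c * v) / 2) ≤ |τ| * (c ^ 2 + 2 * c * v) / 2 := by
    have : 0 ≤ c ^ 2 + 2 * c * v := by positivity
    nlinarith [neg_abs_le τ]
  have hτc : 0 ≤ |τ| * c ^ 2 := by positivity
  have hcv : 0 ≤ c * v ^ 3 := by positivity
  have hB0 : 0 ≤ B := by positivity
  have hBv : B * v ≤ B * (1 + v ^ 2) := by
    have : v ≤ 1 + v ^ 2 := by nlinarith [sq_nonneg (v - 1)]
    gcongr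
  have h4 : z.re ^ 4 = ((c + v) ^ 2) ^ 2 := by rw [← hre2]; ring
  have h5 : z.im ^ 4 = (v ^ 2) ^ 2 := by rw [← him2]; ring
  have h6 : z.re * z.re + z.im * z.im = (c + v) ^ 2 + v ^ 2 := by rw [← hre2, ← him2]; ring
  rw [h6, h4, h5, hre2, him2]
  have hsq := sq_nonneg (v ^ 2 - (5 + B))
  have hsq' := sq_nonneg (v ^ 2)
  have hB' : B * v = c ^ 3 * v + |τ| * c * v + |x| * v + 4 * c * v := by rw [hB]; ring
  have hle : -v ^ 4 + 5 * v ^ 2 + B * v ≤ (5 + B) ^ 2 + B := by nlinarith [sq_nonneg (5 + B)]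
  nlinarith

end Estimates

/-! ### Differentiation in `s` and `τ`. -/

section Deformation

variable {N : ℕ}

/-- The diagonal of `A₁`. -/
noncomputable def diagA (N : ℕ) : Unit ⊕ Fin N → ℂ :=
  Sum.elim (fun _ => -((N : ℂ) / ((N : ℂ) + 1))) (fun _ => 1 / ((N : ℂ) + 1))

lemma natCast_add_one_ne_zero (N : ℕ) : (N : ℂ) + 1 ≠ 0 := by
  exact_mod_cast Nat.succ_ne_zero N

lemma A₁_eq_diagonal : A₁ N = diagonal (diagA N) := by
  rw [A₁, show (-(N : ℂ) • (1 : Matrix Unit Unit ℂ)) = diagonal (fun _ => -(N : ℂ)) by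
    rw [← diagonal_one, ← diagonal_smul]; congr 1; ext; simp, ← diagonal_one, fromBlocks_diagonal,
    ← diagonal_smul]
  congr 1
  ext (i | i) <;> simp [diagA, div_eq_inv_mul]

lemma norm_diagA_le (i : Unit ⊕ Fin N) : ‖diagA N i‖ ≤ 1 := by
  have h : ‖(N : ℂ) + 1‖ = N + 1 := by
    rw [show (N : ℂ) + 1 = ((N + 1 : ℕ) : ℂ) by push_cast; ring, Complex.norm_natCast]
    push_cast; ring
  have h0 : (0 : ℝ) < N + 1 := by positivity
  rcases i with i | i
  · simp only [diagA, Sum.elim_inl, norm_neg, norm_div, h, Complex.norm_natCast]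
    rw [div_le_one h0]
    linarith
  · simp only [diagA, Sum.elim_inr, norm_div, h, norm_one]
    rw [div_le_one h0]
    linarith [(Nat.cast_nonneg N : (0 : ℝ) ≤ N)]

lemma gauge_eq_diagonal (a : Fin N → ℝ) (s τ : ℝ) (z : ℂ) : gauge a s τ z =
    diagonal (Sum.elim
      (fun _ => Complex.exp (1 / ((N : ℂ) + 1) * ∑ j, theta τ (a j + s) z))
      (fun i => Complex.exp
        (1 / ((N : ℂ) + 1) * ∑ j, theta τ (a j + s) z - theta τ (a i + s) z))) := by
  rw [gauge, ← diagonal_smul]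
  congr 1
  ext (i | i)
  · simp
  · simp [sub_eq_add_neg, Complex.exp_add]

/-- The diagonal matrix relating the gauge matrices at different parameters. -/
noncomputable def gaugeRatio (N : ℕ) (lam : ℂ → ℂ) (t : ℝ) (z : ℂ) : Mat N :=
  diagonal fun i => Complex.exp (diagA N i * (t * lam z))

variable {c : ℝ} {a : Fin N → ℝ} {k : Fin (N + 1) → ℝ} {s τ s' τ' t : ℝ} {lam : ℂ → ℂ}

/-- A change of `s` or `τ` shifts all the phases by the same amount `-tλ`, whatever `a_j` is. So the
gauge changes by `exp (tλ A₁)`, which is why the leading coefficients of the equations in `s` and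
`τ` are multiples of `A₁`. -/
lemma gaugeRatio_mul_gauge {z : ℂ}
    (h : ∀ x : ℝ, theta τ' (x + s') z = theta τ (x + s) z - t * lam z) :
    gaugeRatio N lam t z * gauge a s τ z = gauge a s' τ' z := by
  have hN := natCast_add_one_ne_zero N
  rw [gauge_eq_diagonal, gauge_eq_diagonal, gaugeRatio, diagonal_mul_diagonal]
  congr 1
  ext (i | i)
  · simp only [diagA, Sum.elim_inl, ← Complex.exp_add, h, Finset.sum_sub_distrib,
      Finset.sum_const, Finset.card_univ, Fintype.card_fin, nsmul_eq_mul]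
    congr 1
    field_simp
    ring
  · simp only [diagA, Sum.elim_inr, ← Complex.exp_add, h, Finset.sum_sub_distrib,
      Finset.sum_const, Finset.card_univ, Fintype.card_fin, nsmul_eq_mul]
    congr 1
    field_simp
    ring

/-- The diagonal entries of `A₁` differ by `1`, so conjugation by `exp (tλ A₁)` multiplies the lower
left block by `e^{tλ}`, exactly the change of `e^{-θ}`. For `gMat` the exponent has the opposite
sign. -/
lemma fMat_mul_gaugeRatio {z : ℂ}
    (h : ∀ x : ℝ, theta τ' (x + s') z = theta τ (x + s) z - t * lam z) :
    fMat a k s' τ' z * gaugeRatio N lam t z = gaugeRatio N lam t z * fMat a k s τ z := by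
  have hN := natCast_add_one_ne_zero N
  ext i j
  rw [gaugeRatio, mul_diagonal, diagonal_mul]
  rcases i with i | i <;> rcases j with j | j <;> simp only [fMat, fromBlocks_apply₁₁,
    fromBlocks_apply₁₂, fromBlocks_apply₂₁, fromBlocks_apply₂₂, replicateCol_apply,
    Matrix.zero_apply, zero_mul, mul_zero, h, diagA, Sum.elim_inl, Sum.elim_inr]
  rw [mul_assoc, ← Complex.exp_add, mul_left_comm (Complex.exp _), ← Complex.exp_add]
  congr 2
  field_simp
  ring

lemma gMat_mul_gaugeRatio {z : ℂ}
    (h : ∀ x : ℝ, theta τ' (x + s') z = theta τ (x + s) z - t * lam z) :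
    gMat a k s' τ' z * gaugeRatio N lam t z = gaugeRatio N lam t z * gMat a k s τ z := by
  have hN := natCast_add_one_ne_zero N
  ext i j
  rw [gaugeRatio, mul_diagonal, diagonal_mul]
  rcases i with i | i <;> rcases j with j | j <;> simp only [gMat, fromBlocks_apply₁₁,
    fromBlocks_apply₁₂, fromBlocks_apply₂₁, fromBlocks_apply₂₂, replicateRow_apply,
    Matrix.zero_apply, zero_mul, mul_zero, h, diagA, Sum.elim_inl, Sum.elim_inr]
  rw [mul_assoc, ← Complex.exp_add, mul_left_comm (Complex.exp _), ← Complex.exp_add]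
  congr 2
  field_simp
  ring

lemma exists_norm_fMat_sub_le (a : Fin N → ℝ) (k : Fin (N + 1) → ℝ) (s τ : ℝ)
    (hlam : ∀ z, ‖lam z‖ ≤ 1 + ‖z‖ ^ 2) : ∃ κ, 0 ≤ κ ∧ ∀ t s' τ' : ℝ, |t| ≤ 1 →
      (∀ (x : ℝ) (z : ℂ), theta τ' (x + s') z = theta τ (x + s) z - t * lam z) →
      ∀ z ∈ imAxis, ‖fMat a k s' τ' z - fMat a k s τ z‖ ≤ κ * |t| * (1 + z.im ^ 2)⁻¹ := by
  obtain ⟨M, hM⟩ := exists_theta_bound_imAxis τ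
  set r := ∑ j, ‖rootDiff k j‖ with hr
  set m := ∑ i : Unit ⊕ Fin N, ∑ j : Unit ⊕ Fin N, ‖(single i j (1 : ℂ) : Mat N)‖ with hm
  refine ⟨m * (r * Real.exp M), by positivity, fun t s' τ' ht h z hz => ?_⟩
  refine (norm_matrix_le (C := r * (Real.exp M * |t| * (1 + z.im ^ 2)⁻¹))
    fun i j => ?_).trans_eq (by rw [← hm]; ring)
  have h0 : 0 ≤ r * (Real.exp M * |t| * (1 + z.im ^ 2)⁻¹) := by positivity
  rcases i with i | i <;> rcases j with j | j <;> simp only [fMat, Matrix.sub_apply,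
    fromBlocks_apply₁₁, fromBlocks_apply₁₂, fromBlocks_apply₂₁, fromBlocks_apply₂₂,
    replicateCol_apply, Matrix.zero_apply, sub_zero, norm_zero, h0]
  rw [← mul_sub, norm_mul, norm_neg]
  gcongr
  · exact Finset.single_le_sum (f := fun j => ‖rootDiff k j‖) (fun _ _ => norm_nonneg _)
      (Finset.mem_univ i)
  · rw [h, neg_sub', sub_neg_eq_add]
    refine norm_exp_add_sub_exp_le ht ((hM (a i + s) z hz).trans' ?_)
    gcongr
    exact hlam z

lemma exists_norm_gMat_sub_le (hc : 0 < c) (a : Fin N → ℝ) (k : Fin (N + 1) → ℝ) (s τ : ℝ)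
    (hlam : ∀ z, ‖lam z‖ ≤ 1 + ‖z‖ ^ 2) : ∃ κ, 0 ≤ κ ∧ ∀ t s' τ' : ℝ, |t| ≤ 1 →
      (∀ (x : ℝ) (z : ℂ), theta τ' (x + s') z = theta τ (x + s) z - t * lam z) →
      ∀ z ∈ sigma c, ‖gMat a k s' τ' z - gMat a k s τ z‖ ≤ κ * |t| * (1 + z.im ^ 2)⁻¹ := by
  choose M hM using fun j => exists_theta_bound_sigma hc τ (a j + s)
  set r := ∑ j, ‖rootDiff k j‖ with hr
  set m := ∑ i : Unit ⊕ Fin N, ∑ j : Unit ⊕ Fin N, ‖(single i j (1 : ℂ) : Mat N)‖ with hm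
  set M' := ∑ j, |M j| with hM'
  refine ⟨m * (r * Real.exp M'), by positivity, fun t s' τ' ht h z hz => ?_⟩
  refine (norm_matrix_le (C := r * (Real.exp M' * |t| * (1 + z.im ^ 2)⁻¹))
    fun i j => ?_).trans_eq (by rw [← hm]; ring)
  have h0 : 0 ≤ r * (Real.exp M' * |t| * (1 + z.im ^ 2)⁻¹) := by positivity
  rcases i with i | i <;> rcases j with j | j <;> simp only [gMat, Matrix.sub_apply,
    fromBlocks_apply₁₁, fromBlocks_apply₁₂, fromBlocks_apply₂₁, fromBlocks_apply₂₂,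
    replicateRow_apply, Matrix.zero_apply, sub_zero, norm_zero, h0]
  rw [← mul_sub, norm_mul, norm_neg]
  gcongr
  · exact Finset.single_le_sum (f := fun j => ‖rootDiff k j‖) (fun _ _ => norm_nonneg _)
      (Finset.mem_univ j)
  · rw [h, sub_eq_add_neg (theta τ (a j + s) z), ← mul_neg]
    have hMj : M j ≤ M' := (le_abs_self _).trans (Finset.single_le_sum (f := fun j => |M j|)
      (fun _ _ => abs_nonneg _) (Finset.mem_univ j))
    refine norm_exp_add_sub_exp_le ht (((hM j z hz).trans hMj).trans' ?_)
    rw [norm_neg]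
    gcongr
    exact hlam z

lemma differentiable_gaugeRatio (hlam : Differentiable ℂ lam) (t : ℝ) :
    Differentiable ℂ (gaugeRatio N lam t) := by
  intro z
  refine differentiableAt_matrix fun i j => ?_
  simp only [gaugeRatio, diagonal_apply]
  split_ifs
  · exact (((hlam z).const_mul _).const_mul _).cexp
  · exact differentiableAt_const _

lemma exists_gaugeRatio_bound (hlam : ∀ z, ‖lam z‖ ≤ 1 + ‖z‖ ^ 2) (R : ℝ) :
    ∃ A, 0 ≤ A ∧ ∀ᶠ t in 𝓝[≠] (0 : ℝ), ∀ z : ℂ, ‖z‖ ≤ R →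
      ‖gaugeRatio N lam t z‖ ≤ ‖(1 : Mat N)‖ + 1 ∧
      ‖(t⁻¹ : ℂ) • (gaugeRatio N lam t z - 1) - lam z • A₁ N‖ ≤ A * |t| := by
  set L := 1 + R ^ 2 with hL
  have hL0 : 0 < L := by positivity
  refine ⟨L ^ 2, by positivity, ?_⟩
  have hsmall : ∀ᶠ t : ℝ in 𝓝 0, 2 * (|t| * L) < 1 := by
    have : Tendsto (fun t : ℝ => 2 * (|t| * L)) (𝓝 0) (𝓝 0) :=
      Continuous.tendsto' (by fun_prop) _ _ (by simp)
    exact this.eventually_lt_const one_pos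
  filter_upwards [nhdsWithin_le_nhds hsmall, self_mem_nhdsWithin] with t ht ht0 z hz
  have ht0 : t ≠ 0 := ht0
  have htp : 0 < |t| := abs_pos.2 ht0
  have hlz : ‖lam z‖ ≤ L := (hlam z).trans (by rw [hL]; gcongr)
  have hu : ∀ i, ‖diagA N i * (t * lam z)‖ ≤ |t| * L := by
    intro i
    rw [norm_mul, norm_mul, Complex.norm_real, Real.norm_eq_abs]
    calc _ ≤ 1 * (|t| * L) := by gcongr; exact norm_diagA_le i
      _ = _ := one_mul _
  constructor
  · have h1 : ‖gaugeRatio N lam t z - 1‖ ≤ 1 := by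
      rw [gaugeRatio, ← diagonal_one, diagonal_sub]
      refine norm_diagonal_le zero_le_one fun i => ?_
      have := Complex.norm_exp_sub_one_le (x := diagA N i * (t * lam z)) (by linarith [hu i])
      linarith [hu i]
    calc _ = ‖1 + (gaugeRatio N lam t z - 1)‖ := by congr 1; abel
      _ ≤ _ := (norm_add_le _ _).trans (by gcongr)
  · rw [gaugeRatio, A₁_eq_diagonal, ← diagonal_one, diagonal_sub, ← diagonal_smul,
      ← diagonal_smul, diagonal_sub]
    refine norm_diagonal_le (by positivity) fun i => ?_
    have h2 : ((t⁻¹ : ℂ) • fun i => Complex.exp (diagA N i * (t * lam z)) - 1) i -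
        (lam z • diagA N) i = (t⁻¹ : ℂ) * (Complex.exp (diagA N i * (t * lam z)) - 1 -
          diagA N i * (t * lam z)) := by
      have : (t : ℂ) ≠ 0 := by exact_mod_cast ht0
      simp only [Pi.smul_apply, smul_eq_mul]
      field_simp
    rw [h2, norm_mul, norm_inv, Complex.norm_real, Real.norm_eq_abs]
    have h3 := Complex.norm_exp_sub_one_sub_id_le (x := diagA N i * (t * lam z))
      (by linarith [hu i])
    calc _ ≤ |t|⁻¹ * (|t| * L) ^ 2 := by
          gcongr
          exact h3.trans (by gcongr; exact hu i)
      _ = _ := by field_simp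

/-- The derivative of `Γ T` along a family of parameters along which all the phases change by
`- t λ`. -/
theorem hasDerivAt_deformation (hc : 0 < c) {σ ρ : ℝ → ℝ}
    (hθ : ∀ (t x : ℝ) (z : ℂ), theta (ρ t) (x + σ t) z = theta τ (x + s) z - t * lam z)
    (hlam : Differentiable ℂ lam) (hlam' : ∀ z, ‖lam z‖ ≤ 1 + ‖z‖ ^ 2)
    {Γt : ℝ → ℂ → Mat N} {Gt : ℝ → ℕ → Mat N} (h0 : IsRHPSolution c a k s τ (Γt 0) (Gt 0))
    (h : ∀ᶠ t in 𝓝 0, IsRHPSolution c a k (σ t) (ρ t) (Γt t) (Gt t)) {P : ℂ → Mat N}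
    (hP : Differentiable ℂ P) {C r₀ : ℝ} (hC0 : 0 ≤ C)
    (hC : ∀ z ∈ (contour c)ᶜ, r₀ ≤ ‖z‖ →
      ‖Γt 0 z * (lam z • A₁ N) - P z * Γt 0 z‖ ≤ C / ‖z‖) {z : ℂ} (hz : z ∈ (contour c)ᶜ)
    (i j : Unit ⊕ Fin N) :
    HasDerivAt (fun t : ℝ => (Γt t z * gauge a (σ t) (ρ t) z) i j)
      ((P z * (Γt 0 z * gauge a s τ z)) i j) 0 := by
  have hex : ∀ t : ℝ, ∃ E E' : ℂ → Mat N,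
      IsRHPSolution c a k (σ t) (ρ t) (Γt t) (Gt t) →
      IsExtension c (blockProj N) (fMat a k (σ t) (ρ t)) (gMat a k (σ t) (ρ t)) E E' ∧
      ∀ (β : Region), ∀ z ∈ β.interior c,
        E z * β.mult (fMat a k (σ t) (ρ t) z) (gMat a k (σ t) (ρ t) z) = Γt t z := by
    intro t
    by_cases ht : IsRHPSolution c a k (σ t) (ρ t) (Γt t) (Gt t)
    · obtain ⟨E, E', hE⟩ := exists_isExtension hc ht
      exact ⟨E, E', fun _ => hE⟩
    · exact ⟨0, 0, fun h => absurd h ht⟩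
  choose Et Et' hEt using hex
  obtain ⟨E₀, E₀', hE₀, hE₀Γ⟩ := exists_isExtension hc h0
  obtain ⟨κ₁, hκ₁, hF⟩ := exists_norm_fMat_sub_le a k s τ hlam'
  obtain ⟨κ₂, hκ₂, hG⟩ := exists_norm_gMat_sub_le hc a k s τ hlam'
  have hsmall : ∀ᶠ t : ℝ in 𝓝 0, |t| ≤ 1 := by
    have : Tendsto (fun t : ℝ => |t|) (𝓝 0) (𝓝 0) := Continuous.tendsto' (by fun_prop) _ _ (by simp)
    exact this.eventually_le_const one_pos
  obtain ⟨β, hβ⟩ := Region.exists_mem_interior hz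
  have key := tendsto_deformation (Ft := fun t => fMat a k (σ t) (ρ t))
    (Gt := fun t => gMat a k (σ t) (ρ t)) (Et := Et) (Et' := Et') (D := gaugeRatio N lam)
    (κ := κ₁ + κ₂) (N := fun z => lam z • A₁ N) (P := P) hE₀ (h.mono fun t ht => (hEt t ht).1) hc
    (by positivity)
    (hsmall.mono fun t ht z hz => (hF t _ _ ht (hθ t) z hz).trans (by gcongr; linarith))
    (hsmall.mono fun t ht z hz => (hG t _ _ ht (hθ t) z hz).trans (by gcongr; linarith))
    (differentiable_gaugeRatio hlam) (fun t z => fMat_mul_gaugeRatio fun x => hθ t x z)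
    (fun t z => gMat_mul_gaugeRatio fun x => hθ t x z) hP (exists_gaugeRatio_bound hlam') hC0
    (fun γ w hw hwr => by
      rw [hE₀Γ γ w hw]
      exact hC w (γ.interior_subset_compl hc hw) hwr) z
  rw [hasDerivAt_iff_tendsto_slope_zero]
  have h2 := ((entryCLM i j).continuous.tendsto _).comp
    (key.mul_const (Γt 0 z * gauge a s τ z))
  refine h2.congr' ?_
  have hθ0 : ∀ x : ℝ, theta (ρ 0) (x + σ 0) z = theta τ (x + s) z := fun x => by
    rw [hθ]; simp
  have hg0 : gauge a (σ 0) (ρ 0) z = gauge a s τ z := by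
    simp only [gauge, hθ0]
  filter_upwards [nhdsWithin_le_nhds h] with t ht
  obtain ⟨hE1, hE2⟩ := hEt t ht
  -- `Ψ_t = (E_t D E_0⁻¹) Ψ_0`, so the difference quotient of `Ψ` is that of the bracket, applied to
  -- `Ψ_0`.
  have hmain : Γt t z * gauge a (σ t) (ρ t) z =
      Et t z * gaugeRatio N lam t z * E₀' z * (Γt 0 z * gauge a s τ z) := by
    have hm : β.mult (fMat a k (σ t) (ρ t) z) (gMat a k (σ t) (ρ t) z) * gaugeRatio N lam t z =
        gaugeRatio N lam t z * β.mult (fMat a k s τ z) (gMat a k s τ z) := by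
      have h1 := fMat_mul_gaugeRatio (a := a) (k := k) (lam := lam) fun x => hθ t x z
      have h2 := gMat_mul_gaugeRatio (a := a) (k := k) (lam := lam) fun x => hθ t x z
      cases β <;> simp only [Region.mult, mul_add, add_mul, one_mul, mul_one, mul_assoc, h1, h2]
      rw [← mul_assoc, h1, mul_assoc]
    rw [← gaugeRatio_mul_gauge fun x => hθ t x z, ← hE2 β z hβ, ← hE₀Γ β z hβ]
    calc _ = Et t z * (β.mult (fMat a k (σ t) (ρ t) z) (gMat a k (σ t) (ρ t) z) *
          gaugeRatio N lam t z) * gauge a s τ z := by simp only [mul_assoc]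
      _ = Et t z * gaugeRatio N lam t z * (E₀' z * E₀ z) *
          (β.mult (fMat a k s τ z) (gMat a k s τ z) * gauge a s τ z) := by
        rw [hm, hE₀.inv_mul, mul_one]
        simp only [mul_assoc]
      _ = _ := by simp only [mul_assoc]
  rw [Function.comp_apply, entryCLM_apply, zero_add, hmain, hg0, smul_mul_assoc, sub_mul, one_mul,
    Matrix.smul_apply, Matrix.sub_apply, smul_eq_mul, Complex.real_smul, Complex.ofReal_inv]

end Deformation

/-! ### The three equations and their coefficients. -/

section LaxPair

variable {N : ℕ} {c : ℝ} {a : Fin N → ℝ} {k : Fin (N + 1) → ℝ} {s τ : ℝ}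

/-- A commutator with a diagonal matrix multiplies each entry by a difference of diagonal entries.
For `A₁` this is `1` on the upper right block, `-1` on the lower left and `0` on the diagonal
blocks. -/
lemma X₁_eq_A₀ (Γ₁ : Mat N) : X₁ Γ₁ = A₀ Γ₁ := by
  have hN := natCast_add_one_ne_zero N
  ext i j
  rw [X₁, A₁_eq_diagonal, Matrix.sub_apply, mul_diagonal, diagonal_mul]
  rcases i with i | i <;> rcases j with j | j <;>
    simp only [diagA, A₀, Sum.elim_inl, Sum.elim_inr, fromBlocks_apply₁₁, fromBlocks_apply₁₂,
      fromBlocks_apply₂₁, fromBlocks_apply₂₂, toBlocks₁₂, toBlocks₂₁, of_apply, Matrix.neg_apply,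
      Matrix.zero_apply] <;>
    field_simp <;> ring

lemma exists_norm_mul_sub_mul_le_div {Γ : ℂ → Mat N} {G : ℕ → Mat N}
    (h : IsRHPSolution c a k s τ Γ G) (N₀ N₁ N₂ N₃ P₀ P₁ P₂ P₃ : Mat N)
    (h3 : N₃ - P₃ = 0) (h2 : G 1 * N₃ - P₃ * G 1 + (N₂ - P₂) = 0)
    (h1 : G 2 * N₃ - P₃ * G 2 + (G 1 * N₂ - P₂ * G 1) + (N₁ - P₁) = 0)
    (h0 : G 3 * N₃ - P₃ * G 3 + (G 2 * N₂ - P₂ * G 2) + (G 1 * N₁ - P₁ * G 1) + (N₀ - P₀) = 0) :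
    ∃ C r₀ : ℝ, 0 ≤ C ∧ ∀ z ∈ (contour c)ᶜ, r₀ ≤ ‖z‖ →
      ‖Γ z * (z ^ 3 • N₃ + z ^ 2 • N₂ + z • N₁ + N₀) -
        (z ^ 3 • P₃ + z ^ 2 • P₂ + z • P₁ + P₀) * Γ z‖ ≤ C / ‖z‖ := by
  obtain ⟨C, r₀, hC, hr₀, hb⟩ := exists_expansion_bound h 3
  obtain ⟨K, hK, hb'⟩ := exists_norm_mul_sub_mul_le (G 1) (G 2) (G 3) N₀ N₁ N₂ N₃ P₀ P₁ P₂ P₃ C hC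
    h3 h2 h1 h0
  refine ⟨K, r₀, hK, fun z hz hr => hb' z (Γ z) (hr₀.trans hr) ?_⟩
  have := hb z hz hr
  simpa [Finset.sum_range_succ, h.coeff_zero] using this

lemma hasDerivAt_theta (τ x : ℝ) (z : ℂ) :
    HasDerivAt (theta τ x) (z ^ 3 - τ * z - x) z := by
  have := (((hasDerivAt_pow 4 z).div_const 4).sub
    (((hasDerivAt_pow 2 z).const_mul (τ : ℂ)).div_const 2)).sub ((hasDerivAt_id z).const_mul (x : ℂ))
  refine this.congr_deriv ?_
  push_cast
  ring

/-- The logarithmic derivative of the gauge matrix in the spectral variable. -/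
noncomputable def gaugeLogDeriv (a : Fin N → ℝ) (s τ : ℝ) (z : ℂ) : Mat N :=
  diagonal (Sum.elim
    (fun _ => 1 / ((N : ℂ) + 1) * ∑ j, (z ^ 3 - τ * z - (a j + s : ℝ)))
    (fun i => 1 / ((N : ℂ) + 1) * ∑ j, (z ^ 3 - τ * z - (a j + s : ℝ)) -
      (z ^ 3 - τ * z - (a i + s : ℝ))))

lemma gaugeLogDeriv_eq (z : ℂ) : gaugeLogDeriv a s τ z =
    z ^ 3 • tildeB₃ N + z ^ 2 • (0 : Mat N) + z • tildeB₁ N τ + tildeB₀ a s := by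
  have hN := natCast_add_one_ne_zero N
  rw [gaugeLogDeriv, tildeB₃, tildeB₁, tildeB₀, A₁_eq_diagonal, smul_zero, add_zero]
  simp only [← diagonal_smul, diagonal_neg, diagonal_add]
  congr 1
  ext (i | i)
  · simp only [Sum.elim_inl, diagA, Pi.smul_apply, smul_eq_mul,
      Finset.sum_sub_distrib, Finset.sum_add_distrib, Finset.sum_const, Finset.card_univ,
      Fintype.card_fin, nsmul_eq_mul, Complex.ofReal_add]
    field_simp
    ring
  · have h := Finset.sum_erase_eq_sub (f := fun j => (a j : ℂ)) (Finset.mem_univ i)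
    simp only [Sum.elim_inr, diagA, Pi.smul_apply, smul_eq_mul, h,
      Finset.sum_sub_distrib, Finset.sum_add_distrib, Finset.sum_const, Finset.card_univ,
      Fintype.card_fin, nsmul_eq_mul, Complex.ofReal_add]
    field_simp
    ring

lemma differentiable_gaugeLogDeriv : Differentiable ℂ (gaugeLogDeriv a s τ) := by
  rw [funext (gaugeLogDeriv_eq (a := a) (s := s) (τ := τ))]
  fun_prop

lemma hasDerivAt_gauge (z : ℂ) :
    HasDerivAt (gauge a s τ) (gaugeLogDeriv a s τ z * gauge a s τ z) z := by
  have h0 : HasDerivAt (fun z => 1 / ((N : ℂ) + 1) * ∑ j, theta τ (a j + s) z)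
      (1 / ((N : ℂ) + 1) * ∑ j, (z ^ 3 - τ * z - (a j + s : ℝ))) z :=
    (HasDerivAt.fun_sum fun j _ => hasDerivAt_theta τ (a j + s) z).const_mul _
  refine hasDerivAt_matrix fun i j => ?_
  simp only [gauge_eq_diagonal, gaugeLogDeriv, diagonal_mul_diagonal]
  by_cases hij : i = j
  · subst hij
    simp only [diagonal_apply_eq]
    rcases i with i | i
    · exact h0.cexp.congr_deriv (mul_comm _ _)
    · exact (h0.sub (hasDerivAt_theta τ (a i + s) z)).cexp.congr_deriv (mul_comm _ _)
  · simp only [diagonal_apply_ne _ hij]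
    exact hasDerivAt_const _ _

/-- The infinitesimal form of the constancy of `T⁻¹ F T` in the spectral variable. -/
lemma hasDerivAt_fMat (z : ℂ) : HasDerivAt (fMat a k s τ)
    (gaugeLogDeriv a s τ z * fMat a k s τ z - fMat a k s τ z * gaugeLogDeriv a s τ z) z := by
  refine hasDerivAt_matrix fun i j => ?_
  rw [gaugeLogDeriv, Matrix.sub_apply, mul_diagonal, diagonal_mul]
  rcases i with i | i <;> rcases j with j | j <;> simp only [fMat, fromBlocks_apply₁₁,
    fromBlocks_apply₁₂, fromBlocks_apply₂₁, fromBlocks_apply₂₂, replicateCol_apply,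
    Matrix.zero_apply, zero_mul, mul_zero, sub_zero, hasDerivAt_const, Sum.elim_inl, Sum.elim_inr]
  refine (((hasDerivAt_theta τ (a i + s) z).neg.cexp).const_mul _).congr_deriv ?_
  simp only [Pi.neg_apply]
  ring

lemma hasDerivAt_gMat (z : ℂ) : HasDerivAt (gMat a k s τ)
    (gaugeLogDeriv a s τ z * gMat a k s τ z - gMat a k s τ z * gaugeLogDeriv a s τ z) z := by
  refine hasDerivAt_matrix fun i j => ?_
  rw [gaugeLogDeriv, Matrix.sub_apply, mul_diagonal, diagonal_mul]
  rcases i with i | i <;> rcases j with j | j <;> simp only [gMat, fromBlocks_apply₁₁,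
    fromBlocks_apply₁₂, fromBlocks_apply₂₁, fromBlocks_apply₂₂, replicateRow_apply,
    Matrix.zero_apply, zero_mul, mul_zero, sub_zero, hasDerivAt_const, Sum.elim_inl, Sum.elim_inr]
  refine (((hasDerivAt_theta τ (a j + s) z).cexp).const_mul _).congr_deriv ?_
  ring

/-- The equation in the spectral variable. -/
theorem hasDerivAt_spectral (hc : 0 < c) {Γ : ℂ → Mat N} {G : ℕ → Mat N}
    (h : IsRHPSolution c a k s τ Γ G) {z : ℂ} (hz : z ∈ (contour c)ᶜ) (i j : Unit ⊕ Fin N) :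
    HasDerivAt (fun z => (Γ z * gauge a s τ z) i j)
      ((laxB a s τ (G 1) (G 2) (G 3) z * (Γ z * gauge a s τ z)) i j) z := by
  -- The tilde coefficients are those of `∂_μ T T⁻¹`. Cancelling the powers `μ²`, `μ` and `1` in
  -- turn determines `B₂`, `B₁` and `B₀`.
  obtain ⟨C, r₀, hC, hb⟩ := exists_norm_mul_sub_mul_le_div h (tildeB₀ a s) (tildeB₁ N τ) 0
    (tildeB₃ N) (tildeB₀ a s + B₀ τ (G 1) (G 2) (G 3)) (tildeB₁ N τ + B₁ (G 1) (G 2)) (B₂ (G 1))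
    (tildeB₃ N) (sub_self _)
    (by
      rw [tildeB₃, B₂, X₁]
      noncomm_ring)
    (by
      rw [tildeB₃, B₂, B₁, X₂]
      noncomm_ring)
    (by
      rw [tildeB₃, B₂, B₁, B₀, tildeB₁, X₃]
      simp only [mul_smul_comm, smul_mul_assoc, add_mul, mul_zero, mul_neg, neg_mul, X₁, smul_sub]
      abel)
  obtain ⟨E, E', hE, hEΓ⟩ := exists_isExtension hc h
  have hP : Differentiable ℂ (laxB a s τ (G 1) (G 2) (G 3)) := by
    unfold laxB
    fun_prop
  have key := deriv_mul_inv_add_eq hE hc (W := gaugeLogDeriv a s τ)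
    (P := laxB a s τ (G 1) (G 2) (G 3)) differentiable_gaugeLogDeriv hP hasDerivAt_fMat
    hasDerivAt_gMat hC (fun β w hw hwr => by
      rw [hEΓ β w hw, gaugeLogDeriv_eq]
      exact hb w (β.interior_subset_compl hc hw) hwr) z
  obtain ⟨β, hβ⟩ := Region.exists_mem_interior hz
  have hd := ((hE.diff_E z).hasDerivAt.mul
    (β.hasDerivAt_mult (hasDerivAt_fMat (a := a) (k := k) (s := s) (τ := τ) z)
      (hasDerivAt_gMat (k := k) z))).mul (hasDerivAt_gauge (a := a) (s := s) (τ := τ) z)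
  have hd' : HasDerivAt (fun w => Γ w * gauge a s τ w)
      (laxB a s τ (G 1) (G 2) (G 3) z * (Γ z * gauge a s τ z)) z := by
    refine (hd.congr_deriv ?_).congr_of_eventuallyEq ?_
    · rw [← hEΓ β z hβ, mul_assoc (E z), ← mul_assoc (laxB _ _ _ _ _ _ _), ← key, Pi.mul_apply]
      noncomm_ring
    · filter_upwards [(Region.isOpen_interior c β).mem_nhds hβ] with w hw
      rw [← hEΓ β w hw]
      rfl
  exact (entryCLM i j).hasFDerivAt.comp_hasDerivAt z hd'

/-- The equation in `s`. -/
theorem hasDerivAt_space (hc : 0 < c) {Γ : ℝ → ℂ → Mat N} {G : ℝ → ℕ → Mat N}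
    (h : ∀ᶠ s' in 𝓝 s, IsRHPSolution c a k s' τ (Γ s') (G s')) {z : ℂ} (hz : z ∈ (contour c)ᶜ)
    (i j : Unit ⊕ Fin N) :
    HasDerivAt (fun s' : ℝ => (Γ s' z * gauge a s' τ z) i j)
      ((laxA (G s 1) z * (Γ s z * gauge a s τ z)) i j) s := by
  obtain ⟨C, r₀, hC, hb⟩ := exists_norm_mul_sub_mul_le_div h.self_of_nhds 0 (A₁ N) 0 0
    (A₀ (G s 1)) (A₁ N) 0 0 (sub_self _) (by simp) (by simp)
    (by
      rw [← X₁_eq_A₀, X₁]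
      simp)
  have hadd : Tendsto (fun t : ℝ => s + t) (𝓝 0) (𝓝 s) :=
    Continuous.tendsto' (by fun_prop) _ _ (by simp)
  -- Raising `s` by `t` lowers every phase by `t μ`, so `λ = μ`.
  have key := hasDerivAt_deformation (s := s) (τ := τ) (lam := fun z => z) hc
    (σ := fun t => s + t) (ρ := fun _ => τ) (fun t x z => by simp only [theta]; push_cast; ring)
    differentiable_id (fun z => by nlinarith [sq_nonneg (‖z‖ - 1)])
    (Γt := fun t => Γ (s + t)) (Gt := fun t => G (s + t)) (by simpa using h.self_of_nhds)
    (hadd.eventually h) (P := laxA (G s 1)) (by unfold laxA; fun_prop) hC (r₀ := r₀)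
    (fun w hw hwr => by simpa [laxA] using hb w hw hwr) hz i j
  rw [← sub_self s] at key
  simpa using key.comp_sub_const s s

/-- The equation in `τ`. -/
theorem hasDerivAt_time (hc : 0 < c) {Γ : ℝ → ℂ → Mat N} {G : ℝ → ℕ → Mat N}
    (h : ∀ᶠ τ' in 𝓝 τ, IsRHPSolution c a k s τ' (Γ τ') (G τ')) {z : ℂ} (hz : z ∈ (contour c)ᶜ)
    (i j : Unit ⊕ Fin N) :
    HasDerivAt (fun τ' : ℝ => (Γ τ' z * gauge a s τ' z) i j)
      ((laxC (G τ 1) (G τ 2) z * (Γ τ z * gauge a s τ z)) i j) τ := by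
  obtain ⟨C, r₀, hC, hb⟩ := exists_norm_mul_sub_mul_le_div h.self_of_nhds 0 0
    ((1 / 2 : ℂ) • A₁ N) 0 (C₀ (G τ 1) (G τ 2)) (C₁ (G τ 1)) ((1 / 2 : ℂ) • A₁ N) 0 (sub_self _)
    (by simp)
    (by
      rw [C₁, X₁]
      simp only [mul_smul_comm, smul_mul_assoc, smul_sub]
      simp)
    (by
      rw [C₀, C₁, X₂]
      simp only [mul_smul_comm, smul_mul_assoc, smul_sub, mul_zero, zero_mul]
      abel)
  have hadd : Tendsto (fun t : ℝ => τ + t) (𝓝 0) (𝓝 τ) :=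
    Continuous.tendsto' (by fun_prop) _ _ (by simp)
  -- Raising `τ` by `t` lowers every phase by `t μ² / 2`, so `λ = μ² / 2`.
  have key := hasDerivAt_deformation (s := s) (τ := τ) (lam := fun z => z ^ 2 / 2) hc
    (σ := fun _ => s) (ρ := fun t => τ + t) (fun t x z => by simp only [theta]; push_cast; ring)
    (by fun_prop) (fun z => by
      rw [norm_div, norm_pow, Complex.norm_ofNat]
      nlinarith [sq_nonneg ‖z‖])
    (Γt := fun t => Γ (τ + t)) (Gt := fun t => G (τ + t)) (by simpa using h.self_of_nhds)
    (hadd.eventually h) (P := laxC (G τ 1) (G τ 2)) (by unfold laxC; fun_prop) hC (r₀ := r₀)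
    (fun w hw hwr => by
      have := hb w hw hwr
      simpa [laxC, smul_smul, div_eq_mul_inv] using this) hz i j
  rw [← sub_self τ] at key
  simpa using key.comp_sub_const τ τ

end LaxPair

end Pearcey

theorem mainTheorem5 {N : ℕ} (hN : 1 < N) (a : Fin N → ℝ) (ha : StrictMono a)
    (k : Fin (N + 1) → ℝ) (hk_first : k 0 = 0) (hk_last : k (Fin.last N) = 0)
    (hk_mem : ∀ j, k j ∈ Set.Icc (0 : ℝ) 1) (hk_ne : ∀ j : Fin N, k j.castSucc ≠ k j.succ)
    {c : ℝ} (hc : 0 < c) (U : Set (ℝ × ℝ)) (hU : IsOpen U)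
    (Γ : ℝ → ℝ → ℂ → Pearcey.Mat N) (G : ℝ → ℝ → ℕ → Pearcey.Mat N)
    (hΓ : ∀ s τ : ℝ, (s, τ) ∈ U → Pearcey.IsRHPSolution c a k s τ (Γ s τ) (G s τ)) :
    ∀ s τ : ℝ, (s, τ) ∈ U → ∀ μ ∈ (Pearcey.contour c)ᶜ,
      ∀ i j : Unit ⊕ Fin N,
        HasDerivAt (fun s' : ℝ => Pearcey.Psi a Γ s' τ μ i j)
          ((Pearcey.laxA (G s τ 1) μ * Pearcey.Psi a Γ s τ μ) i j) s ∧
        HasDerivAt (fun μ' : ℂ => Pearcey.Psi a Γ s τ μ' i j)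
          ((Pearcey.laxB a s τ (G s τ 1) (G s τ 2) (G s τ 3) μ * Pearcey.Psi a Γ s τ μ) i j) μ ∧
        HasDerivAt (fun τ' : ℝ => Pearcey.Psi a Γ s τ' μ i j)
          ((Pearcey.laxC (G s τ 1) (G s τ 2) μ * Pearcey.Psi a Γ s τ μ) i j) τ := by
  intro s τ hU' μ hμ i j
  have hs : ∀ᶠ s' in 𝓝 s, (s', τ) ∈ U :=
    (Continuous.tendsto (by fun_prop : Continuous fun s' : ℝ => (s', τ)) s).eventually
      (hU.mem_nhds hU')
  have hτ : ∀ᶠ τ' in 𝓝 τ, (s, τ') ∈ U :=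
    (Continuous.tendsto (by fun_prop : Continuous fun τ' : ℝ => (s, τ')) τ).eventually
      (hU.mem_nhds hU')
  exact ⟨Pearcey.hasDerivAt_space hc (Γ := fun s' => Γ s' τ) (G := fun s' => G s' τ)
      (hs.mono fun s' h => hΓ s' τ h) hμ i j,
    Pearcey.hasDerivAt_spectral hc (hΓ s τ hU') hμ i j,
    Pearcey.hasDerivAt_time hc (Γ := Γ s) (G := G s) (hτ.mono fun τ' h => hΓ s τ' h) hμ i j⟩
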